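/- Let $\varepsilon>0$ and consider, in the half-space $\{u_2\ge 0\}\subset\mathbb R^3$, the system $$\frac{du_2}{d\eta}=\sqrt\varepsilon\,u_2p_2,\qquad \frac{dp_2}{d\eta}=\tfrac23u_2^3+\tfrac12\sqrt\varepsilon\,(p_2^2-q_2^2),\qquad \frac{dq_2}{d\eta}=u_2^2,$$ which is the desingularized restriction (with $dy=u_2\,d\eta$) of $u_2'=\sqrt\varepsilon p_2,\ p_2'=u_2^2-v_2,\ v_2'=\sqrt\varepsilon q_2,\ q_2'=u_2$ to the zero level set of $H_2=\frac12\sqrt\varepsilon(p_2^2-q_2^2)+u_2v_2-\frac13u_2^3$. Let $E$ be its set of equilibria in $\{u_2\ge0\}$ and let $$\mathscr L_-^{u}=\{(0,-q,q):q<0\},\quad \mathscr L_-^{s}=\{(0,-q,q):q>0\},\quad \mathscr L_+^{u}=\{(0,q,q):q>0\},\quad \mathscr L_+^{s}=\{(0,q,q):q<0\}.$$ Let $\Gamma_0(y)=\left(\frac1{12}\sqrt\varepsilon\,y^2,\ \frac16y,\ \frac1{36}\sqrt\varepsilon\,y^3\right)$ be the $(u_2,p_2,q_2)$ components of the algebraic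 solution, with halves $\Gamma_0^-=\Gamma_0(\{y\le0\})$ and $\Gamma_0^+=\Gamma_0(\{y\ge0\})$. The stable manifold $W^s(\Gamma_0^-)$ is the set of points of $\{u_2\ge0\}$ whose solution exists for all $\eta\ge0$, stays in $\{u_2\ge0\}$ and has distance to $\Gamma_0^-$ tending to $0$ as $\eta\to+\infty$; the unstable manifold $W^u(\Gamma_0^+)$ is the set of points whose solution exists for all $\eta\le0$, stays in $\{u_2\ge0\}$ and has distance to $\Gamma_0^+$ tending to $0$ as $\eta\to-\infty$. A solution in $\{u_2\ge0\}$ defined for all $\eta\in\mathbb R$ is called a heteroclinic of class 1 if it connects (from $\eta\to-\infty$ to $\eta\to+\infty$) a point of $\mathscr L_-^u$ to a point of $\mathscr L_-^s$; of class 2 if it connects a point of $\mathscr L_-^u$ to a point of $\mathscr L_+^s$; of class 3 if it connects a point of $\mathscr L_+^u$ to a point of $\mathscr L_-^s$. Let $C_i$ be the union of the orbits of the class $i$ heteroclinics. Then: 1. Each of the three classes contains heteroclinics lying in $\{u_2>0\}$, and every nonconstant solution in $\{u_2\ge0\}$ connecting two points of $\mathscr L_-^u\cup\mathscr L_-^s\cup\mathscr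 L_+^u\cup\mathscr L_+^s$ belongs to one of the three classes. 2. $W^s(\Gamma_0^-)$ is the phase-space boundary between the class 1 and the class 2 heteroclinics. That is, with $D$ the set of points whose backward solution converges to a point of $\mathscr L_-^u$: $C_1\cap C_2=\emptyset$; $(\partial C_1\cap\partial C_2)\setminus E\subset W^s(\Gamma_0^-)$; $W^s(\Gamma_0^-)\cap D\subset\partial C_1\cap\partial C_2$; every connected subset of $D\setminus E$ that meets both $C_1$ and $C_2$ meets $W^s(\Gamma_0^-)$; and $\Gamma_0^-\subset W^s(\Gamma_0^-)\cap\partial C_1\cap\partial C_2$. 3. $W^u(\Gamma_0^+)$ is the phase-space boundary between the class 1 and the class 3 heteroclinics. That is, with $D'$ the set of points whose forward solution converges to a point of $\mathscr L_-^s$: $C_1\cap C_3=\emptyset$; $(\partial C_1\cap\partial C_3)\setminus E\subset W^u(\Gamma_0^+)$; $W^u(\Gamma_0^+)\cap D'\subset\partial C_1\cap\partial C_3$; every connected subset of $D'\setminus E$ that meets both $C_1$ and $C_3$ meets $W^u(\Gamma_0^+)$; and $\Gamma_0^+\subset W^u(\Gamma_0^+)\cap\partial C_1\cap\partial C_3$.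 Here $\partial$ denotes the topological boundary in $\mathbb R^3$. -/

import Mathlib

open Set Filter Topology

noncomputable section

/-- The phase space, with coordinates `(u, p, q)` (written `u₂, p₂, q₂` in rescaled coordinates). -/
abbrev Phase : Type := ℝ × ℝ × ℝ

/-- The desingularized vector field on the zero level set of the Hamiltonian
`H₂ = (√ε / 2) (p² - q²) + u v - u³ / 3`, after elimination of `v` and the time change
`dy = u dη`:
`u' = √ε u p`, `p' = (2/3) u³ + (√ε / 2) (p² - q²)`, `q' = u²`. -/
def field (ε : ℝ) (x : Phase) : Phase :=
  (√ε * x.1 * x.2.1,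
    2 / 3 * x.1 ^ 3 + 1 / 2 * √ε * (x.2.1 ^ 2 - x.2.2 ^ 2),
    x.1 ^ 2)

/-- The closed half-space `{u ≥ 0}`. -/
def halfSpace : Set Phase := {x | 0 ≤ x.1}

/-- `γ` solves the system on the time interval `J` and stays in the half-space `{u ≥ 0}`. -/
def IsSolutionOn (ε : ℝ) (J : Set ℝ) (γ : ℝ → Phase) : Prop :=
  ∀ t ∈ J, HasDerivWithinAt γ (field ε (γ t)) J t ∧ γ t ∈ halfSpace

/-- The equilibria of the system in `{u ≥ 0}`. -/
def equilibria (ε : ℝ) : Set Phase := {x | x ∈ halfSpace ∧ field ε x = 0}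

/-- The line `u = 0`, `p = q`. -/
def linePlus : Set Phase := {x | x.1 = 0 ∧ x.2.1 = x.2.2}

/-- The line `u = 0`, `p = -q`. -/
def lineMinus : Set Phase := {x | x.1 = 0 ∧ x.2.1 = -x.2.2}

/-- The center-unstable half of the line `p = q`. -/
def linePlusU : Set Phase := {x | x ∈ linePlus ∧ 0 < x.2.2}

/-- The center-stable half of the line `p = q`. -/
def linePlusS : Set Phase := {x | x ∈ linePlus ∧ x.2.2 < 0}

/-- The center-unstable half of the line `p = -q`. -/
def lineMinusU : Set Phase := {x | x ∈ lineMinus ∧ x.2.2 < 0}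

/-- The center-stable half of the line `p = -q`. -/
def lineMinusS : Set Phase := {x | x ∈ lineMinus ∧ 0 < x.2.2}

/-- `γ` is a solution in `{u ≥ 0}`, defined for all times, that connects a point of `A`
(as the time tends to `-∞`) to a point of `B` (as the time tends to `+∞`). -/
def Connects (ε : ℝ) (A B : Set Phase) (γ : ℝ → Phase) : Prop :=
  IsSolutionOn ε univ γ ∧
    ∃ a ∈ A, ∃ b ∈ B, Tendsto γ atBot (𝓝 a) ∧ Tendsto γ atTop (𝓝 b)

/-- Class 1 heteroclinics. -/
def IsClass1 (ε : ℝ) (γ : ℝ → Phase) : Prop := Connects ε lineMinusU lineMinusS γ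

/-- Class 2 heteroclinics. -/
def IsClass2 (ε : ℝ) (γ : ℝ → Phase) : Prop := Connects ε lineMinusU linePlusS γ

/-- Class 3 heteroclinics. -/
def IsClass3 (ε : ℝ) (γ : ℝ → Phase) : Prop := Connects ε linePlusU lineMinusS γ

/-- The part of the phase space that is filled by the class 1 heteroclinics. -/
def region1 (ε : ℝ) : Set Phase := {x | ∃ γ, IsClass1 ε γ ∧ x ∈ range γ}

/-- The part of the phase space that is filled by the class 2 heteroclinics. -/
def region2 (ε : ℝ) : Set Phase := {x | ∃ γ, IsClass2 ε γ ∧ x ∈ range γ}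

/-- The part of the phase space that is filled by the class 3 heteroclinics. -/
def region3 (ε : ℝ) : Set Phase := {x | ∃ γ, IsClass3 ε γ ∧ x ∈ range γ}

/-- The `(u, p, q)` components of the algebraic solution `Γ₀`, parametrized by the
original independent variable `y`. -/
def algebraicSolution (ε : ℝ) (y : ℝ) : Phase :=
  (1 / 12 * √ε * y ^ 2, 1 / 6 * y, 1 / 36 * √ε * y ^ 3)

/-- The half `y ≤ 0` of the algebraic solution. -/
def gammaMinus (ε : ℝ) : Set Phase := algebraicSolution ε '' Iic 0

/-- The half `y ≥ 0` of the algebraic solution. -/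
def gammaPlus (ε : ℝ) : Set Phase := algebraicSolution ε '' Ici 0

/-- The (global) stable manifold in `{u ≥ 0}` of a set `A`: the points whose forward solution
exists for all positive times and is asymptotic to `A`. -/
def stableManifold (ε : ℝ) (A : Set Phase) : Set Phase :=
  {x | ∃ γ, IsSolutionOn ε (Ici 0) γ ∧ γ 0 = x ∧
    Tendsto (fun t => Metric.infDist (γ t) A) atTop (𝓝 0)}

/-- The (global) unstable manifold in `{u ≥ 0}` of a set `A`: the points whose backward solution
exists for all negative times and is asymptotic to `A`. -/
def unstableManifold (ε : ℝ) (A : Set Phase) : Set Phase :=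
  {x | ∃ γ, IsSolutionOn ε (Iic 0) γ ∧ γ 0 = x ∧
    Tendsto (fun t => Metric.infDist (γ t) A) atBot (𝓝 0)}

/-- The points whose backward solution converges to a point of `A`. -/
def emanatesFrom (ε : ℝ) (A : Set Phase) : Set Phase :=
  {x | ∃ γ, IsSolutionOn ε (Iic 0) γ ∧ γ 0 = x ∧ ∃ a ∈ A, Tendsto γ atBot (𝓝 a)}

/-- The points whose forward solution converges to a point of `A`. -/
def terminatesAt (ε : ℝ) (A : Set Phase) : Set Phase :=
  {x | ∃ γ, IsSolutionOn ε (Ici 0) γ ∧ γ 0 = x ∧ ∃ a ∈ A, Tendsto γ atTop (𝓝 a)}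

/-- `W` is the phase-space boundary between the disjoint regions `C` and `C'`, among the
nonstationary trajectories that fill the set `D` (`E` is the set of equilibria):
every nonstationary common boundary point of the regions lies on `W`; conversely every
point of `W ∩ D` is a common boundary point; and within `D`, equilibria removed,
one cannot pass from `C` to `C'` without meeting `W`. -/
def IsBoundaryBetween (W C C' D E : Set Phase) : Prop :=
  Disjoint C C' ∧
  (frontier C ∩ frontier C') \ E ⊆ W ∧
  W ∩ D ⊆ frontier C ∩ frontier C' ∧
  ∀ T : Set Phase, IsPreconnected T → T ⊆ D \ E →
    (T ∩ C).Nonempty → (T ∩ C').Nonempty → (T ∩ W).Nonempty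

end

/-!
Write `s = √ε`. A solution in the half-space along which eventually `p ≤ 0` and `q` is bounded
converges to an equilibrium `(0, -|Q|, Q)`, that is, to a point of `lineMinusS` if `Q > 0`, to a
point of `linePlusS` if `Q < 0`, and to the origin if `Q = 0` (`IsSolutionOn.exists_tendsto`). The
basins `terminatesAt ε lineMinusS` and `terminatesAt ε linePlusS` are relatively open in the
half-space, and the classes 1 and 2 fill the parts of `emanatesFrom ε lineMinusU` in the first and
in the second of them. A point of the closure of `terminatesAt ε linePlusS` that is no equilibrium
either lies in that basin or has a forward orbit that tends to the origin
(`mem_of_mem_closure_terminatesAt`), and for `u > 0` the latter means that it lies on the stable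
manifold of `gammaMinus ε`. So the stable manifold separates the two classes; what remains is that
its points are limits of both classes.

Openness comes from trapping regions. In `{p < 0, p² > (2 / (3 s)) u³}` the quantity `u` decreases
so fast that `q`, which is nondecreasing, converges and `u → 0`, `p → -|q|`. A subregion with
`q + u / s < 0` lies in the basin of `linePlusS` (`trapPlus`). In
`{p < 0, q > 0, u³ < (3 s / 4) q²}` the value of `p` stays away from zero, and the region lies in
the basin of `lineMinusS` (`trapMinus`).

The points of the stable manifold with `u > 0` are limits of both basins, because the system is
cooperative in `{q ≤ 0}`: solutions keep the componentwise order of their initial points. If the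
orbit of `x` tends to the origin, raising the `p` component of `x` therefore makes `q` become
positive, and the orbit ends on `lineMinusS`; lowering the `q` component keeps `q` negative and
bounded away from zero, and the orbit ends on `linePlusS`.

To see that the points of `gammaMinus ε` itself are such limits, nearby points of
`emanatesFrom ε lineMinusU` are needed. The functions `K = u³ - (3 s / 4) q²`, `L = u p - q / 2`,
`M = (3 s / 2) p² - u / 2` vanish on the algebraic solution and satisfy a linear system,
`K' = 3 s u² L`, `L' = (2 / 3) u K + u M`, `M' = s p (2 K + M)`, which is cooperative for `p ≥ 0`.
So the cone `K ≤ 0`, `L < 0`, `M ≤ 0` is kept while `p ≥ 0`, and there a bound on `u` forces `p` to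
reach zero, after which the orbit is trapped by the basin of `lineMinusS`
(`mem_terminatesAt_of_defects`). Time reversal `(u, p, q) ↦ (u, -p, -q)` turns this into a statement
about `emanatesFrom ε lineMinusU`; it also exchanges `gammaMinus ε` and `gammaPlus ε`, and reduces
the assertions about the unstable manifold to those about the stable manifold.
-/

/-! ### Differential inequalities on the line -/

lemma hasDerivAt_min_zero_sq (x : ℝ) :
    HasDerivAt (fun x : ℝ => (min x 0) ^ 2) (2 * min x 0) x := by
  rcases lt_trichotomy x 0 with hx | hx | hx
  · have h : HasDerivAt (fun x : ℝ => x ^ 2) (2 * x) x := by simpa using hasDerivAt_pow 2 x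
    rw [min_eq_left hx.le]
    refine h.congr_of_eventuallyEq ?_
    filter_upwards [Iio_mem_nhds hx] with y hy
    rw [min_eq_left (le_of_lt hy)]
  · subst hx
    rw [min_self, mul_zero, hasDerivAt_iff_isLittleO]
    have h1 : (fun y : ℝ => y ^ 2) =o[𝓝 0] fun y => y := by
      simpa using Asymptotics.isLittleO_pow_id (𝕜 := ℝ) (one_lt_two)
    refine Asymptotics.IsBigO.trans_isLittleO (Asymptotics.IsBigO.of_bound 1 ?_)
      (by simpa using h1)
    refine Eventually.of_forall fun y => ?_
    rcases le_total y 0 with hy | hy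
    · simp [min_eq_left hy]
    · simp [min_eq_right hy]
      positivity
  · rw [min_eq_right hx.le, mul_zero]
    refine (hasDerivAt_const x (0 : ℝ)).congr_of_eventuallyEq ?_
    filter_upwards [Ioi_mem_nhds hx] with y hy
    rw [min_eq_right (le_of_lt hy)]
    simp

lemma monotoneOn_Icc_of_deriv {f f' : ℝ → ℝ} {a b : ℝ}
    (hf : ∀ t ∈ Icc a b, HasDerivWithinAt f (f' t) (Icc a b) t)
    (h : ∀ t ∈ Icc a b, 0 ≤ f' t) : MonotoneOn f (Icc a b) :=
  monotoneOn_of_hasDerivWithinAt_nonneg (convex_Icc a b)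
    (fun t ht => (hf t ht).continuousWithinAt)
    (fun t ht => (hf t (interior_subset ht)).mono interior_subset)
    (fun t ht => h t (interior_subset ht))

lemma antitoneOn_Icc_of_deriv {f f' : ℝ → ℝ} {a b : ℝ}
    (hf : ∀ t ∈ Icc a b, HasDerivWithinAt f (f' t) (Icc a b) t)
    (h : ∀ t ∈ Icc a b, f' t ≤ 0) : AntitoneOn f (Icc a b) :=
  antitoneOn_of_hasDerivWithinAt_nonpos (convex_Icc a b)
    (fun t ht => (hf t ht).continuousWithinAt)
    (fun t ht => (hf t (interior_subset ht)).mono interior_subset)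
    (fun t ht => h t (interior_subset ht))

/-- Invariance of the nonnegative orthant under a linear differential inequality whose matrix has
nonnegative off-diagonal entries. The inequality for a component is needed only where that
component is negative. -/
lemma nonneg_of_cooperative {ι : Type*} [Fintype ι] {f f' : ι → ℝ → ℝ} {A : ι → ι → ℝ → ℝ}
    {a b : ℝ} (hf : ∀ i, ∀ t ∈ Icc a b, HasDerivWithinAt (f i) (f' i t) (Icc a b) t)
    (hA : ∀ i j, ContinuousOn (A i j) (Icc a b))
    (hoff : ∀ i j, i ≠ j → ∀ t ∈ Icc a b, 0 ≤ A i j t)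
    (hle : ∀ i, ∀ t ∈ Icc a b, f i t < 0 → ∑ j, A i j t * f j t ≤ f' i t)
    (h0 : ∀ i, 0 ≤ f i a) : ∀ t ∈ Icc a b, ∀ i, 0 ≤ f i t := by
  classical
  choose C hC using fun i j => isCompact_Icc.exists_bound_of_continuousOn (hA i j)
  set M : ℝ := ∑ i, ∑ j, |C i j| with hM
  have hCM : ∀ i j, ∀ t ∈ Icc a b, |A i j t| ≤ M := by
    intro i j t ht
    have h1 := hC i j t ht
    rw [Real.norm_eq_abs] at h1
    calc |A i j t| ≤ |C i j| := h1.trans (le_abs_self _)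
      _ ≤ ∑ j, |C i j| := Finset.single_le_sum (f := fun j => |C i j|)
          (fun j _ => abs_nonneg _) (Finset.mem_univ j)
      _ ≤ M := Finset.single_le_sum (f := fun i => ∑ j, |C i j|)
          (fun i _ => Finset.sum_nonneg fun j _ => abs_nonneg _) (Finset.mem_univ i)
  set n : ℝ := (Fintype.card ι : ℝ) with hn
  -- Gronwall's inequality for the sum `V` of the squares of the negative parts
  set V : ℝ → ℝ := fun t => ∑ i, (min (f i t) 0) ^ 2 with hV
  set V' : ℝ → ℝ := fun t => ∑ i, 2 * min (f i t) 0 * f' i t with hV'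
  have hVd : ∀ t ∈ Icc a b, HasDerivWithinAt V (V' t) (Icc a b) t := by
    intro t ht
    exact HasDerivWithinAt.fun_sum fun i _ =>
      (hasDerivAt_min_zero_sq (f i t)).comp_hasDerivWithinAt t (hf i t ht)
  have hVle : ∀ t ∈ Icc a b, V' t ≤ 2 * M * n * V t := by
    intro t ht
    have key : ∀ i, 2 * min (f i t) 0 * f' i t ≤
        ∑ j, M * ((min (f i t) 0) ^ 2 + (min (f j t) 0) ^ 2) := by
      intro i
      have hM0 : 0 ≤ M := (abs_nonneg _).trans (hCM i i t ht)
      rcases le_or_gt 0 (f i t) with h | h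
      · rw [min_eq_right h]
        simp only [mul_zero, zero_mul]
        exact Finset.sum_nonneg fun j _ => by positivity
      · have hmi : min (f i t) 0 = f i t := min_eq_left h.le
        rw [hmi]
        have h1 : 2 * f i t * f' i t ≤ 2 * f i t * ∑ j, A i j t * f j t :=
          mul_le_mul_of_nonpos_left (hle i t ht h) (by linarith)
        refine h1.trans ?_
        rw [Finset.mul_sum]
        refine Finset.sum_le_sum fun j _ => ?_
        have hA1 := hCM i j t ht
        have h2 : 2 * f i t * (A i j t * f j t) ≤ 2 * M * (|f i t| * |min (f j t) 0|) := by
          rcases le_or_gt 0 (f j t) with hj | hj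
          · have hij : i ≠ j := by rintro rfl; linarith
            rw [min_eq_right hj]
            simp only [abs_zero, mul_zero]
            have := mul_nonneg (hoff i j hij t ht) hj
            nlinarith
          · rw [min_eq_left hj.le]
            calc 2 * f i t * (A i j t * f j t) ≤ |2 * f i t * (A i j t * f j t)| := le_abs_self _
              _ = |A i j t| * (2 * (|f i t| * |f j t|)) := by
                  simp only [abs_mul, abs_two]; ring
              _ ≤ M * (2 * (|f i t| * |f j t|)) :=
                  mul_le_mul_of_nonneg_right hA1 (by positivity)
              _ = _ := by ring
        have h3 : 2 * (|f i t| * |min (f j t) 0|) ≤ f i t ^ 2 + (min (f j t) 0) ^ 2 := by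
          have := two_mul_le_add_sq (|f i t|) (|min (f j t) 0|)
          rw [sq_abs, sq_abs] at this
          linarith
        nlinarith
    calc V' t ≤ ∑ i, ∑ j, M * ((min (f i t) 0) ^ 2 + (min (f j t) 0) ^ 2) :=
          Finset.sum_le_sum fun i _ => key i
      _ = 2 * M * n * V t := by
          simp only [← Finset.mul_sum, Finset.sum_add_distrib, Finset.sum_const, Finset.card_univ,
            nsmul_eq_mul, hV, hn]
          ring
  have hanti : AntitoneOn (fun t => V t * Real.exp (-(2 * M * n) * t)) (Icc a b) := by
    refine antitoneOn_Icc_of_deriv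
      (f' := fun t => V' t * Real.exp (-(2 * M * n) * t) +
        V t * (Real.exp (-(2 * M * n) * t) * (-(2 * M * n) * 1))) ?_ ?_
    · intro t ht
      exact (hVd t ht).mul
        (((hasDerivAt_id t).const_mul (-(2 * M * n))).exp.hasDerivWithinAt)
    · intro t ht
      have := hVle t ht
      have he := Real.exp_pos (-(2 * M * n) * t)
      nlinarith
  intro t ht i
  have ha : a ∈ Icc a b := ⟨le_rfl, ht.1.trans ht.2⟩
  have h1 := hanti ha ht ht.1
  have hVa : V a = 0 := by
    simp only [hV]
    exact Finset.sum_eq_zero fun i _ => by rw [min_eq_right (h0 i)]; simp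
  simp only [hVa, zero_mul] at h1
  have hVt : V t ≤ 0 := by
    by_contra hcon
    push Not at hcon
    have := mul_pos hcon (Real.exp_pos (-(2 * M * n) * t))
    linarith
  have h2 : (min (f i t) 0) ^ 2 ≤ V t :=
    Finset.single_le_sum (f := fun i => (min (f i t) 0) ^ 2) (fun i _ => sq_nonneg _)
      (Finset.mem_univ i)
  have h3 : min (f i t) 0 = 0 := by
    have : (min (f i t) 0) ^ 2 = 0 := le_antisymm (h2.trans hVt) (sq_nonneg _)
    exact pow_eq_zero_iff (two_ne_zero) |>.1 this
  exact min_eq_right_iff.1 h3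

lemma nonneg_of_deriv_ge_mul {f f' A : ℝ → ℝ} {a b : ℝ}
    (hf : ∀ t ∈ Icc a b, HasDerivWithinAt f (f' t) (Icc a b) t)
    (hA : ContinuousOn A (Icc a b))
    (hle : ∀ t ∈ Icc a b, f t < 0 → A t * f t ≤ f' t)
    (h0 : 0 ≤ f a) : ∀ t ∈ Icc a b, 0 ≤ f t := fun t ht =>
  nonneg_of_cooperative (ι := Unit) (f := fun _ => f) (f' := fun _ => f') (A := fun _ _ => A)
    (fun _ => hf) (fun _ _ => hA) (fun i j h => absurd rfl h) (by simpa using hle)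
    (fun _ => h0) t ht ()

lemma pos_of_deriv_ge_mul {f f' A : ℝ → ℝ} {a b : ℝ}
    (hf : ∀ t ∈ Icc a b, HasDerivWithinAt f (f' t) (Icc a b) t)
    (hA : ContinuousOn A (Icc a b))
    (hle : ∀ t ∈ Icc a b, A t * f t ≤ f' t)
    (h0 : 0 < f a) : ∀ t ∈ Icc a b, 0 < f t := by
  have hnn := nonneg_of_deriv_ge_mul hf hA (fun t ht _ => hle t ht) h0.le
  obtain ⟨C, hC⟩ := isCompact_Icc.exists_bound_of_continuousOn hA
  have hmono : MonotoneOn (fun t => f t * Real.exp (C * t)) (Icc a b) := by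
    refine monotoneOn_Icc_of_deriv
      (f' := fun t => f' t * Real.exp (C * t) + f t * (Real.exp (C * t) * (C * 1))) ?_ ?_
    · intro t ht
      exact (hf t ht).mul (((hasDerivAt_id t).const_mul C).exp.hasDerivWithinAt)
    · intro t ht
      have h1 := hC t ht
      rw [Real.norm_eq_abs, abs_le] at h1
      have h2 := hle t ht
      have h3 := hnn t ht
      have he := Real.exp_pos (C * t)
      have h4 : 0 ≤ f' t + f t * C := by nlinarith
      calc (0 : ℝ) ≤ (f' t + f t * C) * Real.exp (C * t) := by positivity
        _ = _ := by ring
  intro t ht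
  have h1 := hmono ⟨le_rfl, ht.1.trans ht.2⟩ ht ht.1
  simp only at h1
  have h2 := mul_pos h0 (Real.exp_pos (C * a))
  by_contra hcon
  push Not at hcon
  have := mul_nonpos_of_nonpos_of_nonneg hcon (Real.exp_pos (C * t)).le
  linarith

lemma eq_zero_of_deriv_eq_mul {f A : ℝ → ℝ} {a b : ℝ}
    (hf : ∀ t ∈ Icc a b, HasDerivWithinAt f (A t * f t) (Icc a b) t)
    (hA : ContinuousOn A (Icc a b)) (h0 : f a = 0) : ∀ t ∈ Icc a b, f t = 0 := by
  intro t ht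
  have h1 := nonneg_of_deriv_ge_mul hf hA (fun _ _ _ => le_rfl) h0.ge t ht
  have h2 := nonneg_of_deriv_ge_mul (f := fun t => -f t) (fun t ht => (hf t ht).neg) hA
    (fun t _ _ => by simp) (by simp [h0]) t ht
  linarith

/-- Continuous induction for an open condition on a compact interval. -/
lemma forall_Icc_of_open_induction {P : ℝ → Prop} {a b : ℝ}
    (hopen : ∀ t ∈ Icc a b, P t → ∀ᶠ r in 𝓝[Icc a b] t, P r) (h0 : P a)
    (hstep : ∀ t ∈ Ioc a b, (∀ r ∈ Ico a t, P r) → P t) : ∀ t ∈ Icc a b, P t := by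
  intro t ht
  by_contra hcon
  set B : Set ℝ := {r | r ∈ Icc a b ∧ ¬ P r} with hB
  have hBne : B.Nonempty := ⟨t, ht, hcon⟩
  have hBb : BddBelow B := ⟨a, fun r hr => hr.1.1⟩
  set c := sInf B with hc
  have hca : a ≤ c := le_csInf hBne fun r hr => hr.1.1
  have hcb : c ≤ b := (csInf_le hBb ⟨ht, hcon⟩).trans ht.2
  have hlt : ∀ r ∈ Ico a c, P r := by
    intro r hr
    by_contra hnr
    exact absurd (csInf_le hBb ⟨⟨hr.1, hr.2.le.trans hcb⟩, hnr⟩) (not_le.2 hr.2)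
  have hPc : P c := by
    rcases hca.eq_or_lt with h | h
    · rw [← h]; exact h0
    · exact hstep c ⟨h, hcb⟩ hlt
  have h1 := hopen c ⟨hca, hcb⟩ hPc
  rw [eventually_nhdsWithin_iff, Metric.eventually_nhds_iff] at h1
  obtain ⟨δ, hδ, h1⟩ := h1
  obtain ⟨r, hr, hrc⟩ := exists_lt_of_csInf_lt hBne (show sInf B < c + δ by linarith)
  have hcr : c ≤ r := csInf_le hBb hr
  refine hr.2 (h1 ?_ hr.1)
  rw [Real.dist_eq, abs_of_nonneg (by linarith)]
  linarith

/-- A differentiable function that decreases at a definite rate wherever it is at least `β`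
is eventually at most `β`. -/
lemma eventually_le_of_deriv_le {f f' : ℝ → ℝ} {T β c : ℝ} (hc : 0 < c)
    (hf : ∀ t ∈ Ici T, HasDerivWithinAt f (f' t) (Ici T) t)
    (h : ∀ t ∈ Ici T, β ≤ f t → f' t ≤ -c) : ∀ᶠ t in atTop, f t ≤ β := by
  have hsub : ∀ {a b : ℝ}, T ≤ a → ∀ t ∈ Icc a b, HasDerivWithinAt f (f' t) (Icc a b) t :=
    fun ha t ht => (hf t (ha.trans ht.1)).mono fun r hr => ha.trans hr.1
  have hex : ∃ t0 ≥ T, f t0 ≤ β := by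
    by_contra hcon
    push Not at hcon
    have hb : ∀ t ≥ T, f t + c * t ≤ f T + c * T := by
      intro t ht
      have := antitoneOn_Icc_of_deriv (f := fun t => f t + c * t) (f' := fun t => f' t + c * 1)
        (a := T) (b := t)
        (fun r hr => (hsub le_rfl r hr).add (((hasDerivAt_id r).const_mul c).hasDerivWithinAt))
        (fun r hr => by have := h r hr.1 (hcon r hr.1).le; linarith)
      exact this ⟨le_rfl, ht⟩ ⟨ht, le_rfl⟩ ht
    set t := T + (|f T - β| + 1) / c with ht
    have ht1 : T ≤ t := by rw [ht]; have : 0 ≤ (|f T - β| + 1) / c := by positivity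
                           linarith
    have h1 := hb t ht1
    have h2 := hcon t ht1
    have h3 : c * t = c * T + (|f T - β| + 1) := by rw [ht]; field_simp
    have h4 := le_abs_self (f T - β)
    linarith
  obtain ⟨t0, ht0, hft0⟩ := hex
  filter_upwards [eventually_ge_atTop t0] with t ht
  have := nonneg_of_deriv_ge_mul (f := fun t => β - f t) (f' := fun t => - f' t) (A := fun _ => 0)
    (a := t0) (b := t) (fun r hr => by simpa using (hsub ht0 r hr).const_sub β)
    continuousOn_const (fun r hr hlt => by
      have := h r (ht0.trans hr.1) (by linarith)
      linarith) (by simpa using hft0) t ⟨ht, le_rfl⟩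
  simpa using this

/-! ### Solutions: restriction, gluing, existence, dependence on initial points -/

lemma le_on_Icc_of_le_on_Ico {f : ℝ → ℝ} {a t c : ℝ} (hat : a < t)
    (hf : ContinuousOn f (Icc a t)) (h : ∀ r ∈ Ico a t, f r ≤ c) : ∀ r ∈ Icc a t, f r ≤ c := by
  have h1 : MapsTo f (Ico a t) (Iic c) := h
  have h2 := h1.closure_of_continuousOn (by rwa [closure_Ico hat.ne])
  rw [closure_Ico hat.ne, isClosed_Iic.closure_eq] at h2
  exact h2

lemma ge_on_Icc_of_ge_on_Ico {f : ℝ → ℝ} {a t c : ℝ} (hat : a < t)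
    (hf : ContinuousOn f (Icc a t)) (h : ∀ r ∈ Ico a t, c ≤ f r) : ∀ r ∈ Icc a t, c ≤ f r := by
  have h1 : MapsTo f (Ico a t) (Ici c) := h
  have h2 := h1.closure_of_continuousOn (by rwa [closure_Ico hat.ne])
  rw [closure_Ico hat.ne, isClosed_Ici.closure_eq] at h2
  exact h2

namespace IsSolutionOn

variable {ε : ℝ} {J J' : Set ℝ} {γ δ : ℝ → Phase} {a b : ℝ}

lemma mono (h : IsSolutionOn ε J γ) (hJ : J' ⊆ J) : IsSolutionOn ε J' γ :=
  fun t ht => ⟨(h t (hJ ht)).1.mono hJ, (h t (hJ ht)).2⟩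

lemma deriv_u (h : IsSolutionOn ε J γ) {t : ℝ} (ht : t ∈ J) :
    HasDerivWithinAt (fun t => (γ t).1) (√ε * (γ t).1 * (γ t).2.1) J t := by
  simpa [field] using (h t ht).1.hasFDerivWithinAt.fst.hasDerivWithinAt

lemma deriv_p (h : IsSolutionOn ε J γ) {t : ℝ} (ht : t ∈ J) :
    HasDerivWithinAt (fun t => (γ t).2.1)
      (2 / 3 * (γ t).1 ^ 3 + 1 / 2 * √ε * ((γ t).2.1 ^ 2 - (γ t).2.2 ^ 2)) J t := by
  simpa [field] using (h t ht).1.hasFDerivWithinAt.snd.fst.hasDerivWithinAt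

lemma deriv_q (h : IsSolutionOn ε J γ) {t : ℝ} (ht : t ∈ J) :
    HasDerivWithinAt (fun t => (γ t).2.2) ((γ t).1 ^ 2) J t := by
  simpa [field] using (h t ht).1.hasFDerivWithinAt.snd.snd.hasDerivWithinAt

lemma nonneg (h : IsSolutionOn ε J γ) {t : ℝ} (ht : t ∈ J) : 0 ≤ (γ t).1 := (h t ht).2

lemma continuousOn (h : IsSolutionOn ε J γ) : ContinuousOn γ J :=
  fun t ht => (h t ht).1.continuousWithinAt

lemma cont_u (h : IsSolutionOn ε J γ) : ContinuousOn (fun t => (γ t).1) J :=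
  h.continuousOn.fst

lemma cont_p (h : IsSolutionOn ε J γ) : ContinuousOn (fun t => (γ t).2.1) J :=
  h.continuousOn.snd.fst

lemma cont_q (h : IsSolutionOn ε J γ) : ContinuousOn (fun t => (γ t).2.2) J :=
  h.continuousOn.snd.snd

lemma comp_add (h : IsSolutionOn ε J γ) (c : ℝ) (hJ : ∀ t ∈ J', t + c ∈ J) :
    IsSolutionOn ε J' (fun t => γ (t + c)) := by
  intro t ht
  refine ⟨?_, (h _ (hJ t ht)).2⟩
  have h1 : HasDerivWithinAt (fun t : ℝ => t + c) 1 J' t :=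
    ((hasDerivAt_id t).add_const c).hasDerivWithinAt
  exact ((h _ (hJ t ht)).1.scomp t h1 hJ).congr_deriv (one_smul _ _)

/-- Concatenation of two solutions that agree at the common end point of their intervals. -/
lemma concat {T : ℝ} (h1 : IsSolutionOn ε J γ) (h2 : IsSolutionOn ε J' δ)
    (hJ : J ⊆ Iic T) (hJ' : J' ⊆ Ici T) (hT : T ∈ J) (hT' : T ∈ J') (heq : γ T = δ T) :
    IsSolutionOn ε (J ∪ J') (fun t => if t ≤ T then γ t else δ t) := by
  set ζ : ℝ → Phase := fun t => if t ≤ T then γ t else δ t with hζ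
  have e1 : EqOn ζ γ J := fun t ht => if_pos (hJ ht)
  have e2 : EqOn ζ δ J' := by
    intro t ht
    have hTt : T ≤ t := hJ' ht
    rcases hTt.eq_or_lt with h | h
    · subst h; simp [hζ, heq]
    · simp [hζ, not_le.2 h]
  have d1 : ∀ t ∈ J ∪ J', HasDerivWithinAt ζ (field ε (ζ t)) J t := by
    intro t ht
    by_cases h : t ∈ J
    · rw [e1 h]
      exact (h1 t h).1.congr e1 (e1 h)
    · have h' : t ∈ J' := ht.resolve_left h
      refine HasFDerivWithinAt.of_notMem_closure fun hc => h ?_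
      have : t ≤ T := closure_minimal hJ isClosed_Iic hc
      rwa [le_antisymm this (hJ' h')]
  have d2 : ∀ t ∈ J ∪ J', HasDerivWithinAt ζ (field ε (ζ t)) J' t := by
    intro t ht
    by_cases h : t ∈ J'
    · rw [e2 h]
      exact (h2 t h).1.congr e2 (e2 h)
    · have h' : t ∈ J := ht.resolve_right h
      refine HasFDerivWithinAt.of_notMem_closure fun hc => h ?_
      have : T ≤ t := closure_minimal hJ' isClosed_Ici hc
      rwa [le_antisymm (hJ h') this]
  intro t ht
  refine ⟨(d1 t ht).union (d2 t ht), ?_⟩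
  rcases ht with h | h
  · rw [e1 h]; exact (h1 t h).2
  · rw [e2 h]; exact (h2 t h).2

end IsSolutionOn

/-- The time reversal symmetry `(u, p, q) ↦ (u, -p, -q)` of the system. -/
def reversal (x : Phase) : Phase := (x.1, -x.2.1, -x.2.2)

@[simp] lemma reversal_reversal (x : Phase) : reversal (reversal x) = x := by simp [reversal]

lemma continuous_reversal : Continuous reversal := by unfold reversal; fun_prop

lemma IsSolutionOn.reverse {ε : ℝ} {J J' : Set ℝ} {γ : ℝ → Phase} (h : IsSolutionOn ε J γ)
    (hJ : ∀ t ∈ J', -t ∈ J) : IsSolutionOn ε J' (fun t => reversal (γ (-t))) := by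
  intro t ht
  have h0 : HasDerivWithinAt (fun t : ℝ => -t) (-1) J' t := (hasDerivAt_neg t).hasDerivWithinAt
  have hu := (h.deriv_u (hJ t ht)).scomp t h0 hJ
  have hp := ((h.deriv_p (hJ t ht)).scomp t h0 hJ).neg
  have hq := ((h.deriv_q (hJ t ht)).scomp t h0 hJ).neg
  refine ⟨(hu.prodMk (hp.prodMk hq)).congr_deriv ?_, h.nonneg (hJ t ht)⟩
  simp [field, reversal]

/-- The field agrees on any ball with a bounded, globally Lipschitz field. -/
lemma exists_truncation (ε R : ℝ) : ∃ (w : Phase → Phase) (K L : NNReal), LipschitzWith K w ∧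
    (∀ x, ‖w x‖ ≤ L) ∧ ∀ x, ‖x‖ ≤ R → w x = field ε x := by
  set R' := max R 0 with hR'
  have hR0 : 0 ≤ R' := le_max_right _ _
  set c : ℝ → ℝ := fun y => max (min y R') (-R') with hc
  have hcL : LipschitzWith 1 c := (LipschitzWith.id.min_const R').max_const (-R')
  set π : Phase → Phase := fun x => (c x.1, c x.2.1, c x.2.2) with hπ
  have hπL : LipschitzWith 1 π := by
    have h1 : LipschitzWith 1 (fun x : Phase => c x.1) := by
      exact (hcL.comp LipschitzWith.prod_fst).weaken (by simp)
    have h2 : LipschitzWith 1 (fun x : Phase => c x.2.1) := by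
      exact (hcL.comp (LipschitzWith.prod_fst.comp LipschitzWith.prod_snd)).weaken (by simp)
    have h3 : LipschitzWith 1 (fun x : Phase => c x.2.2) := by
      exact (hcL.comp (LipschitzWith.prod_snd.comp LipschitzWith.prod_snd)).weaken (by simp)
    simpa using h1.prodMk (h2.prodMk h3)
  have hcb : ∀ y, |c y| ≤ R' := by
    intro y
    rw [abs_le]
    exact ⟨le_max_right _ _, max_le (min_le_right _ _) (by linarith)⟩
  have hπb : ∀ x, π x ∈ Metric.closedBall (0 : Phase) R' := by
    intro x
    rw [mem_closedBall_zero_iff]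
    simp only [hπ, Prod.norm_def, Real.norm_eq_abs]
    exact max_le (hcb _) (max_le (hcb _) (hcb _))
  have hsm : ContDiff ℝ 1 (field ε) := by unfold field; fun_prop
  obtain ⟨K, hK⟩ := (hsm.contDiffOn (s := Metric.closedBall (0 : Phase) R')).exists_lipschitzOnWith
    one_ne_zero (convex_closedBall _ _) (isCompact_closedBall _ _)
  obtain ⟨L, hL⟩ := (isCompact_closedBall (0 : Phase) R').exists_bound_of_continuousOn
    hsm.continuous.continuousOn
  refine ⟨field ε ∘ π, K * 1, L.toNNReal, ?_, ?_, ?_⟩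
  · rw [← lipschitzOnWith_univ]
    exact hK.comp hπL.lipschitzOnWith fun x _ => hπb x
  · intro x
    exact (hL _ (hπb x)).trans (Real.le_coe_toNNReal L)
  · intro x hx
    have hx' : ‖x‖ ≤ R' := hx.trans (le_max_left _ _)
    have hid : ∀ y : ℝ, |y| ≤ R' → c y = y := by
      intro y hy
      rw [abs_le] at hy
      simp [hc, min_eq_left hy.2, max_eq_left hy.1]
    simp only [Prod.norm_def, Real.norm_eq_abs, max_le_iff] at hx'
    simp only [Function.comp, hπ, hid _ hx'.1, hid _ hx'.2.1, hid _ hx'.2.2]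

lemma exists_solution_of_bounded_lipschitz {w : Phase → Phase} {K L : NNReal}
    (hK : LipschitzWith K w) (hL : ∀ x, ‖w x‖ ≤ L) (x : Phase) {T : ℝ} (hT : 0 ≤ T) :
    ∃ γ : ℝ → Phase, γ 0 = x ∧ ∀ t ∈ Icc 0 T, HasDerivWithinAt γ (w (γ t)) (Icc 0 T) t := by
  have hp : IsPicardLindelof (fun _ => w) (tmin := 0) (tmax := T) ⟨0, le_rfl, hT⟩ x
      (L * T.toNNReal) 0 L K := by
    refine IsPicardLindelof.of_time_independent (fun x _ => hL x) hK.lipschitzOnWith ?_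
    simp [hT]
  exact hp.exists_eq_forall_mem_Icc_hasDerivWithinAt₀

lemma dist_le_of_lipschitz_solutions {w : Phase → Phase} {K : NNReal} (hK : LipschitzWith K w)
    {γ δ : ℝ → Phase} {a b : ℝ}
    (hγ : ∀ t ∈ Icc a b, HasDerivWithinAt γ (w (γ t)) (Icc a b) t)
    (hδ : ∀ t ∈ Icc a b, HasDerivWithinAt δ (w (δ t)) (Icc a b) t) :
    ∀ t ∈ Icc a b, dist (γ t) (δ t) ≤ dist (γ a) (δ a) * Real.exp (K * (t - a)) := by
  have hmem : ∀ t ∈ Ico a b, Icc a b ∈ 𝓝[≥] t := fun t ht => Icc_mem_nhdsGE_of_mem ht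
  exact dist_le_of_trajectories_ODE (v := fun _ => w) (fun _ => hK)
    (fun t ht => (hγ t ht).continuousWithinAt)
    (fun t ht => (hγ t (Ico_subset_Icc_self ht)).mono_of_mem_nhdsWithin (hmem t ht))
    (fun t ht => (hδ t ht).continuousWithinAt)
    (fun t ht => (hδ t (Ico_subset_Icc_self ht)).mono_of_mem_nhdsWithin (hmem t ht)) le_rfl

lemma IsSolutionOn.exists_norm_le {ε : ℝ} {γ : ℝ → Phase} {a b : ℝ}
    (h : IsSolutionOn ε (Icc a b) γ) : ∃ M, ∀ t ∈ Icc a b, ‖γ t‖ ≤ M :=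
  isCompact_Icc.exists_bound_of_continuousOn h.continuousOn

lemma IsSolutionOn.eqOn_Icc {ε : ℝ} {γ δ : ℝ → Phase} {a b : ℝ}
    (hγ : IsSolutionOn ε (Icc a b) γ) (hδ : IsSolutionOn ε (Icc a b) δ) (h : γ a = δ a) :
    EqOn γ δ (Icc a b) := by
  obtain ⟨M, hM⟩ := hγ.exists_norm_le
  obtain ⟨N, hN⟩ := hδ.exists_norm_le
  obtain ⟨w, K, L, hK, -, hw⟩ := exists_truncation ε (max M N)
  intro t ht
  have := dist_le_of_lipschitz_solutions hK (γ := γ) (δ := δ) (a := a) (b := b)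
    (fun t ht => by rw [hw _ ((hM t ht).trans (le_max_left _ _))]; exact (hγ t ht).1)
    (fun t ht => by rw [hw _ ((hN t ht).trans (le_max_right _ _))]; exact (hδ t ht).1) t ht
  rw [h, dist_self, zero_mul] at this
  exact dist_le_zero.1 this

lemma IsSolutionOn.eqOn_Ici {ε : ℝ} {γ δ : ℝ → Phase} {a : ℝ}
    (hγ : IsSolutionOn ε (Ici a) γ) (hδ : IsSolutionOn ε (Ici a) δ) (h : γ a = δ a) :
    EqOn γ δ (Ici a) := fun t ht =>
  (hγ.mono Icc_subset_Ici_self).eqOn_Icc (hδ.mono Icc_subset_Ici_self) h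
    (⟨ht, le_rfl⟩ : t ∈ Icc a t)

/-- The half-space `{u ≥ 0}` is invariant, since `u' = √ε p u`. -/
lemma isSolutionOn_of_hasDerivWithinAt {ε : ℝ} {γ : ℝ → Phase} {a b : ℝ}
    (h : ∀ t ∈ Icc a b, HasDerivWithinAt γ (field ε (γ t)) (Icc a b) t) (h0 : γ a ∈ halfSpace) :
    IsSolutionOn ε (Icc a b) γ := by
  have hc : ContinuousOn γ (Icc a b) := fun t ht => (h t ht).continuousWithinAt
  have hu : ∀ t ∈ Icc a b, HasDerivWithinAt (fun t => (γ t).1)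
      ((√ε * (γ t).2.1) * (γ t).1) (Icc a b) t := fun t ht => by
    have := (h t ht).hasFDerivWithinAt.fst.hasDerivWithinAt
    refine this.congr_deriv ?_
    simp [field]
    ring
  have hnn := nonneg_of_deriv_ge_mul hu (continuousOn_const.mul hc.snd.fst)
    (fun _ _ _ => le_rfl) h0
  exact fun t ht => ⟨h t ht, hnn t ht⟩

/-- Continuous dependence on the initial point. -/
lemma IsSolutionOn.eventually_exists_near {ε : ℝ} {γ : ℝ → Phase} {T η : ℝ} (hT : 0 ≤ T)
    (hη : 0 < η) (h : IsSolutionOn ε (Icc 0 T) γ) :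
    ∀ᶠ y in 𝓝 (γ 0), y ∈ halfSpace → ∃ δ, IsSolutionOn ε (Icc 0 T) δ ∧ δ 0 = y ∧
      ∀ t ∈ Icc 0 T, dist (δ t) (γ t) < η := by
  obtain ⟨M, hM⟩ := h.exists_norm_le
  obtain ⟨w, K, L, hK, hL, hw⟩ := exists_truncation ε (M + η)
  have hpos : 0 < η / Real.exp (K * T) := by positivity
  filter_upwards [Metric.ball_mem_nhds (γ 0) hpos] with y hy hyh
  obtain ⟨δ, hδ0, hδ⟩ := exists_solution_of_bounded_lipschitz hK hL y hT
  have hdist : ∀ t ∈ Icc 0 T, dist (δ t) (γ t) < η := by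
    intro t ht
    have h1 := dist_le_of_lipschitz_solutions hK hδ (δ := γ)
      (fun t ht => by rw [hw _ (by linarith [hM t ht])]; exact (h t ht).1) t ht
    rw [hδ0, sub_zero] at h1
    have h2 : Real.exp (K * t) ≤ Real.exp (K * T) := by
      rw [Real.exp_le_exp]; exact mul_le_mul_of_nonneg_left ht.2 K.2
    have h3 : dist y (γ 0) < η / Real.exp (K * T) := hy
    rw [lt_div_iff₀ (Real.exp_pos _)] at h3
    calc dist (δ t) (γ t) ≤ dist y (γ 0) * Real.exp (K * t) := h1
      _ ≤ dist y (γ 0) * Real.exp (K * T) := mul_le_mul_of_nonneg_left h2 dist_nonneg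
      _ < η := h3
  refine ⟨δ, isSolutionOn_of_hasDerivWithinAt (fun t ht => ?_) (by rwa [hδ0]), hδ0, hdist⟩
  have hn : ‖δ t‖ ≤ M + η := by
    have h1 := hdist t ht
    rw [dist_eq_norm] at h1
    have h2 := norm_le_norm_add_norm_sub (γ t) (δ t)
    rw [norm_sub_rev] at h2
    linarith [hM t ht]
  rw [← hw _ hn]
  exact hδ t ht

/-- A priori bounds imply existence on a compact time interval. -/
lemma exists_solution_Icc_of_bound {ε : ℝ} {x : Phase} (hx : x ∈ halfSpace) {T R : ℝ} (hT : 0 ≤ T)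
    (hR : ∀ τ ∈ Icc 0 T, ∀ γ, IsSolutionOn ε (Icc 0 τ) γ → γ 0 = x → ‖γ τ‖ ≤ R) :
    ∃ γ, IsSolutionOn ε (Icc 0 T) γ ∧ γ 0 = x := by
  set S := max R ‖x‖ + 1 with hS
  have hRS : R < S := by rw [hS]; linarith [le_max_left R ‖x‖]
  have hxS : ‖x‖ < S := by rw [hS]; linarith [le_max_right R ‖x‖]
  obtain ⟨w, K, L, hK, hL, hw⟩ := exists_truncation ε S
  obtain ⟨γ, hγ0, hγ⟩ := exists_solution_of_bounded_lipschitz hK hL x hT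
  have hc : ContinuousOn γ (Icc 0 T) := fun t ht => (hγ t ht).continuousWithinAt
  have hlt : ∀ t ∈ Icc 0 T, ‖γ t‖ < S := by
    refine forall_Icc_of_open_induction ?_ (by rwa [hγ0]) ?_
    · intro t ht hlt
      exact (hc.norm t ht).eventually (Iio_mem_nhds hlt)
    · intro t ht hlt
      have htT : Icc 0 t ⊆ Icc 0 T := Icc_subset_Icc_right ht.2
      have hle := le_on_Icc_of_le_on_Ico ht.1 (hc.mono htT).norm fun r hr => (hlt r hr).le
      have hsol : IsSolutionOn ε (Icc 0 t) γ := by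
        refine isSolutionOn_of_hasDerivWithinAt (fun r hr => ?_) (by rwa [hγ0])
        rw [← hw _ (hle r hr)]
        exact (hγ r (htT hr)).mono htT
      exact (hR t ⟨ht.1.le, ht.2⟩ γ hsol hγ0).trans_lt hRS
  refine ⟨γ, isSolutionOn_of_hasDerivWithinAt (fun t ht => ?_) (by rwa [hγ0]), hγ0⟩
  rw [← hw _ (hlt t ht).le]
  exact hγ t ht

lemma exists_solution_Ici_of_Icc {ε : ℝ} {x : Phase}
    (h : ∀ T : ℝ, 0 ≤ T → ∃ γ, IsSolutionOn ε (Icc 0 T) γ ∧ γ 0 = x) :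
    ∃ γ, IsSolutionOn ε (Ici 0) γ ∧ γ 0 = x := by
  choose! g hg hg0 using h
  have heq : ∀ T T' t : ℝ, 0 ≤ t → t ≤ T → t ≤ T' → g T t = g T' t := by
    intro T T' t h0 h1 h2
    exact ((hg T (h0.trans h1)).mono (Icc_subset_Icc_right h1)).eqOn_Icc
      ((hg T' (h0.trans h2)).mono (Icc_subset_Icc_right h2))
      (by rw [hg0 T (h0.trans h1), hg0 T' (h0.trans h2)]) ⟨h0, le_rfl⟩
  refine ⟨fun t => g t t, ?_, hg0 0 le_rfl⟩
  intro t ht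
  have ht0 : (0 : ℝ) ≤ t := ht
  have hsol := hg (t + 1) (by linarith)
  have htm : t ∈ Icc 0 (t + 1) := ⟨ht0, by linarith⟩
  have he : ∀ r ∈ Icc 0 (t + 1), g r r = g (t + 1) r := fun r hr =>
    heq r (t + 1) r hr.1 le_rfl hr.2
  refine ⟨?_, ?_⟩
  · have h1 : HasDerivWithinAt (fun r => g r r) (field ε (g t t)) (Icc 0 (t + 1)) t := by
      rw [he t htm]
      exact (hsol t htm).1.congr he (he t htm)
    refine h1.mono_of_mem_nhdsWithin ?_
    rw [← Ici_inter_Iic]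
    exact inter_mem self_mem_nhdsWithin (mem_nhdsWithin_of_mem_nhds (Iic_mem_nhds (by linarith)))
  · show g t t ∈ halfSpace
    rw [he t htm]; exact (hsol t htm).2

/-- A priori bounds imply existence for all positive times. -/
lemma exists_solution_Ici_of_bound {ε : ℝ} {x : Phase} (hx : x ∈ halfSpace)
    (h : ∀ T : ℝ, 0 ≤ T → ∃ R, ∀ τ ∈ Icc 0 T, ∀ γ, IsSolutionOn ε (Icc 0 τ) γ → γ 0 = x →
      ‖γ τ‖ ≤ R) : ∃ γ, IsSolutionOn ε (Ici 0) γ ∧ γ 0 = x :=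
  exists_solution_Ici_of_Icc fun T hT => by
    obtain ⟨R, hR⟩ := h T hT
    exact exists_solution_Icc_of_bound hx hT hR

/-! ### Conserved signs and monotone quantities -/

/-- `u³ - (3/4) √ε q²`; this, `defectL` and `defectM` vanish on the algebraic solution, and their
derivatives along solutions are linear combinations of the three functions. -/
noncomputable def defectK (ε : ℝ) (x : Phase) : ℝ := x.1 ^ 3 - 3 / 4 * √ε * x.2.2 ^ 2

/-- `u p - q / 2`, see `defectK`. -/
noncomputable def defectL (x : Phase) : ℝ := x.1 * x.2.1 - x.2.2 / 2

/-- `(3/2) √ε p² - u / 2`, see `defectK`. -/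
noncomputable def defectM (ε : ℝ) (x : Phase) : ℝ := 3 / 2 * √ε * x.2.1 ^ 2 - x.1 / 2

/-- `p² - g u - (2 / (3√ε)) u³`. Where `p < 0`, its positivity is preserved by the flow. -/
noncomputable def gap (ε g : ℝ) (x : Phase) : ℝ :=
  x.2.1 ^ 2 - g * x.1 - 2 / (3 * √ε) * x.1 ^ 3

lemma continuous_defectK (ε : ℝ) : Continuous (defectK ε) := by unfold defectK; fun_prop

lemma continuous_gap (ε g : ℝ) : Continuous (gap ε g) := by unfold gap; fun_prop

namespace IsSolutionOn

variable {ε : ℝ} {J : Set ℝ} {γ : ℝ → Phase} {a b : ℝ}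

lemma deriv_p_eq (h : IsSolutionOn ε J γ) {t : ℝ} (ht : t ∈ J) :
    HasDerivWithinAt (fun t => (γ t).2.1)
      (2 / 3 * defectK ε (γ t) + 1 / 2 * √ε * (γ t).2.1 ^ 2) J t := by
  refine (h.deriv_p ht).congr_deriv ?_
  simp only [defectK]
  ring

lemma deriv_defectK (h : IsSolutionOn ε J γ) {t : ℝ} (ht : t ∈ J) :
    HasDerivWithinAt (fun t => defectK ε (γ t)) (3 * √ε * (γ t).1 ^ 2 * defectL (γ t)) J t := by
  refine (((h.deriv_u ht).fun_pow 3).fun_sub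
    (((h.deriv_q ht).fun_pow 2).const_mul (3 / 4 * √ε))).congr_deriv ?_
  simp only [defectL]
  push_cast
  ring

lemma deriv_defectL (h : IsSolutionOn ε J γ) {t : ℝ} (ht : t ∈ J) :
    HasDerivWithinAt (fun t => defectL (γ t))
      (2 / 3 * (γ t).1 * defectK ε (γ t) + (γ t).1 * defectM ε (γ t)) J t := by
  refine (((h.deriv_u ht).fun_mul (h.deriv_p ht)).fun_sub
    ((h.deriv_q ht).div_const 2)).congr_deriv ?_
  simp only [defectK, defectM]
  ring

lemma deriv_defectM (h : IsSolutionOn ε J γ) {t : ℝ} (ht : t ∈ J) :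
    HasDerivWithinAt (fun t => defectM ε (γ t))
      (√ε * (γ t).2.1 * (2 * defectK ε (γ t) + defectM ε (γ t))) J t := by
  refine ((((h.deriv_p ht).fun_pow 2).const_mul (3 / 2 * √ε)).fun_sub
    ((h.deriv_u ht).div_const 2)).congr_deriv ?_
  simp only [defectK, defectM]
  push_cast
  ring

lemma deriv_gap (hε : 0 < ε) (g : ℝ) (h : IsSolutionOn ε J γ) {t : ℝ} (ht : t ∈ J) :
    HasDerivWithinAt (fun t => gap ε g (γ t))
      (√ε * (γ t).2.1 * (gap ε g (γ t) - (γ t).2.2 ^ 2)) J t := by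
  have hs : √ε ≠ 0 := (Real.sqrt_pos.2 hε).ne'
  refine ((((h.deriv_p ht).fun_pow 2).fun_sub ((h.deriv_u ht).const_mul g)).fun_sub
    (((h.deriv_u ht).fun_pow 3).const_mul (2 / (3 * √ε)))).congr_deriv ?_
  simp only [gap]
  push_cast
  field_simp
  ring

lemma u_pos (h : IsSolutionOn ε (Icc a b) γ) (h0 : 0 < (γ a).1) : ∀ t ∈ Icc a b, 0 < (γ t).1 :=
  pos_of_deriv_ge_mul (fun t ht => h.deriv_u ht) (A := fun t => √ε * (γ t).2.1)
    (continuousOn_const.mul h.cont_p) (fun t _ => by linarith) h0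

lemma u_eq_zero (h : IsSolutionOn ε (Icc a b) γ) (h0 : (γ a).1 = 0) :
    ∀ t ∈ Icc a b, (γ t).1 = 0 :=
  eq_zero_of_deriv_eq_mul (A := fun t => √ε * (γ t).2.1)
    (fun t ht => (h.deriv_u ht).congr_deriv (by ring)) (continuousOn_const.mul h.cont_p) h0

lemma monotoneOn_q (h : IsSolutionOn ε (Icc a b) γ) : MonotoneOn (fun t => (γ t).2.2) (Icc a b) :=
  monotoneOn_Icc_of_deriv (fun _ ht => h.deriv_q ht) (fun _ _ => sq_nonneg _)

lemma q_le_q (h : IsSolutionOn ε (Ici a) γ) {t r : ℝ} (ht : a ≤ t) (htr : t ≤ r) :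
    (γ t).2.2 ≤ (γ r).2.2 :=
  (h.mono Icc_subset_Ici_self).monotoneOn_q (⟨ht, htr⟩ : t ∈ Icc a r) ⟨ht.trans htr, le_rfl⟩ htr

lemma q_eq_of_u_eq_zero (h : IsSolutionOn ε (Ici a) γ) (h0 : (γ a).1 = 0) {t : ℝ} (ht : a ≤ t) :
    (γ t).2.2 = (γ a).2.2 := by
  have hsol : IsSolutionOn ε (Icc a t) γ := h.mono Icc_subset_Ici_self
  refine le_antisymm ?_ (h.q_le_q le_rfl ht)
  exact antitoneOn_Icc_of_deriv (fun r hr => hsol.deriv_q hr)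
    (fun r hr => by rw [hsol.u_eq_zero h0 r hr]; simp) ⟨le_rfl, ht⟩ ⟨ht, le_rfl⟩ ht

lemma antitoneOn_u (h : IsSolutionOn ε (Icc a b) γ) (hp : ∀ t ∈ Icc a b, (γ t).2.1 ≤ 0) :
    AntitoneOn (fun t => (γ t).1) (Icc a b) :=
  antitoneOn_Icc_of_deriv (fun _ ht => h.deriv_u ht) (fun t ht =>
    mul_nonpos_of_nonneg_of_nonpos (mul_nonneg (Real.sqrt_nonneg _) (h.nonneg ht)) (hp t ht))

/-- `p` cannot fall below a negative bound that is at least `|q|` in size, since `p' ≥ 0` there. -/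
lemma p_ge {P : ℝ} (h : IsSolutionOn ε (Icc a b) γ) (hP : -P ≤ (γ a).2.1)
    (hq : ∀ t ∈ Icc a b, |(γ t).2.2| ≤ P) : ∀ t ∈ Icc a b, -P ≤ (γ t).2.1 := by
  intro t ht
  have := nonneg_of_deriv_ge_mul (f := fun t => (γ t).2.1 + P) (A := fun _ => 0)
    (fun t ht => (h.deriv_p ht).add_const P) continuousOn_const (fun t ht hlt => ?_)
    (by linarith) t ht
  · linarith
  · have h1 := hq t ht
    have h2 : |(γ t).2.2| ^ 2 ≤ P ^ 2 := pow_le_pow_left₀ (abs_nonneg _) h1 2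
    rw [sq_abs] at h2
    have h3 : P ^ 2 ≤ (γ t).2.1 ^ 2 := by nlinarith [(abs_nonneg _).trans h1]
    have h4 := pow_nonneg (h.nonneg ht) 3
    have h5 := mul_nonneg (Real.sqrt_nonneg ε)
      (show 0 ≤ (γ t).2.1 ^ 2 - (γ t).2.2 ^ 2 by linarith)
    linarith

/-- A lower bound of `q'` makes `q` unbounded. -/
lemma exists_lt_q {c : ℝ} (hc : 0 < c) (h : IsSolutionOn ε (Ici a) γ)
    (hu : ∀ t ∈ Ici a, c ≤ (γ t).1) (M : ℝ) : ∃ t ∈ Ici a, M < (γ t).2.2 := by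
  have := eventually_le_of_deriv_le (f := fun t => -(γ t).2.2) (β := -(M + 1)) (c := c ^ 2)
    (by positivity) (fun t ht => (h.deriv_q ht).neg) (fun t ht _ => by
      have := pow_le_pow_left₀ hc.le (hu t ht) 2
      linarith)
  obtain ⟨t, ht, hta⟩ := (this.and (eventually_ge_atTop a)).exists
  exact ⟨t, hta, by linarith⟩

/-- A global solution along which eventually `p ≤ 0` and `q` stays bounded converges to an
equilibrium with `p = -|q|`. -/
lemma exists_tendsto (hε : 0 < ε) (h : IsSolutionOn ε (Ici 0) γ)
    (hp : ∀ᶠ t in atTop, (γ t).2.1 ≤ 0) {M : ℝ} (hq : ∀ t ∈ Ici (0 : ℝ), (γ t).2.2 ≤ M) :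
    ∃ Q : ℝ, Tendsto γ atTop (𝓝 (0, -|Q|, Q)) ∧ ∀ t ∈ Ici (0 : ℝ), (γ t).2.2 ≤ Q := by
  have hs : 0 < √ε := Real.sqrt_pos.2 hε
  -- convergence of `q`
  obtain ⟨Q, hQ, hQle⟩ : ∃ Q, Tendsto (fun t => (γ t).2.2) atTop (𝓝 Q) ∧
      ∀ t ∈ Ici (0 : ℝ), (γ t).2.2 ≤ Q := by
    have hm : Monotone (fun t => (γ (max t 0)).2.2) := fun t r htr =>
      h.q_le_q (le_max_right _ _) (max_le_max_right 0 htr)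
    have hb : BddAbove (range fun t => (γ (max t 0)).2.2) :=
      ⟨M, by rintro _ ⟨t, rfl⟩; exact hq (max t 0) (mem_Ici.2 (le_max_right _ _))⟩
    refine ⟨_, (tendsto_atTop_ciSup hm hb).congr' ?_, fun t ht => ?_⟩
    · filter_upwards [eventually_ge_atTop 0] with t ht
      rw [max_eq_left ht]
    · have := le_ciSup hb t
      simp only [max_eq_left (show (0 : ℝ) ≤ t from ht)] at this
      exact this
  obtain ⟨T, hT0, hT⟩ : ∃ T : ℝ, 0 ≤ T ∧ ∀ t ∈ Ici T, (γ t).2.1 ≤ 0 := by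
    obtain ⟨T, hT⟩ := eventually_atTop.1 hp
    exact ⟨max T 0, le_max_right _ _, fun t ht => hT t ((le_max_left _ _).trans ht)⟩
  have hTI : Ici T ⊆ Ici 0 := Ici_subset_Ici.2 hT0
  -- convergence of `u`
  have hu : Tendsto (fun t => (γ t).1) atTop (𝓝 0) := by
    have hanti : ∀ t r, T ≤ t → t ≤ r → (γ r).1 ≤ (γ t).1 := fun t r ht htr =>
      ((h.mono hTI).mono Icc_subset_Ici_self).antitoneOn_u (fun r hr => hT r hr.1)
        (⟨ht, htr⟩ : t ∈ Icc T r) ⟨ht.trans htr, le_rfl⟩ htr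
    have hsmall : ∀ c > 0, ∃ t ∈ Ici T, (γ t).1 < c := by
      intro c hc
      by_contra hcon
      push Not at hcon
      obtain ⟨t, ht, hlt⟩ := (h.mono hTI).exists_lt_q hc hcon M
      exact absurd (hq t (hTI ht)) (not_le.2 hlt)
    rw [tendsto_order]
    refine ⟨fun c hc => ?_, fun c hc => ?_⟩
    · filter_upwards [eventually_ge_atTop 0] with t ht
      exact hc.trans_le (h.nonneg ht)
    · obtain ⟨t, ht, hlt⟩ := hsmall c hc
      filter_upwards [eventually_ge_atTop t] with r hr
      exact (hanti t r ht hr).trans_lt hlt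
  -- convergence of `p`
  have hqabs : Tendsto (fun t => |(γ t).2.2|) atTop (𝓝 |Q|) := hQ.abs
  have hlow : ∀ δ > 0, ∀ᶠ t in atTop, -|Q| - δ ≤ (γ t).2.1 := by
    intro δ hδ
    obtain ⟨T', hT'⟩ := eventually_atTop.1
      ((hqabs.eventually (Iio_mem_nhds (show |Q| < |Q| + δ / 2 by linarith))).and
        (eventually_ge_atTop 0))
    have hT0' : 0 ≤ T' := (hT' T' le_rfl).2
    have hsol := h.mono (Ici_subset_Ici.2 hT0')
    have := eventually_le_of_deriv_le (f := fun t => -(γ t).2.1) (β := |Q| + δ)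
      (c := √ε / 2 * (3 / 4 * δ ^ 2)) (by positivity) (fun t ht => (hsol.deriv_p ht).neg)
      (fun t ht hge => by
        have h1 : |(γ t).2.2| < |Q| + δ / 2 := (hT' t ht).1
        have h2 : |(γ t).2.2| ^ 2 ≤ (|Q| + δ / 2) ^ 2 :=
          pow_le_pow_left₀ (abs_nonneg _) h1.le 2
        rw [sq_abs] at h2
        have hQ0 := abs_nonneg Q
        have h3 : (|Q| + δ) ^ 2 ≤ (-(γ t).2.1) ^ 2 := pow_le_pow_left₀ (by positivity) hge 2
        have h4 : 3 / 4 * δ ^ 2 ≤ (γ t).2.1 ^ 2 - (γ t).2.2 ^ 2 := by nlinarith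
        have h5 := mul_le_mul_of_nonneg_left h4 (show 0 ≤ √ε / 2 by positivity)
        have h6 := pow_nonneg (hsol.nonneg ht) 3
        linarith)
    filter_upwards [this] with t ht
    linarith
  have hup : ∀ δ > 0, ∀ᶠ t in atTop, (γ t).2.1 ≤ -|Q| + δ := by
    intro δ hδ
    rcases le_or_gt |Q| δ with hQδ | hQδ
    · filter_upwards [hp] with t ht
      linarith
    have hu3 : Tendsto (fun t => (γ t).1 ^ 3) atTop (𝓝 0) := by simpa using hu.pow 3
    obtain ⟨T', hT'⟩ := eventually_atTop.1
      ((hqabs.eventually (Ioi_mem_nhds (show |Q| - δ / 2 < |Q| by linarith))).and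
        ((hu3.eventually (Iio_mem_nhds (show 0 < 3 / 2 * (√ε * δ ^ 2 / 16) by positivity))).and
          (eventually_ge_atTop T)))
    have hsol := h.mono (Ici_subset_Ici.2 (hT0.trans (hT' T' le_rfl).2.2))
    refine eventually_le_of_deriv_le (c := √ε * δ ^ 2 / 16) (by positivity)
      (fun t ht => hsol.deriv_p ht) (fun t ht hge => ?_)
    obtain ⟨h1, h2, h3⟩ := hT' t ht
    have h1 : |Q| - δ / 2 < |(γ t).2.2| := h1
    have h2 : (γ t).1 ^ 3 < 3 / 2 * (√ε * δ ^ 2 / 16) := h2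
    have h4 : (|Q| - δ / 2) ^ 2 ≤ |(γ t).2.2| ^ 2 := pow_le_pow_left₀ (by linarith) h1.le 2
    rw [sq_abs] at h4
    have h5 := hT t h3
    have h6 : (-(γ t).2.1) ^ 2 ≤ (|Q| - δ) ^ 2 := pow_le_pow_left₀ (by linarith) (by linarith) 2
    have h7 : (γ t).2.1 ^ 2 - (γ t).2.2 ^ 2 ≤ -(δ ^ 2 / 4) := by nlinarith
    have h8 := mul_le_mul_of_nonneg_left h7 (show 0 ≤ √ε / 2 by positivity)
    linarith
  have hpt : Tendsto (fun t => (γ t).2.1) atTop (𝓝 (-|Q|)) := by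
    rw [tendsto_order]
    refine ⟨fun c hc => ?_, fun c hc => ?_⟩
    · filter_upwards [hlow ((-|Q| - c) / 2) (by linarith)] with t ht
      linarith
    · filter_upwards [hup ((c + |Q|) / 2) (by linarith)] with t ht
      linarith
  exact ⟨Q, hu.prodMk_nhds (hpt.prodMk_nhds hQ), hQle⟩

end IsSolutionOn

/-! ### Trapping regions -/

lemma phase_norm_le {x : Phase} {R : ℝ} (h1 : |x.1| ≤ R) (h2 : |x.2.1| ≤ R) (h3 : |x.2.2| ≤ R) :
    ‖x‖ ≤ R := by
  simp only [Prod.norm_def, Real.norm_eq_abs]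
  exact max_le h1 (max_le h2 h3)

namespace IsSolutionOn

variable {ε : ℝ} {γ : ℝ → Phase} {a b : ℝ}

lemma gap_pos (hε : 0 < ε) {g : ℝ} (h : IsSolutionOn ε (Icc a b) γ)
    (hp : ∀ t ∈ Icc a b, (γ t).2.1 ≤ 0) (h0 : 0 < gap ε g (γ a)) :
    ∀ t ∈ Icc a b, 0 < gap ε g (γ t) :=
  pos_of_deriv_ge_mul (A := fun t => √ε * (γ t).2.1) (fun t ht => h.deriv_gap hε g ht)
    (continuousOn_const.mul h.cont_p) (fun t ht => by
      have := mul_nonneg (mul_nonneg (Real.sqrt_nonneg ε) (neg_nonneg.2 (hp t ht)))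
        (sq_nonneg (γ t).2.2)
      linarith) h0

lemma gap_nonneg (hε : 0 < ε) {g : ℝ} (h : IsSolutionOn ε (Icc a b) γ)
    (hp : ∀ t ∈ Icc a b, (γ t).2.1 ≤ 0) (h0 : 0 ≤ gap ε g (γ a)) :
    ∀ t ∈ Icc a b, 0 ≤ gap ε g (γ t) :=
  nonneg_of_deriv_ge_mul (A := fun t => √ε * (γ t).2.1) (fun t ht => h.deriv_gap hε g ht)
    (continuousOn_const.mul h.cont_p) (fun t ht _ => by
      have := mul_nonneg (mul_nonneg (Real.sqrt_nonneg ε) (neg_nonneg.2 (hp t ht)))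
        (sq_nonneg (γ t).2.2)
      linarith) h0

/-- Where `gap ε 0` is positive, `p` cannot vanish; hence `p` stays negative. -/
lemma p_neg_of_gap (hε : 0 < ε) (h : IsSolutionOn ε (Icc a b) γ) (hp : (γ a).2.1 < 0)
    (h0 : 0 < gap ε 0 (γ a)) : ∀ t ∈ Icc a b, (γ t).2.1 < 0 := by
  refine forall_Icc_of_open_induction (fun t ht hlt => (h.cont_p t ht).eventually
    (Iio_mem_nhds hlt)) hp fun t ht hlt => ?_
  have hsub : Icc a t ⊆ Icc a b := Icc_subset_Icc_right ht.2
  have hle := le_on_Icc_of_le_on_Ico ht.1 (h.cont_p.mono hsub) fun r hr => (hlt r hr).le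
  have hg := (h.mono hsub).gap_pos hε hle h0 t ⟨ht.1.le, le_rfl⟩
  refine lt_of_le_of_ne (hle t ⟨ht.1.le, le_rfl⟩) fun h00 => ?_
  have h1 : 0 ≤ 2 / (3 * √ε) * (γ t).1 ^ 3 :=
    mul_nonneg (by positivity) (pow_nonneg (h.nonneg ⟨ht.1.le, ht.2⟩) 3)
  simp only [gap, h00] at hg
  linarith

/-- While `p ≤ 0` and `gap ε g ≥ 0`, the increase of `q` is paid for by the decrease of `u`, which
bounds `q`. -/
lemma antitoneOn_q_add (hε : 0 < ε) {g c : ℝ} (hc : 0 ≤ c) (h : IsSolutionOn ε (Icc a b) γ)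
    (hp : ∀ t ∈ Icc a b, (γ t).2.1 ≤ 0) (h0 : 0 ≤ gap ε g (γ a))
    (hg : (γ a).1 ≤ g * (c * √ε) ^ 2) :
    AntitoneOn (fun t => (γ t).2.2 + c * (γ t).1) (Icc a b) := by
  refine antitoneOn_Icc_of_deriv (fun t ht => (h.deriv_q ht).add ((h.deriv_u ht).const_mul c))
    fun t ht => ?_
  have hs : 0 < √ε := Real.sqrt_pos.2 hε
  have h1 := h.gap_nonneg hε hp h0 t ht
  have h2 : (γ t).1 ≤ (γ a).1 := h.antitoneOn_u hp ⟨le_rfl, ht.1.trans ht.2⟩ ht ht.1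
  have hu := h.nonneg ht
  have h3 : 0 ≤ 2 / (3 * √ε) * (γ t).1 ^ 3 := mul_nonneg (by positivity) (pow_nonneg hu 3)
  have h4 : g * (γ t).1 ≤ (γ t).2.1 ^ 2 := by simp only [gap] at h1; linarith
  have h5 : (γ t).1 ^ 2 ≤ (-(c * √ε * (γ t).2.1)) ^ 2 := by
    calc (γ t).1 ^ 2 = (γ t).1 * (γ t).1 := sq _
      _ ≤ g * (c * √ε) ^ 2 * (γ t).1 := mul_le_mul_of_nonneg_right (h2.trans hg) hu
      _ = (c * √ε) ^ 2 * (g * (γ t).1) := by ring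
      _ ≤ (c * √ε) ^ 2 * (γ t).2.1 ^ 2 := mul_le_mul_of_nonneg_left h4 (sq_nonneg _)
      _ = _ := by ring
  have h6 : 0 ≤ -(c * √ε * (γ t).2.1) := by
    have := mul_nonneg (mul_nonneg hc hs.le) (neg_nonneg.2 (hp t ht))
    linarith
  have h7 := (pow_le_pow_iff_left₀ hu h6 two_ne_zero).1 h5
  have h8 := mul_nonneg hu (sub_nonneg.2 h7)
  linarith

end IsSolutionOn

/-- Every point with `p < 0` and `gap ε 0 > 0` has a global forward solution, which converges to
an equilibrium with `p = -|q|`. -/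
lemma exists_tendsto_of_gap {ε : ℝ} (hε : 0 < ε) {x : Phase} (hx : x ∈ halfSpace)
    (hp : x.2.1 < 0) (h0 : 0 < gap ε 0 x) :
    ∃ γ, IsSolutionOn ε (Ici 0) γ ∧ γ 0 = x ∧ ∃ Q : ℝ, Tendsto γ atTop (𝓝 (0, -|Q|, Q)) ∧
      ∀ t ∈ Ici (0 : ℝ), (γ t).2.2 ≤ Q := by
  have hs : 0 < √ε := Real.sqrt_pos.2 hε
  have hxu : 0 ≤ x.1 := hx
  obtain ⟨g, hg, hgx⟩ : ∃ g > 0, 0 ≤ gap ε g x := by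
    rcases hxu.eq_or_lt with hu | hu
    · refine ⟨1, one_pos, ?_⟩
      simp only [gap, ← hu] at h0 ⊢
      linarith
    · refine ⟨gap ε 0 x / x.1, by positivity, ?_⟩
      have : gap ε (gap ε 0 x / x.1) x = gap ε 0 x - gap ε 0 x / x.1 * x.1 := by
        simp only [gap]; ring
      rw [this, div_mul_cancel₀ _ hu.ne', sub_self]
  set c := (x.1 / g + 1) / √ε with hc
  have hc0 : 0 ≤ c := by positivity
  have hgc : x.1 ≤ g * (c * √ε) ^ 2 := by
    have h1 : c * √ε = x.1 / g + 1 := by rw [hc]; field_simp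
    have h2 : g * (x.1 / g + 1) ^ 2 = x.1 * (x.1 / g) + 2 * x.1 + g := by field_simp; ring
    have h3 : 0 ≤ x.1 * (x.1 / g) := by positivity
    rw [h1, h2]; linarith
  have hb : ∀ τ, 0 ≤ τ → ∀ γ, IsSolutionOn ε (Icc 0 τ) γ → γ 0 = x →
      (γ τ).2.1 ≤ 0 ∧ (γ τ).2.2 ≤ x.2.2 + c * x.1 ∧
        ‖γ τ‖ ≤ x.1 + |x.2.1| + |x.2.2| + |x.2.2 + c * x.1| := by
    intro τ hτ γ h hγ0
    have hpn : ∀ t ∈ Icc 0 τ, (γ t).2.1 ≤ 0 := fun t ht =>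
      (h.p_neg_of_gap hε (by rwa [hγ0]) (by rwa [hγ0]) t ht).le
    have hm : τ ∈ Icc 0 τ := ⟨hτ, le_rfl⟩
    have hu : ∀ t ∈ Icc 0 τ, (γ t).1 ≤ x.1 := fun t ht => by
      rw [← hγ0]; exact h.antitoneOn_u hpn ⟨le_rfl, hτ⟩ ht ht.1
    have hq1 : ∀ t ∈ Icc 0 τ, x.2.2 ≤ (γ t).2.2 := fun t ht => by
      rw [← hγ0]; exact h.monotoneOn_q ⟨le_rfl, hτ⟩ ht ht.1
    have hq2 : ∀ t ∈ Icc 0 τ, (γ t).2.2 ≤ x.2.2 + c * x.1 := fun t ht => by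
      have h1 := h.antitoneOn_q_add hε hc0 hpn (by rwa [hγ0]) (by rwa [hγ0]) ⟨le_rfl, hτ⟩ ht ht.1
      simp only [hγ0] at h1
      have h2 := mul_nonneg hc0 (h.nonneg ht)
      linarith
    have hqa : ∀ t ∈ Icc 0 τ, |(γ t).2.2| ≤ |x.2.2| + |x.2.2 + c * x.1| := fun t ht => by
      have h1 := hq1 t ht
      have h2 := hq2 t ht
      have h3 := neg_abs_le x.2.2
      have h4 := le_abs_self (x.2.2 + c * x.1)
      have h5 := abs_nonneg x.2.2
      have h6 := abs_nonneg (x.2.2 + c * x.1)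
      rw [abs_le]
      constructor <;> linarith
    have hpl := h.p_ge (P := |x.2.1| + |x.2.2| + |x.2.2 + c * x.1|) (by
      rw [hγ0]
      linarith [neg_abs_le x.2.1, abs_nonneg x.2.2, abs_nonneg (x.2.2 + c * x.1)])
      (fun t ht => (hqa t ht).trans (by linarith [abs_nonneg x.2.1])) τ hm
    have h5 := abs_nonneg x.2.2
    have h6 := abs_nonneg (x.2.2 + c * x.1)
    have h7 := abs_nonneg x.2.1
    refine ⟨hpn τ hm, hq2 τ hm, phase_norm_le ?_ ?_ ?_⟩
    · rw [abs_of_nonneg (h.nonneg hm)]; linarith [hu τ hm]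
    · rw [abs_of_nonpos (hpn τ hm)]; linarith
    · linarith [hqa τ hm]
  obtain ⟨γ, h, hγ0⟩ := exists_solution_Ici_of_bound hx fun T _ =>
    ⟨_, fun τ hτ γ h hγ0 => (hb τ hτ.1 γ h hγ0).2.2⟩
  have hb' := fun t (ht : 0 ≤ t) => hb t ht γ (h.mono Icc_subset_Ici_self) hγ0
  exact ⟨γ, h, hγ0, h.exists_tendsto hε
    ((eventually_ge_atTop 0).mono fun t ht => (hb' t ht).1) fun t ht => (hb' t ht).2.1⟩

/-- An open set whose part in the half-space is forward invariant and contained in the basin of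
`linePlusS`: the last condition bounds the limit of `q`, since `q + u / √ε` does not increase. -/
def trapPlus (ε : ℝ) : Set Phase :=
  {x | x.1 < 1 ∧ x.2.1 < 0 ∧ 0 < gap ε 1 x ∧ x.2.2 + 1 / √ε * x.1 < 0}

/-- An open set whose part in the half-space is forward invariant and contained in the basin of
`lineMinusS`: there `defectK` does not increase, and this keeps `p` away from zero. -/
def trapMinus (ε : ℝ) : Set Phase :=
  {x | 0 < x.2.2 ∧ x.2.1 < 0 ∧ defectK ε x < 0}

lemma isOpen_trapPlus (ε : ℝ) : IsOpen (trapPlus ε) := by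
  have h1 : IsOpen {x : Phase | x.1 < 1} := isOpen_lt (by fun_prop) (by fun_prop)
  have h2 : IsOpen {x : Phase | x.2.1 < 0} := isOpen_lt (by fun_prop) (by fun_prop)
  have h3 : IsOpen {x : Phase | 0 < gap ε 1 x} := isOpen_lt (by fun_prop) (continuous_gap ε 1)
  have h4 : IsOpen {x : Phase | x.2.2 + 1 / √ε * x.1 < 0} :=
    isOpen_lt (by fun_prop) (by fun_prop)
  exact h1.inter (h2.inter (h3.inter h4))

lemma isOpen_trapMinus (ε : ℝ) : IsOpen (trapMinus ε) := by
  have h1 : IsOpen {x : Phase | 0 < x.2.2} := isOpen_lt (by fun_prop) (by fun_prop)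
  have h2 : IsOpen {x : Phase | x.2.1 < 0} := isOpen_lt (by fun_prop) (by fun_prop)
  have h3 : IsOpen {x : Phase | defectK ε x < 0} :=
    isOpen_lt (continuous_defectK ε) (by fun_prop)
  exact h1.inter (h2.inter h3)

lemma mem_linePlusS {Q : ℝ} (hQ : Q < 0) : ((0, -|Q|, Q) : Phase) ∈ linePlusS :=
  ⟨⟨rfl, by simp [abs_of_neg hQ]⟩, hQ⟩

lemma mem_lineMinusS {Q : ℝ} (hQ : 0 < Q) : ((0, -|Q|, Q) : Phase) ∈ lineMinusS :=
  ⟨⟨rfl, by simp [abs_of_pos hQ]⟩, hQ⟩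

lemma trapPlus_subset {ε : ℝ} (hε : 0 < ε) {x : Phase} (hx : x ∈ halfSpace)
    (h : x ∈ trapPlus ε) : x ∈ terminatesAt ε linePlusS := by
  obtain ⟨h1, h2, h3, h4⟩ := h
  have hs : 0 < √ε := Real.sqrt_pos.2 hε
  have hxu : 0 ≤ x.1 := hx
  obtain ⟨γ, hγ, hγ0, Q, hQ, -⟩ := exists_tendsto_of_gap hε hx h2
    (by simp only [gap] at h3 ⊢; linarith)
  have hp : ∀ t, 0 ≤ t → ∀ r ∈ Icc 0 t, (γ r).2.1 ≤ 0 := fun t _ r hr =>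
    ((hγ.mono Icc_subset_Ici_self).p_neg_of_gap hε (by rwa [hγ0])
      (by rw [hγ0]; simp only [gap] at h3 ⊢; linarith) r hr).le
  have hq : ∀ t, 0 ≤ t → (γ t).2.2 ≤ x.2.2 + 1 / √ε * x.1 := by
    intro t ht
    have h5 := (hγ.mono Icc_subset_Ici_self).antitoneOn_q_add hε (g := 1) (c := 1 / √ε)
      (by positivity) (hp t ht) (by rw [hγ0]; exact h3.le) (by
        rw [hγ0, one_div_mul_cancel hs.ne']; linarith) ⟨le_rfl, ht⟩ ⟨ht, le_rfl⟩ ht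
    simp only [hγ0] at h5
    have h6 : 0 ≤ 1 / √ε * (γ t).1 := mul_nonneg (by positivity) (hγ.nonneg ht)
    linarith
  have hQ0 : Q < 0 := lt_of_le_of_lt (le_of_tendsto
    ((continuous_snd.comp continuous_snd).tendsto _ |>.comp hQ)
    ((eventually_ge_atTop 0).mono hq)) h4
  exact ⟨γ, hγ, hγ0, _, mem_linePlusS hQ0, hQ⟩

namespace IsSolutionOn

variable {ε : ℝ} {γ : ℝ → Phase} {a b : ℝ}

lemma trapMinus_invariant (hε : 0 < ε) (h : IsSolutionOn ε (Icc a b) γ)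
    (h0 : γ a ∈ trapMinus ε) : ∀ t ∈ Icc a b,
      (γ t).2.1 < 0 ∧ defectK ε (γ t) ≤ defectK ε (γ a) := by
  have hs : 0 < √ε := Real.sqrt_pos.2 hε
  obtain ⟨hq0, hp0, hk0⟩ := h0
  have hk : ∀ t ∈ Icc a b, (∀ r ∈ Icc a t, (γ r).2.1 ≤ 0) →
      AntitoneOn (fun t => defectK ε (γ t)) (Icc a t) := by
    intro t ht hle
    have hsol := h.mono (Icc_subset_Icc_right ht.2)
    refine antitoneOn_Icc_of_deriv (fun r hr => hsol.deriv_defectK hr) fun r hr => ?_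
    have hq : (γ a).2.2 ≤ (γ r).2.2 := hsol.monotoneOn_q ⟨le_rfl, ht.1⟩ hr hr.1
    have hl : defectL (γ r) ≤ 0 := by
      have := mul_nonpos_of_nonneg_of_nonpos (hsol.nonneg hr) (hle r hr)
      simp only [defectL]
      linarith
    exact mul_nonpos_of_nonneg_of_nonpos (by positivity) hl
  have hp : ∀ t ∈ Icc a b, (γ t).2.1 < 0 := by
    refine forall_Icc_of_open_induction (fun t ht hlt => (h.cont_p t ht).eventually
      (Iio_mem_nhds hlt)) hp0 fun t ht hlt => ?_
    have hsub : Icc a t ⊆ Icc a b := Icc_subset_Icc_right ht.2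
    have hle := le_on_Icc_of_le_on_Ico ht.1 (h.cont_p.mono hsub) fun r hr => (hlt r hr).le
    have hsol := h.mono hsub
    have := pos_of_deriv_ge_mul (f := fun t => -(γ t).2.1)
      (A := fun t => 1 / 2 * √ε * (γ t).2.1) (fun r hr => (hsol.deriv_p_eq hr).neg)
      (continuousOn_const.mul hsol.cont_p) (fun r hr => by
        have : defectK ε (γ r) ≤ defectK ε (γ a) :=
          hk t ⟨ht.1.le, ht.2⟩ hle ⟨le_rfl, ht.1.le⟩ hr hr.1
        linarith) (by linarith) t ⟨ht.1.le, le_rfl⟩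
    linarith
  exact fun t ht => ⟨hp t ht, hk t ht (fun r hr => (hp r ⟨hr.1, hr.2.trans ht.2⟩).le)
    ⟨le_rfl, ht.1⟩ ⟨ht.1, le_rfl⟩ ht.1⟩

end IsSolutionOn

lemma trapMinus_subset {ε : ℝ} (hε : 0 < ε) {x : Phase} (hx : x ∈ halfSpace)
    (h : x ∈ trapMinus ε) : x ∈ terminatesAt ε lineMinusS := by
  have hs : 0 < √ε := Real.sqrt_pos.2 hε
  have hxu : 0 ≤ x.1 := hx
  obtain ⟨hq0, hp0, hk0⟩ := id h
  have hb : ∀ τ, 0 ≤ τ → ∀ γ, IsSolutionOn ε (Icc 0 τ) γ → γ 0 = x →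
      ‖γ τ‖ ≤ x.1 + |x.2.1| + |x.2.2| + x.1 ^ 2 * τ := by
    intro τ hτ γ h' hγ0
    have hpn := fun t ht => (h'.trapMinus_invariant hε (by rwa [hγ0]) t ht).1
    have hm : τ ∈ Icc 0 τ := ⟨hτ, le_rfl⟩
    have hu : ∀ t ∈ Icc 0 τ, (γ t).1 ≤ x.1 := fun t ht => by
      rw [← hγ0]; exact h'.antitoneOn_u (fun t ht => (hpn t ht).le) ⟨le_rfl, hτ⟩ ht ht.1
    have hqa : ∀ t ∈ Icc 0 τ, |(γ t).2.2| ≤ |x.2.2| + x.1 ^ 2 * τ := fun t ht => by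
      have h1 : x.2.2 ≤ (γ t).2.2 := by
        rw [← hγ0]; exact h'.monotoneOn_q ⟨le_rfl, hτ⟩ ht ht.1
      have h2 := antitoneOn_Icc_of_deriv (f := fun t => (γ t).2.2 - x.1 ^ 2 * t)
        (fun r hr => (h'.deriv_q hr).sub
          (((hasDerivAt_id r).const_mul (x.1 ^ 2)).hasDerivWithinAt))
        (fun r hr => by
          have := pow_le_pow_left₀ (h'.nonneg hr) (hu r hr) 2
          linarith) ⟨le_rfl, hτ⟩ ht ht.1
      simp only [hγ0, mul_zero, sub_zero] at h2
      have h3 := mul_le_mul_of_nonneg_left ht.2 (sq_nonneg x.1)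
      rw [abs_of_pos hq0, abs_of_pos (hq0.trans_le h1)]
      linarith
    have h5 := abs_nonneg x.2.2
    have h6 : 0 ≤ x.1 ^ 2 * τ := by positivity
    have h7 := abs_nonneg x.2.1
    have hpl := h'.p_ge (P := |x.2.1| + |x.2.2| + x.1 ^ 2 * τ) (by
      rw [hγ0]
      linarith [neg_abs_le x.2.1]) (fun t ht => (hqa t ht).trans (by linarith)) τ hm
    refine phase_norm_le ?_ ?_ ?_
    · rw [abs_of_nonneg (h'.nonneg hm)]; linarith [hu τ hm]
    · rw [abs_of_neg (hpn τ hm)]; linarith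
    · linarith [hqa τ hm]
  obtain ⟨γ, hγ, hγ0⟩ := exists_solution_Ici_of_bound hx fun T _ =>
    ⟨x.1 + |x.2.1| + |x.2.2| + x.1 ^ 2 * T, fun τ hτ γ h hγ0 => (hb τ hτ.1 γ h hγ0).trans (by
      have := mul_le_mul_of_nonneg_left hτ.2 (sq_nonneg x.1)
      linarith)⟩
  have hinv : ∀ t ∈ Ici (0 : ℝ), (γ t).2.1 < 0 ∧ defectK ε (γ t) ≤ defectK ε x := by
    intro t ht
    have := (hγ.mono Icc_subset_Ici_self).trapMinus_invariant hε (by rwa [hγ0])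
      t (⟨ht, le_rfl⟩ : t ∈ Icc 0 t)
    rwa [hγ0] at this
  -- `p` is eventually bounded away from `0`, since `p' ≤ (2/3) k + (√ε/2) p²` with `k ≤ k(0) < 0`
  obtain ⟨β, hβ, hβk⟩ : ∃ β > 0, 1 / 2 * √ε * β ^ 2 ≤ -(1 / 3) * defectK ε x := by
    refine ⟨√(-(2 / 3) * defectK ε x / √ε), Real.sqrt_pos.2 (div_pos (by linarith) hs), ?_⟩
    rw [Real.sq_sqrt (div_nonneg (by linarith) hs.le)]
    field_simp
    linarith
  have hev := eventually_le_of_deriv_le (f := fun t => (γ t).2.1) (β := -β)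
    (c := -(1 / 3) * defectK ε x) (by linarith) (fun t ht => hγ.deriv_p_eq ht)
    (fun t ht hge => by
      obtain ⟨h1, h2⟩ := hinv t ht
      have h3 : (γ t).2.1 ^ 2 ≤ β ^ 2 := by
        nlinarith
      have h4 := mul_le_mul_of_nonneg_left h3 (show 0 ≤ 1 / 2 * √ε by positivity)
      linarith)
  obtain ⟨T, hT⟩ := eventually_atTop.1 (hev.and (eventually_ge_atTop 0))
  have hT0 : 0 ≤ T := (hT T le_rfl).2
  set c := (γ T).1 / (√ε * β) with hc
  have hqb : ∀ t ∈ Ici T, (γ t).2.2 ≤ (γ T).2.2 + c * (γ T).1 := by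
    intro t ht
    have hsol : IsSolutionOn ε (Icc T t) γ := hγ.mono fun r hr => hT0.trans hr.1
    have h1 := antitoneOn_Icc_of_deriv
      (fun r hr => (hsol.deriv_q hr).fun_add ((hsol.deriv_u hr).const_mul c)) (fun r hr => by
        have h2 : (γ r).2.1 ≤ -β := (hT r hr.1).1
        have h3 : (γ r).1 ≤ (γ T).1 := hsol.antitoneOn_u
          (fun r hr => ((hT r hr.1).1.trans (by linarith))) ⟨le_rfl, ht⟩ hr hr.1
        have h4 := hsol.nonneg hr
        have h5 : 0 ≤ c * √ε := by
          have := h4.trans h3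
          positivity
        have h6 : c * √ε * β = (γ T).1 := by rw [hc]; field_simp
        have h7 := mul_le_mul_of_nonneg_left h2 h5
        have h8 : (γ r).1 * ((γ r).1 + c * √ε * (γ r).2.1) ≤ 0 :=
          mul_nonpos_of_nonneg_of_nonpos h4 (by linarith)
        linarith) ⟨le_rfl, ht⟩ ⟨ht, le_rfl⟩ ht
    have h9 : 0 ≤ c * (γ t).1 := by
      have h4 := hsol.nonneg (⟨ht, le_rfl⟩ : t ∈ Icc T t)
      have h5 := hsol.nonneg (⟨le_rfl, ht⟩ : T ∈ Icc T t)
      positivity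
    linarith
  have hqb' : ∀ t ∈ Ici (0 : ℝ), (γ t).2.2 ≤ (γ T).2.2 + c * (γ T).1 := fun t ht =>
    (hγ.q_le_q ht (le_max_left t T)).trans (hqb _ (le_max_right t T))
  obtain ⟨Q, hQ, hQle⟩ := hγ.exists_tendsto hε
    ((eventually_ge_atTop 0).mono fun t ht => (hinv t ht).1.le) hqb'
  have hQ0 : 0 < Q := hq0.trans_le (by
    have := hQle 0 self_mem_Ici
    rwa [hγ0] at this)
  exact ⟨γ, hγ, hγ0, _, mem_lineMinusS hQ0, hQ⟩

/-! ### Openness of the basins and their closure -/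

lemma IsSolutionOn.exists_extend {ε : ℝ} {δ ζ : ℝ → Phase} {T : ℝ} (hT : 0 ≤ T)
    (hδ : IsSolutionOn ε (Icc 0 T) δ) (hζ : IsSolutionOn ε (Ici 0) ζ) (h : ζ 0 = δ T) :
    ∃ η, IsSolutionOn ε (Ici 0) η ∧ EqOn η δ (Icc 0 T) ∧ ∀ t, 0 ≤ t → η (t + T) = ζ t := by
  have h1 : IsSolutionOn ε (Ici T) (fun t => ζ (t + -T)) :=
    hζ.comp_add (-T) fun t ht => by simpa using ht
  have h2 := hδ.concat h1 (T := T) (fun t ht => ht.2) subset_rfl ⟨hT, le_rfl⟩ self_mem_Ici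
    (by simp [h])
  rw [Icc_union_Ici_eq_Ici hT] at h2
  refine ⟨_, h2, fun t ht => if_pos ht.2, fun t ht => ?_⟩
  rcases ht.eq_or_lt with h0 | h0
  · subst h0; simp [h]
  · simp [h0]

lemma mem_terminatesAt_of_Icc {ε : ℝ} {A : Set Phase} {δ : ℝ → Phase} {T : ℝ} (hT : 0 ≤ T)
    (hδ : IsSolutionOn ε (Icc 0 T) δ) (h : δ T ∈ terminatesAt ε A) :
    δ 0 ∈ terminatesAt ε A := by
  obtain ⟨ζ, hζ, hζ0, a, ha, hlim⟩ := h
  obtain ⟨η, hη, heq, htail⟩ := hδ.exists_extend hT hζ hζ0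
  refine ⟨η, hη, heq ⟨le_rfl, hT⟩, a, ha, ?_⟩
  refine (tendsto_congr' ?_).1 (hlim.comp (tendsto_atTop_add_const_right atTop (-T) tendsto_id))
  filter_upwards [eventually_ge_atTop T] with t ht
  have := htail (t + -T) (by linarith)
  simpa using this.symm

/-- The set of points that terminate at `A` is relatively open, if the points of `A` have an open
neighbourhood that terminates at `A`. -/
lemma eventually_mem_terminatesAt {ε : ℝ} {A U : Set Phase} (hU : IsOpen U) (hAU : A ⊆ U)
    (hUA : ∀ y ∈ halfSpace, y ∈ U → y ∈ terminatesAt ε A) {x : Phase}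
    (hx : x ∈ terminatesAt ε A) :
    ∀ᶠ y in 𝓝 x, y ∈ halfSpace → y ∈ terminatesAt ε A := by
  obtain ⟨γ, hγ, hγ0, a, ha, hlim⟩ := hx
  obtain ⟨T, hTU, hT⟩ :=
    ((hlim.eventually (hU.mem_nhds (hAU ha))).and (eventually_ge_atTop 0)).exists
  obtain ⟨η, hη, hball⟩ := Metric.isOpen_iff.1 hU _ hTU
  have := (hγ.mono (Icc_subset_Ici_self : Icc 0 T ⊆ Ici 0)).eventually_exists_near hT hη
  rw [hγ0] at this
  filter_upwards [this] with y hy hyh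
  obtain ⟨δ, hδ, hδ0, hnear⟩ := hy hyh
  have hTm : T ∈ Icc 0 T := ⟨hT, le_rfl⟩
  rw [← hδ0]
  exact mem_terminatesAt_of_Icc hT hδ (hUA _ (hδ T hTm).2 (hball (hnear T hTm)))

lemma eventually_mem_terminatesAt_linePlusS {ε : ℝ} (hε : 0 < ε) {x : Phase}
    (hx : x ∈ terminatesAt ε linePlusS) :
    ∀ᶠ y in 𝓝 x, y ∈ halfSpace → y ∈ terminatesAt ε linePlusS := by
  refine eventually_mem_terminatesAt (isOpen_trapPlus ε) ?_
    (fun y hy hyt => trapPlus_subset hε hy hyt) hx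
  rintro ⟨u, p, q⟩ ⟨⟨h1, h2⟩, h3⟩
  simp only at h1 h2 h3
  subst h1 h2
  refine ⟨one_pos, h3, ?_, ?_⟩
  · have := pow_pos (neg_pos.2 h3) 2
    simp only [gap]
    linarith
  · simpa using h3

lemma eventually_mem_terminatesAt_lineMinusS {ε : ℝ} (hε : 0 < ε) {x : Phase}
    (hx : x ∈ terminatesAt ε lineMinusS) :
    ∀ᶠ y in 𝓝 x, y ∈ halfSpace → y ∈ terminatesAt ε lineMinusS := by
  have hs : 0 < √ε := Real.sqrt_pos.2 hε
  refine eventually_mem_terminatesAt (isOpen_trapMinus ε) ?_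
    (fun y hy hyt => trapMinus_subset hε hy hyt) hx
  rintro ⟨u, p, q⟩ ⟨⟨h1, h2⟩, h3⟩
  simp only at h1 h2 h3
  subst h1 h2
  refine ⟨h3, by simpa using h3, ?_⟩
  have := mul_pos hs (pow_pos h3 2)
  simp only [defectK]
  linarith

lemma IsSolutionOn.q_le_of_tendsto {ε : ℝ} {γ : ℝ → Phase} {a : Phase}
    (h : IsSolutionOn ε (Ici 0) γ) (hlim : Tendsto γ atTop (𝓝 a)) {t : ℝ} (ht : 0 ≤ t) :
    (γ t).2.2 ≤ a.2.2 :=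
  ge_of_tendsto ((continuous_snd.comp continuous_snd).tendsto _ |>.comp hlim)
    ((eventually_ge_atTop t).mono fun _ hr => h.q_le_q ht hr)

lemma terminatesAt_subset_halfSpace {ε : ℝ} {A : Set Phase} : terminatesAt ε A ⊆ halfSpace := by
  rintro x ⟨γ, hγ, rfl, -⟩
  exact hγ.nonneg self_mem_Ici

lemma IsSolutionOn.q_neg_of_tendsto {ε : ℝ} {γ : ℝ → Phase} {a : Phase}
    (h : IsSolutionOn ε (Ici 0) γ) (ha : a ∈ linePlusS) (hlim : Tendsto γ atTop (𝓝 a))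
    {t : ℝ} (ht : 0 ≤ t) : (γ t).2.2 < 0 :=
  (h.q_le_of_tendsto hlim ht).trans_lt ha.2

/-- In the region `p + q > 0` solutions cannot reach `linePlusS`. -/
lemma IsSolutionOn.p_add_q_nonpos_of_tendsto {ε : ℝ} {γ : ℝ → Phase} {a : Phase}
    (h : IsSolutionOn ε (Ici 0) γ) (ha : a ∈ linePlusS) (hlim : Tendsto γ atTop (𝓝 a))
    {t : ℝ} (ht : 0 ≤ t) : (γ t).2.1 + (γ t).2.2 ≤ 0 := by
  by_contra hcon
  push Not at hcon
  have hpos : ∀ r ≥ t, 0 < (γ r).2.1 + (γ r).2.2 := by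
    intro r hr
    have hsol : IsSolutionOn ε (Icc t r) γ := h.mono fun r hr => ht.trans hr.1
    refine pos_of_deriv_ge_mul (A := fun r => √ε / 2 * ((γ r).2.1 - (γ r).2.2))
      (fun r hr => (hsol.deriv_p hr).fun_add (hsol.deriv_q hr))
      (continuousOn_const.mul (hsol.cont_p.sub hsol.cont_q)) (fun r hr => ?_) hcon r ⟨hr, le_rfl⟩
    have h1 := pow_nonneg (hsol.nonneg hr) 3
    have h2 := sq_nonneg (γ r).1
    linarith
  have hl : Tendsto (fun r => (γ r).2.1 + (γ r).2.2) atTop (𝓝 (a.2.1 + a.2.2)) :=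
    ((show Continuous fun x : Phase => x.2.1 + x.2.2 by fun_prop).tendsto a).comp hlim
  have := ge_of_tendsto hl ((eventually_ge_atTop t).mono fun r hr => (hpos r hr).le)
  have h1 := ha.1.2
  have h2 := ha.2
  linarith

lemma IsSolutionOn.norm_le_of_tendsto_linePlusS {ε : ℝ} {γ : ℝ → Phase} {a : Phase}
    (h : IsSolutionOn ε (Ici 0) γ) (ha : a ∈ linePlusS) (hlim : Tendsto γ atTop (𝓝 a))
    {T t : ℝ} (ht : t ∈ Icc 0 T) :
    ‖γ t‖ ≤ (γ 0).1 * Real.exp (√ε * |(γ 0).2.2| * T) + |(γ 0).2.1| + |(γ 0).2.2| := by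
  have hsol : IsSolutionOn ε (Icc 0 T) γ := h.mono Icc_subset_Ici_self
  have h0T : (0 : ℝ) ∈ Icc 0 T := ⟨le_rfl, ht.1.trans ht.2⟩
  have hq : ∀ r ∈ Icc 0 T, |(γ r).2.2| ≤ |(γ 0).2.2| := by
    intro r hr
    have h1 := hsol.monotoneOn_q h0T hr hr.1
    simp only at h1
    have h2 := h.q_neg_of_tendsto ha hlim hr.1
    rw [abs_of_neg h2, abs_of_neg (h1.trans_lt h2)]
    linarith
  have hp : ∀ r ∈ Icc 0 T, (γ r).2.1 ≤ |(γ 0).2.2| := by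
    intro r hr
    have h1 := h.p_add_q_nonpos_of_tendsto ha hlim hr.1
    have h2 := hq r hr
    linarith [neg_abs_le (γ r).2.2]
  have hpl := hsol.p_ge (P := |(γ 0).2.1| + |(γ 0).2.2|)
    (by linarith [neg_abs_le (γ 0).2.1, abs_nonneg (γ 0).2.2])
    (fun r hr => (hq r hr).trans (by linarith [abs_nonneg (γ 0).2.1])) t ht
  have hu : (γ t).1 ≤ (γ 0).1 * Real.exp (√ε * |(γ 0).2.2| * T) := by
    set c := √ε * |(γ 0).2.2| with hc
    have hanti := antitoneOn_Icc_of_deriv (f := fun r => (γ r).1 * Real.exp (-c * r))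
      (fun r hr => (hsol.deriv_u hr).mul
        (((hasDerivAt_id r).const_mul (-c)).exp.hasDerivWithinAt)) (fun r hr => by
        have h1 := mul_le_mul_of_nonneg_left (hp r hr)
          (mul_nonneg (Real.sqrt_nonneg ε) (hsol.nonneg hr))
        have h2 : √ε * (γ r).1 * (γ r).2.1 - (γ r).1 * c ≤ 0 := by
          have : (γ r).1 * c = √ε * (γ r).1 * |(γ 0).2.2| := by rw [hc]; ring
          linarith
        have h3 := mul_nonpos_of_nonpos_of_nonneg h2 (Real.exp_pos (-c * r)).le
        simp only [id]
        linarith) h0T ht ht.1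
    simp only [mul_zero, Real.exp_zero, mul_one] at hanti
    have h3 : (γ t).1 = (γ t).1 * Real.exp (-c * t) * Real.exp (c * t) := by
      rw [mul_assoc, ← Real.exp_add]; simp
    have h4 : Real.exp (c * t) ≤ Real.exp (c * T) := by
      rw [Real.exp_le_exp]; exact mul_le_mul_of_nonneg_left ht.2 (by positivity)
    have hu0 := h.nonneg (self_mem_Ici (a := (0 : ℝ)))
    calc (γ t).1 = (γ t).1 * Real.exp (-c * t) * Real.exp (c * t) := h3
      _ ≤ (γ 0).1 * Real.exp (c * t) := mul_le_mul_of_nonneg_right hanti (Real.exp_pos _).le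
      _ ≤ _ := mul_le_mul_of_nonneg_left h4 hu0
  have hut := hsol.nonneg ht
  have h5 := abs_nonneg (γ 0).2.1
  have h6 := abs_nonneg (γ 0).2.2
  refine phase_norm_le ?_ ?_ ?_
  · rw [abs_of_nonneg hut]; linarith
  · rw [abs_le]
    have := hp t ht
    constructor <;> linarith
  · have := hq t ht
    linarith

/-- Limits of points that terminate at `linePlusS` have global forward solutions, along which
`q ≤ 0`: the solutions that reach `linePlusS` are bounded locally uniformly. -/
lemma exists_solution_of_mem_closure {ε : ℝ} {x : Phase}
    (hx : x ∈ closure (terminatesAt ε linePlusS)) :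
    ∃ γ, IsSolutionOn ε (Ici 0) γ ∧ γ 0 = x ∧ ∀ t ∈ Ici (0 : ℝ), (γ t).2.2 ≤ 0 := by
  have hxh : x ∈ halfSpace :=
    closure_minimal terminatesAt_subset_halfSpace
      (isClosed_le continuous_const continuous_fst) hx
  have key : ∀ T : ℝ, 0 ≤ T → ∃ γ, IsSolutionOn ε (Icc 0 T) γ ∧ γ 0 = x ∧
      ∀ t ∈ Icc 0 T, (γ t).2.2 ≤ 0 := by
    intro T hT
    set R := (‖x‖ + 1) * Real.exp (√ε * (‖x‖ + 1) * T) + (‖x‖ + 1) + (‖x‖ + 1) with hR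
    obtain ⟨w, K, L, hK, hL, hw⟩ := exists_truncation ε R
    obtain ⟨γ, hγ0, hγ⟩ := exists_solution_of_bounded_lipschitz hK hL x hT
    have happ : ∀ t ∈ Icc 0 T, ∀ η > 0, ‖γ t‖ ≤ R + η ∧ (γ t).2.2 ≤ 0 + η := by
      intro t ht η hη
      have hpos : 0 < min 1 (η / Real.exp (K * t)) := by positivity
      obtain ⟨y, ⟨δ, hδ, hδ0, a, ha, hlim⟩, hyx⟩ := Metric.mem_closure_iff.1 hx _ hpos
      have hyn : ‖δ 0‖ ≤ ‖x‖ + 1 := by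
        have h1 : ‖x - δ 0‖ < 1 := by
          rw [hδ0, ← dist_eq_norm]; exact hyx.trans_le (min_le_left _ _)
        have h2 := norm_le_norm_add_norm_sub x (δ 0)
        linarith
      have hc := hyn
      simp only [Prod.norm_def, Real.norm_eq_abs, max_le_iff] at hc
      have hδn : ∀ r ∈ Icc 0 T, ‖δ r‖ ≤ R := by
        intro r hr
        refine (hδ.norm_le_of_tendsto_linePlusS ha hlim hr).trans ?_
        simp only [hR]
        have h1 : (δ 0).1 ≤ ‖x‖ + 1 := (le_abs_self _).trans hc.1
        have h2 : √ε * |(δ 0).2.2| * T ≤ √ε * (‖x‖ + 1) * T :=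
          mul_le_mul_of_nonneg_right
            (mul_le_mul_of_nonneg_left hc.2.2 (Real.sqrt_nonneg _)) hT
        have h3 := Real.exp_le_exp.2 h2
        have h4 : (δ 0).1 * Real.exp (√ε * |(δ 0).2.2| * T) ≤
            (‖x‖ + 1) * Real.exp (√ε * (‖x‖ + 1) * T) :=
          mul_le_mul h1 h3 (Real.exp_pos _).le (by positivity)
        exact add_le_add (add_le_add h4 hc.2.1) hc.2.2
      have hd := dist_le_of_lipschitz_solutions hK hγ (δ := δ)
        (fun r hr => by rw [hw _ (hδn r hr)]; exact (hδ.mono Icc_subset_Ici_self r hr).1) t ht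
      rw [hγ0, hδ0, sub_zero] at hd
      have hlt : dist x y < η / Real.exp (K * t) := hyx.trans_le (min_le_right _ _)
      rw [lt_div_iff₀ (Real.exp_pos _)] at hlt
      have hd' : ‖γ t - δ t‖ ≤ η := by rw [← dist_eq_norm]; exact hd.trans hlt.le
      constructor
      · have h1 := norm_le_norm_add_norm_sub (δ t) (γ t)
        rw [norm_sub_rev] at h1
        linarith [hδn t ht]
      · have h2 : |(γ t).2.2 - (δ t).2.2| ≤ η :=
          ((norm_snd_le (γ t - δ t).2).trans (norm_snd_le (γ t - δ t))).trans hd'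
        have h3 := hδ.q_neg_of_tendsto ha hlim ht.1
        linarith [le_abs_self ((γ t).2.2 - (δ t).2.2)]
    refine ⟨γ, isSolutionOn_of_hasDerivWithinAt (fun t ht => ?_) (by rwa [hγ0]), hγ0,
      fun t ht => le_of_forall_pos_le_add fun η hη => (happ t ht η hη).2⟩
    rw [← hw _ (le_of_forall_pos_le_add fun η hη => (happ t ht η hη).1)]
    exact hγ t ht
  obtain ⟨γ, hγ, hγ0⟩ := exists_solution_Ici_of_Icc fun T hT =>
    let ⟨γ, h1, h2, _⟩ := key T hT
    ⟨γ, h1, h2⟩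
  refine ⟨γ, hγ, hγ0, fun t ht => ?_⟩
  obtain ⟨δ, hδ, hδ0, hδq⟩ := key t ht
  have htm : t ∈ Icc 0 t := ⟨ht, le_rfl⟩
  rw [(hγ.mono Icc_subset_Ici_self).eqOn_Icc hδ (hγ0.trans hδ0.symm) htm]
  exact hδq t htm

/-- A global solution in `{u > 0}` along which `q ≤ 0` eventually has `p ≤ 0`. Otherwise `q` would
be unbounded: where `p > 0` and `defectK ≥ 0`, both functions increase and hence so does `u`. -/
lemma IsSolutionOn.eventually_p_nonpos {ε : ℝ} {γ : ℝ → Phase} (h : IsSolutionOn ε (Ici 0) γ)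
    (hu0 : 0 < (γ 0).1) (hq : ∀ t ∈ Ici (0 : ℝ), (γ t).2.2 ≤ 0) :
    ∀ᶠ t in atTop, (γ t).2.1 ≤ 0 := by
  have hupos : ∀ t ∈ Ici (0 : ℝ), 0 < (γ t).1 := fun t ht =>
    (h.mono Icc_subset_Ici_self).u_pos hu0 t (⟨ht, le_rfl⟩ : t ∈ Icc 0 t)
  have hex : ∀ t0 ∈ Ici (0 : ℝ), ∃ t ∈ Ici t0, (γ t).2.1 ≤ 0 := by
    intro t0 ht0
    by_contra hcon
    push Not at hcon
    have hsol : IsSolutionOn ε (Ici t0) γ := h.mono (Ici_subset_Ici.2 ht0)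
    obtain ⟨t, ht, hlt⟩ := hsol.exists_lt_q (hupos t0 ht0) (fun t ht => by
      have hs : IsSolutionOn ε (Icc t0 t) γ := hsol.mono Icc_subset_Ici_self
      exact monotoneOn_Icc_of_deriv (fun r hr => hs.deriv_u hr) (fun r hr =>
        mul_nonneg (mul_nonneg (Real.sqrt_nonneg _) (hs.nonneg hr)) (hcon r hr.1).le)
        ⟨le_rfl, ht⟩ ⟨ht, le_rfl⟩ ht) 0
    exact absurd (hq t (mem_Ici.1 ht0 |>.trans ht)) (not_le.2 hlt)
  have hk : ∀ t1 ∈ Ici (0 : ℝ), 0 < (γ t1).2.1 → defectK ε (γ t1) < 0 := by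
    intro t1 ht1 hp1
    by_contra hcon
    push Not at hcon
    obtain ⟨t2, ht2, hp2⟩ := hex t1 ht1
    have hsol : IsSolutionOn ε (Icc t1 t2) γ := h.mono fun r hr => (mem_Ici.1 ht1).trans hr.1
    have := forall_Icc_of_open_induction (P := fun t => 0 < (γ t).2.1)
      (fun t ht hlt => (hsol.cont_p t ht).eventually (Ioi_mem_nhds hlt)) hp1 (fun t ht hlt => by
        have hsub : Icc t1 t ⊆ Icc t1 t2 := Icc_subset_Icc_right ht.2
        have hs := hsol.mono hsub
        have hge := ge_on_Icc_of_ge_on_Ico ht.1 hs.cont_p fun r hr => (hlt r hr).le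
        have hkm := monotoneOn_Icc_of_deriv (fun r hr => hs.deriv_defectK hr) fun r hr => by
          have hl : 0 ≤ defectL (γ r) := by
            have h1 := mul_nonneg (hs.nonneg hr) (hge r hr)
            have h2 := hq r ((mem_Ici.1 ht1).trans hr.1)
            simp only [defectL]
            linarith
          positivity
        have hpm := monotoneOn_Icc_of_deriv (fun r hr => hs.deriv_p_eq hr) fun r hr => by
          have h1 := hkm ⟨le_rfl, ht.1.le⟩ hr hr.1
          simp only at h1
          have h2 : 0 ≤ defectK ε (γ r) := hcon.trans h1
          positivity
        exact hp1.trans_le (hpm ⟨le_rfl, ht.1.le⟩ ⟨ht.1.le, le_rfl⟩ ht.1.le)) t2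
        ⟨ht2, le_rfl⟩
    exact absurd hp2 (not_le.2 this)
  obtain ⟨t0, ht0, hp0⟩ := hex 0 self_mem_Ici
  filter_upwards [eventually_ge_atTop t0] with t ht
  have hsol : IsSolutionOn ε (Icc t0 t) γ := h.mono fun r hr => (mem_Ici.1 ht0).trans hr.1
  have := nonneg_of_deriv_ge_mul (f := fun t => -(γ t).2.1)
    (A := fun t => 1 / 2 * √ε * (γ t).2.1) (fun r hr => (hsol.deriv_p_eq hr).neg)
    (continuousOn_const.mul hsol.cont_p) (fun r hr hlt => by
      have := hk r ((mem_Ici.1 ht0).trans hr.1) (by linarith)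
      linarith) (by linarith) t ⟨ht, le_rfl⟩
  linarith

/-- The same conclusion in the invariant plane `u = 0`, between the lines of equilibria. -/
lemma IsSolutionOn.eventually_p_nonpos_of_u_eq_zero {ε : ℝ} (hε : 0 < ε) {γ : ℝ → Phase}
    (h : IsSolutionOn ε (Ici 0) γ) (hu0 : (γ 0).1 = 0) (hq : (γ 0).2.2 ≤ 0)
    (hp : (γ 0).2.1 + (γ 0).2.2 < 0) :
    ∀ᶠ t in atTop, (γ t).2.1 ≤ 0 := by
  have hs : 0 < √ε := Real.sqrt_pos.2 hε
  have hu : ∀ t ∈ Ici (0 : ℝ), (γ t).1 = 0 := fun t ht =>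
    (h.mono Icc_subset_Ici_self).u_eq_zero hu0 t (⟨ht, le_rfl⟩ : t ∈ Icc 0 t)
  have hqc : ∀ t ∈ Ici (0 : ℝ), (γ t).2.2 = (γ 0).2.2 := fun t ht => h.q_eq_of_u_eq_zero hu0 ht
  set q := (γ 0).2.2 with hq0
  have hd : ∀ {J : Set ℝ}, J ⊆ Ici 0 → ∀ t ∈ J, HasDerivWithinAt (fun t => (γ t).2.1)
      (1 / 2 * √ε * ((γ t).2.1 ^ 2 - q ^ 2)) J t := by
    intro J hJ t ht
    refine ((h.mono hJ).deriv_p ht).congr_deriv ?_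
    rw [hu t (hJ ht), hqc t (hJ ht)]
    ring
  have hlt : ∀ t ∈ Ici (0 : ℝ), (γ t).2.1 + q < 0 := by
    intro t ht
    have hsol : IsSolutionOn ε (Icc 0 t) γ := h.mono Icc_subset_Ici_self
    have := pos_of_deriv_ge_mul (f := fun t => -((γ t).2.1 + q))
      (A := fun t => 1 / 2 * √ε * ((γ t).2.1 - q))
      (fun r hr => ((hd Icc_subset_Ici_self r hr).add_const q).neg)
      (continuousOn_const.mul (hsol.cont_p.sub continuousOn_const)) (fun r hr => by
        linarith) (by linarith) t ⟨ht, le_rfl⟩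
    linarith
  rcases hq.eq_or_lt with h0 | h0
  · filter_upwards [eventually_ge_atTop 0] with t ht
    have := hlt t ht
    linarith
  set P := max (γ 0).2.1 0 with hP
  have hP0 : 0 ≤ P := le_max_right _ _
  have hPq : P < -q := max_lt (by linarith) (by linarith)
  have hle : ∀ t ∈ Ici (0 : ℝ), (γ t).2.1 ≤ P := by
    intro t ht
    have := nonneg_of_deriv_ge_mul (f := fun t => P - (γ t).2.1) (A := fun _ => 0)
      (fun r hr => (hd Icc_subset_Ici_self r hr).const_sub P) continuousOn_const
      (fun r hr hneg => by
        have h1 := hlt r hr.1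
        have h2 : (γ r).2.1 ^ 2 ≤ (-q) ^ 2 := pow_le_pow_left₀ (by linarith) (by linarith) 2
        have h3 := mul_le_mul_of_nonneg_left h2 (show 0 ≤ 1 / 2 * √ε by positivity)
        linarith) (by linarith [le_max_left (γ 0).2.1 0]) t ⟨ht, le_rfl⟩
    linarith
  refine eventually_le_of_deriv_le (c := 1 / 2 * √ε * (q ^ 2 - P ^ 2)) ?_
    (fun t ht => hd subset_rfl t ht) (fun t ht hge => ?_)
  · have : 0 < q ^ 2 - P ^ 2 := by nlinarith
    positivity
  · have h2 : (γ t).2.1 ^ 2 ≤ P ^ 2 := pow_le_pow_left₀ hge (hle t ht) 2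
    have h3 := mul_le_mul_of_nonneg_left h2 (show 0 ≤ 1 / 2 * √ε by positivity)
    linarith

/-- A nonstationary limit of points that terminate at `linePlusS` terminates at `linePlusS` or at
the origin. -/
lemma mem_of_mem_closure_terminatesAt {ε : ℝ} (hε : 0 < ε) {x : Phase}
    (hx : x ∈ closure (terminatesAt ε linePlusS)) (hxE : x ∉ equilibria ε) :
    x ∈ terminatesAt ε linePlusS ∨ x ∈ terminatesAt ε {0} := by
  obtain ⟨γ, hγ, hγ0, hq⟩ := exists_solution_of_mem_closure hx
  have hev : ∀ᶠ t in atTop, (γ t).2.1 ≤ 0 := by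
    rcases (hγ.nonneg (self_mem_Ici (a := (0 : ℝ)))).eq_or_lt with hu | hu
    · have hpq : x.2.1 + x.2.2 ≤ 0 := by
        have hcl : IsClosed {x : Phase | x.2.1 + x.2.2 ≤ 0} :=
          isClosed_le (by fun_prop) (by fun_prop)
        refine closure_minimal ?_ hcl hx
        rintro y ⟨δ, hδ, rfl, a, ha, hlim⟩
        exact hδ.p_add_q_nonpos_of_tendsto ha hlim le_rfl
      refine hγ.eventually_p_nonpos_of_u_eq_zero hε hu.symm (hq 0 self_mem_Ici) ?_
      rw [hγ0]
      refine lt_of_le_of_ne hpq fun h0 => hxE ⟨?_, ?_⟩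
      · rw [← hγ0]; exact hγ.nonneg self_mem_Ici
      · rw [hγ0] at hu
        have h1 : x.2.1 = -x.2.2 := by linarith
        simp [field, ← hu, h1]
    · exact hγ.eventually_p_nonpos hu hq
  obtain ⟨Q, hQ, -⟩ := hγ.exists_tendsto hε hev hq
  have hQ0 : Q ≤ 0 := le_of_tendsto
    ((continuous_snd.comp continuous_snd).tendsto _ |>.comp hQ)
    ((eventually_ge_atTop 0).mono hq)
  rcases hQ0.eq_or_lt with h | h
  · right
    refine ⟨γ, hγ, hγ0, 0, rfl, ?_⟩
    rw [h, abs_zero, neg_zero] at hQ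
    exact hQ
  · exact Or.inl ⟨γ, hγ, hγ0, _, mem_linePlusS h, hQ⟩

/-! ### Order preservation and neighbours of the stable manifold -/

namespace IsSolutionOn

variable {ε : ℝ} {γ δ : ℝ → Phase} {T : ℝ}

/-- The system is cooperative in `{q ≤ 0}`: the componentwise order of initial points is preserved
there. Only the sum of the two `q` components enters, through the factorization of the difference
of their squares. -/
lemma comparison (hγ : IsSolutionOn ε (Icc 0 T) γ) (hδ : IsSolutionOn ε (Icc 0 T) δ)
    (hu : (γ 0).1 ≤ (δ 0).1) (hp : (γ 0).2.1 ≤ (δ 0).2.1) (hq : (γ 0).2.2 ≤ (δ 0).2.2)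
    (hneg : ∀ t ∈ Icc 0 T, (γ t).2.2 + (δ t).2.2 ≤ 0) :
    (∀ t ∈ Icc 0 T, (γ t).1 ≤ (δ t).1) ∧
      MonotoneOn (fun t => (δ t).2.2 - (γ t).2.2) (Icc 0 T) := by
  have hs : 0 ≤ √ε := Real.sqrt_nonneg ε
  set A : Fin 3 → Fin 3 → ℝ → ℝ :=
    ![![fun t => √ε * (γ t).2.1, fun t => √ε * (δ t).1, fun _ => 0],
      ![fun t => 2 / 3 * ((δ t).1 ^ 2 + (δ t).1 * (γ t).1 + (γ t).1 ^ 2),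
        fun t => 1 / 2 * √ε * ((δ t).2.1 + (γ t).2.1),
        fun t => -(1 / 2 * √ε * ((γ t).2.2 + (δ t).2.2))],
      ![fun t => (δ t).1 + (γ t).1, fun _ => 0, fun _ => 0]] with hA
  have key := nonneg_of_cooperative
    (f := ![fun t => (δ t).1 - (γ t).1, fun t => (δ t).2.1 - (γ t).2.1,
      fun t => (δ t).2.2 - (γ t).2.2])
    (f' := ![fun t => √ε * (δ t).1 * (δ t).2.1 - √ε * (γ t).1 * (γ t).2.1,
      fun t => (2 / 3 * (δ t).1 ^ 3 + 1 / 2 * √ε * ((δ t).2.1 ^ 2 - (δ t).2.2 ^ 2)) -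
        (2 / 3 * (γ t).1 ^ 3 + 1 / 2 * √ε * ((γ t).2.1 ^ 2 - (γ t).2.2 ^ 2)),
      fun t => (δ t).1 ^ 2 - (γ t).1 ^ 2]) (A := A) (a := 0) (b := T) ?_ ?_ ?_ ?_ ?_
  · have hle : ∀ t ∈ Icc 0 T, (γ t).1 ≤ (δ t).1 := fun t ht => by
      have := key t ht 0
      simp at this
      exact this
    refine ⟨hle, monotoneOn_Icc_of_deriv (fun t ht => (hδ.deriv_q ht).sub (hγ.deriv_q ht))
      fun t ht => ?_⟩
    have := pow_le_pow_left₀ (hγ.nonneg ht) (hle t ht) 2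
    linarith
  · intro i t ht
    fin_cases i
    · exact (hδ.deriv_u ht).sub (hγ.deriv_u ht)
    · exact (hδ.deriv_p ht).sub (hγ.deriv_p ht)
    · exact (hδ.deriv_q ht).sub (hγ.deriv_q ht)
  · have h1 := hγ.cont_u
    have h2 := hγ.cont_p
    have h3 := hγ.cont_q
    have h4 := hδ.cont_u
    have h5 := hδ.cont_p
    have h6 := hδ.cont_q
    intro i j
    fin_cases i <;> fin_cases j <;> simp [hA] <;> fun_prop
  · intro i j hij t ht
    have h1 := hγ.nonneg ht
    have h2 := hδ.nonneg ht
    have h3 := mul_nonneg hs (neg_nonneg.2 (hneg t ht))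
    fin_cases i <;> fin_cases j <;> simp [hA] at hij ⊢ <;> first | positivity | nlinarith
  · intro i t ht _
    refine le_of_eq ?_
    fin_cases i <;> simp [hA, Fin.sum_univ_three] <;> ring
  · intro i
    fin_cases i <;> simpa

/-- Solutions in `{u > 0}` that tend to the origin do so inside the region where solutions near them
still converge. Otherwise `p² ≤ (2 / (3√ε)) u³` throughout; then `q + B √u` is nondecreasing for a
suitable `B` and tends to `0`, which gives `q² ≥ (6 / √ε) u`, so that `p' ≤ 0` and `p` cannot
increase to `0`. -/
lemma exists_gap_pos_of_tendsto_zero (hε : 0 < ε) (h : IsSolutionOn ε (Ici 0) γ)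
    (hu0 : 0 < (γ 0).1) (hlim : Tendsto γ atTop (𝓝 0)) :
    ∃ T, 0 ≤ T ∧ (γ T).2.1 < 0 ∧ 0 < gap ε 0 (γ T) := by
  by_contra hcon
  push Not at hcon
  have hs : 0 < √ε := Real.sqrt_pos.2 hε
  have hupos : ∀ t ∈ Ici (0 : ℝ), 0 < (γ t).1 := fun t ht =>
    (h.mono Icc_subset_Ici_self).u_pos hu0 t (⟨ht, le_rfl⟩ : t ∈ Icc 0 t)
  have hlu : Tendsto (fun t => (γ t).1) atTop (𝓝 0) := (continuous_fst.tendsto _).comp hlim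
  have hlp : Tendsto (fun t => (γ t).2.1) atTop (𝓝 0) :=
    ((continuous_fst.comp continuous_snd).tendsto _).comp hlim
  have hlq : Tendsto (fun t => (γ t).2.2) atTop (𝓝 0) :=
    ((continuous_snd.comp continuous_snd).tendsto _).comp hlim
  have hq : ∀ t ∈ Ici (0 : ℝ), (γ t).2.2 ≤ 0 := fun t ht => h.q_le_of_tendsto hlim ht
  obtain ⟨T, hT⟩ := eventually_atTop.1 ((h.eventually_p_nonpos hu0 hq).and
    ((hlu.eventually (Iio_mem_nhds one_pos)).and (eventually_ge_atTop 0)))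
  have hT0 : 0 ≤ T := (hT T le_rfl).2.2
  have hsol : ∀ {a b : ℝ}, T ≤ a → IsSolutionOn ε (Icc a b) γ := fun ha =>
    h.mono fun r hr => hT0.trans (ha.trans hr.1)
  have hp2 : ∀ t ≥ T, (γ t).2.1 ^ 2 ≤ 2 / (3 * √ε) * (γ t).1 ^ 3 := by
    intro t ht
    have hu := hupos t (hT0.trans ht)
    rcases (hT t ht).1.eq_or_lt with h0 | h0
    · rw [h0, zero_pow two_ne_zero]; positivity
    · have := hcon t (hT0.trans ht) h0
      simp only [gap] at this
      linarith
  set C := √(2 / (3 * √ε)) with hC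
  have hC0 : 0 < C := Real.sqrt_pos.2 (by positivity)
  have hC2 : C ^ 2 = 2 / (3 * √ε) := Real.sq_sqrt (by positivity)
  set B := 2 / (√ε * C) with hB
  have hB0 : 0 < B := by positivity
  have hBC : B * √ε * C = 2 := by rw [hB]; field_simp
  have hφ : ∀ t ≥ T, (γ t).2.2 + B * √(γ t).1 ≤ 0 := by
    intro t ht
    have hl : Tendsto (fun t => (γ t).2.2 + B * √(γ t).1) atTop (𝓝 0) := by
      have := hlq.add ((Real.continuous_sqrt.tendsto _ |>.comp hlu).const_mul B)
      simpa using this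
    refine ge_of_tendsto hl ((eventually_ge_atTop t).mono fun r hr => ?_)
    refine monotoneOn_Icc_of_deriv (f := fun t => (γ t).2.2 + B * √(γ t).1)
      (fun r hr => ((hsol ht).deriv_q hr).fun_add
        ((((hsol ht).deriv_u hr).sqrt (hupos r (hT0.trans (ht.trans hr.1))).ne').const_mul B))
      (fun r hr => ?_) ⟨le_rfl, hr⟩ ⟨hr, le_rfl⟩ hr
    have hu := hupos r (hT0.trans (ht.trans hr.1))
    have hpr := (hT r (ht.trans hr.1)).1
    set w := √(γ r).1 with hw
    have hw0 : 0 < w := Real.sqrt_pos.2 hu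
    have hwu : (γ r).1 = w ^ 2 := (Real.sq_sqrt hu.le).symm
    have h1 : (-(γ r).2.1) ^ 2 ≤ (C * w ^ 3) ^ 2 := by
      have := hp2 r (ht.trans hr.1)
      rw [hwu, ← hC2] at this
      linarith
    have h2 : -(γ r).2.1 ≤ C * w ^ 3 :=
      (pow_le_pow_iff_left₀ (by linarith) (by positivity) two_ne_zero).1 h1
    have h3 : B * (√ε * (γ r).1 * (γ r).2.1 / (2 * w)) = -(B * √ε / 2 * w * -(γ r).2.1) := by
      rw [hwu]; field_simp
    have h4 : B * √ε / 2 * w * -(γ r).2.1 ≤ B * √ε / 2 * w * (C * w ^ 3) :=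
      mul_le_mul_of_nonneg_left h2 (by positivity)
    have h5 : B * √ε / 2 * w * (C * w ^ 3) = (γ r).1 ^ 2 := by
      rw [hwu]
      linear_combination (w ^ 4 / 2) * hBC
    rw [h3]
    linarith
  have hpd : ∀ a ≥ T, ∀ b, AntitoneOn (fun t => (γ t).2.1) (Icc a b) := by
    intro a ha b
    refine antitoneOn_Icc_of_deriv (fun r hr => (hsol ha).deriv_p hr) fun r hr => ?_
    have hrT := ha.trans hr.1
    have hu := hupos r (hT0.trans hrT)
    have hu1 : (γ r).1 < 1 := (hT r hrT).2.1
    have h1 := hφ r hrT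
    have h2 : (B * √(γ r).1) ^ 2 ≤ (-(γ r).2.2) ^ 2 :=
      pow_le_pow_left₀ (by positivity) (by linarith) 2
    have h3 : (B * √(γ r).1) ^ 2 = 6 / √ε * (γ r).1 := by
      rw [mul_pow, Real.sq_sqrt hu.le, hB, div_pow, mul_pow, hC2]
      field_simp
      norm_num
    have h4 := hp2 r hrT
    have h5 : 1 / 2 * √ε * ((γ r).2.1 ^ 2 - (γ r).2.2 ^ 2) ≤
        1 / 2 * √ε * (2 / (3 * √ε) * (γ r).1 ^ 3 - 6 / √ε * (γ r).1) :=
      mul_le_mul_of_nonneg_left (by linarith) (by positivity)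
    have h6 : 1 / 2 * √ε * (2 / (3 * √ε) * (γ r).1 ^ 3 - 6 / √ε * (γ r).1) =
        1 / 3 * (γ r).1 ^ 3 - 3 * (γ r).1 := by field_simp; ring
    have h7 : (γ r).1 ^ 3 ≤ (γ r).1 := by
      calc (γ r).1 ^ 3 = (γ r).1 * (γ r).1 ^ 2 := by ring
        _ ≤ (γ r).1 * 1 := mul_le_mul_of_nonneg_left (pow_le_one₀ hu.le hu1.le) hu.le
        _ = (γ r).1 := mul_one _
    linarith
  obtain ⟨t2, ht2, hpt2⟩ : ∃ t ≥ T, (γ t).2.1 < 0 := by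
    by_contra hnn
    push Not at hnn
    have := ge_of_tendsto hlu ((eventually_ge_atTop T).mono fun r hr =>
      monotoneOn_Icc_of_deriv (fun t ht => (hsol le_rfl).deriv_u ht) (fun t ht =>
        mul_nonneg (mul_nonneg hs.le (h.nonneg (hT0.trans ht.1))) (hnn t ht.1))
        (⟨le_rfl, hr⟩ : T ∈ Icc T r) ⟨hr, le_rfl⟩ hr)
    exact absurd (hupos T hT0) (not_lt.2 this)
  have := le_of_tendsto hlp ((eventually_ge_atTop t2).mono fun r hr =>
    hpd t2 ht2 r ⟨le_rfl, hr⟩ ⟨hr, le_rfl⟩ hr)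
  simp only at this
  linarith

/-- Near a solution in `{u > 0}` that tends to the origin, all solutions are global and converge to
an equilibrium with `p = -|q|`. -/
lemma eventually_exists_tendsto (hε : 0 < ε) (h : IsSolutionOn ε (Ici 0) γ)
    (hu0 : 0 < (γ 0).1) (hlim : Tendsto γ atTop (𝓝 0)) :
    ∀ᶠ y in 𝓝 (γ 0), y ∈ halfSpace → ∃ δ, IsSolutionOn ε (Ici 0) δ ∧ δ 0 = y ∧
      ∃ Q : ℝ, Tendsto δ atTop (𝓝 (0, -|Q|, Q)) := by
  obtain ⟨T, hT, hpT, hgT⟩ := h.exists_gap_pos_of_tendsto_zero hε hu0 hlim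
  have hU : IsOpen {x : Phase | x.2.1 < 0 ∧ 0 < gap ε 0 x} := by
    have h1 : IsOpen {x : Phase | x.2.1 < 0} := isOpen_lt (by fun_prop) (by fun_prop)
    have h2 : IsOpen {x : Phase | 0 < gap ε 0 x} := isOpen_lt (by fun_prop) (continuous_gap ε 0)
    exact h1.inter h2
  obtain ⟨η, hη, hball⟩ := Metric.isOpen_iff.1 hU _ ⟨hpT, hgT⟩
  filter_upwards [(h.mono (Icc_subset_Ici_self : Icc 0 T ⊆ Ici 0)).eventually_exists_near hT hη]
    with y hy hyh
  obtain ⟨δ, hδ, hδ0, hnear⟩ := hy hyh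
  have hTm : T ∈ Icc 0 T := ⟨hT, le_rfl⟩
  obtain ⟨h1, h2⟩ := hball (hnear T hTm)
  obtain ⟨ζ, hζ, hζ0, Q, hQ, -⟩ := exists_tendsto_of_gap hε (hδ T hTm).2 h1 h2
  obtain ⟨ξ, hξ, heq, htail⟩ := hδ.exists_extend hT hζ hζ0
  refine ⟨ξ, hξ, (heq ⟨le_rfl, hT⟩).trans hδ0, Q, ?_⟩
  refine (tendsto_congr' ?_).1 (hQ.comp (tendsto_atTop_add_const_right atTop (-T) tendsto_id))
  filter_upwards [eventually_ge_atTop T] with t ht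
  have := htail (t + -T) (by linarith)
  simpa using this.symm

end IsSolutionOn

/-- Points slightly above a point that tends to the origin, in the componentwise order, terminate at
`lineMinusS`. -/
lemma eventually_above_mem_terminatesAt {ε : ℝ} (hε : 0 < ε) {x : Phase} (hxu : 0 < x.1)
    (hx : x ∈ terminatesAt ε {0}) :
    ∀ᶠ y in 𝓝 x, x.1 ≤ y.1 → x.2.1 < y.2.1 → x.2.2 ≤ y.2.2 → y ∈ terminatesAt ε lineMinusS := by
  obtain ⟨γ, hγ, rfl, a, rfl, hlim⟩ := hx
  have hs : 0 < √ε := Real.sqrt_pos.2 hε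
  filter_upwards [hγ.eventually_exists_tendsto hε hxu hlim] with y hy h1 h2 h3
  obtain ⟨δ, hδ, rfl, Q, hQ⟩ := hy (hxu.le.trans h1)
  refine ⟨δ, hδ, rfl, _, mem_lineMinusS ?_, hQ⟩
  by_contra hQ0
  push Not at hQ0
  have hqγ : ∀ t ∈ Ici (0 : ℝ), (γ t).2.2 ≤ 0 := fun t ht => hγ.q_le_of_tendsto hlim ht
  have hqδ : ∀ t ∈ Ici (0 : ℝ), (δ t).2.2 ≤ 0 := fun t ht =>
    (hδ.q_le_of_tendsto hQ ht).trans hQ0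
  have hcomp := fun T : ℝ => (hγ.mono (Icc_subset_Ici_self : Icc 0 T ⊆ Ici 0)).comparison
    (hδ.mono Icc_subset_Ici_self) h1 h2.le h3
    fun t ht => add_nonpos (hqγ t ht.1) (hqδ t ht.1)
  have hmono : ∀ t r : ℝ, 0 ≤ t → t ≤ r →
      (δ t).2.2 - (γ t).2.2 ≤ (δ r).2.2 - (γ r).2.2 := fun t r ht htr =>
    (hcomp r).2 ⟨ht, htr⟩ ⟨ht.trans htr, le_rfl⟩ htr
  have hlq : Tendsto (fun t => (δ t).2.2 - (γ t).2.2) atTop (𝓝 (Q - 0)) :=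
    (((continuous_snd.comp continuous_snd).tendsto _).comp hQ).sub
      (((continuous_snd.comp continuous_snd).tendsto _).comp hlim)
  -- the two solutions have the same `q`, hence they coincide
  have heq : ∀ t ∈ Ici (0 : ℝ), (δ t).2.2 = (γ t).2.2 := by
    intro t ht
    have h4 := ge_of_tendsto hlq ((eventually_ge_atTop t).mono fun r hr => hmono t r ht hr)
    have h5 := hmono 0 t le_rfl ht
    linarith
  have hequ : ∀ t ∈ Ici (0 : ℝ), (δ t).1 = (γ t).1 := by
    intro t ht
    have h4 := (uniqueDiffOn_Ici (0 : ℝ) t ht).eq_deriv _ (hδ.deriv_q ht)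
      ((hγ.deriv_q ht).congr heq (heq t ht))
    exact (pow_left_inj₀ (hδ.nonneg ht) (hγ.nonneg ht) two_ne_zero).1 h4
  have h0 : (0 : ℝ) ∈ Ici (0 : ℝ) := self_mem_Ici
  have h6 := (uniqueDiffOn_Ici (0 : ℝ) 0 h0).eq_deriv _ (hδ.deriv_u h0)
    ((hγ.deriv_u h0).congr hequ (hequ 0 h0))
  rw [hequ 0 h0] at h6
  exact h2.ne' (mul_left_cancel₀ (mul_pos hs hxu).ne' h6)

/-- Points slightly below a point that tends to the origin, in the componentwise order, terminate at
`linePlusS`. -/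
lemma eventually_below_mem_terminatesAt {ε : ℝ} (hε : 0 < ε) {x : Phase} (hxu : 0 < x.1)
    (hx : x ∈ terminatesAt ε {0}) :
    ∀ᶠ y in 𝓝 x, y ∈ halfSpace → y.1 ≤ x.1 → y.2.1 ≤ x.2.1 → y.2.2 < x.2.2 →
      y ∈ terminatesAt ε linePlusS := by
  obtain ⟨γ, hγ, rfl, a, rfl, hlim⟩ := hx
  filter_upwards [hγ.eventually_exists_tendsto hε hxu hlim] with y hy hyh h1 h2 h3
  obtain ⟨δ, hδ, rfl, Q, hQ⟩ := hy hyh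
  refine ⟨δ, hδ, rfl, _, mem_linePlusS ?_, hQ⟩
  set c := (γ 0).2.2 - (δ 0).2.2 with hc
  have hc0 : 0 < c := sub_pos.2 h3
  have hqγ : ∀ t ∈ Ici (0 : ℝ), (γ t).2.2 ≤ 0 := fun t ht => hγ.q_le_of_tendsto hlim ht
  have hstep : ∀ t : ℝ, 0 ≤ t → (∀ r ∈ Icc 0 t, (δ r).2.2 ≤ 0) → (δ t).2.2 ≤ -c := by
    intro t ht hle
    have h4 := ((hδ.mono (Icc_subset_Ici_self : Icc 0 t ⊆ Ici 0)).comparison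
      (hγ.mono Icc_subset_Ici_self) h1 h2 h3.le
      fun r hr => add_nonpos (hle r hr) (hqγ r hr.1)).2 ⟨le_rfl, ht⟩ ⟨ht, le_rfl⟩ ht
    simp only at h4
    have h5 := hqγ t ht
    linarith
  have hneg : ∀ t : ℝ, 0 ≤ t → (δ t).2.2 < 0 := by
    intro T hT
    have hsol : IsSolutionOn ε (Icc 0 T) δ := hδ.mono Icc_subset_Ici_self
    refine forall_Icc_of_open_induction (P := fun t => (δ t).2.2 < 0)
      (fun t ht hlt => (hsol.cont_q t ht).eventually (Iio_mem_nhds hlt))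
      (h3.trans_le (hqγ 0 self_mem_Ici)) (fun t ht hlt => ?_) T ⟨hT, le_rfl⟩
    have := hstep t ht.1.le (le_on_Icc_of_le_on_Ico ht.1
      (hsol.mono (Icc_subset_Icc_right ht.2)).cont_q fun r hr => (hlt r hr).le)
    linarith
  have := le_of_tendsto (((continuous_snd.comp continuous_snd).tendsto _).comp hQ)
    ((eventually_ge_atTop 0).mono fun t ht => hstep t ht fun r hr => (hneg r hr.1).le)
  simp only [Function.comp] at this
  linarith

/-! ### The invariant cone beside the algebraic solution -/

/-- While `p ≥ 0`, the functions `defectK`, `defectL`, `defectM` satisfy a cooperative linear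
system, so that they stay nonpositive. -/
lemma IsSolutionOn.defects_nonpos {ε : ℝ} {γ : ℝ → Phase} {T : ℝ} (h : IsSolutionOn ε (Icc 0 T) γ)
    (hp : ∀ t ∈ Icc 0 T, 0 ≤ (γ t).2.1) (hk : defectK ε (γ 0) ≤ 0) (hl : defectL (γ 0) ≤ 0)
    (hm : defectM ε (γ 0) ≤ 0) :
    ∀ t ∈ Icc 0 T, defectK ε (γ t) ≤ 0 ∧ defectL (γ t) ≤ 0 ∧ defectM ε (γ t) ≤ 0 := by
  have hs : 0 ≤ √ε := Real.sqrt_nonneg ε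
  set A : Fin 3 → Fin 3 → ℝ → ℝ :=
    ![![fun _ => 0, fun t => 3 * √ε * (γ t).1 ^ 2, fun _ => 0],
      ![fun t => 2 / 3 * (γ t).1, fun _ => 0, fun t => (γ t).1],
      ![fun t => √ε * (γ t).2.1 * 2, fun _ => 0, fun t => √ε * (γ t).2.1]] with hA
  have key := nonneg_of_cooperative
    (f := ![fun t => -defectK ε (γ t), fun t => -defectL (γ t), fun t => -defectM ε (γ t)])
    (f' := ![fun t => -(3 * √ε * (γ t).1 ^ 2 * defectL (γ t)),
      fun t => -(2 / 3 * (γ t).1 * defectK ε (γ t) + (γ t).1 * defectM ε (γ t)),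
      fun t => -(√ε * (γ t).2.1 * (2 * defectK ε (γ t) + defectM ε (γ t)))])
    (A := A) (a := 0) (b := T) ?_ ?_ ?_ ?_ ?_
  · intro t ht
    have h0 := key t ht 0
    have h1 := key t ht 1
    have h2 := key t ht 2
    simp at h0 h1 h2
    exact ⟨h0, h1, h2⟩
  · intro i t ht
    fin_cases i
    · exact (h.deriv_defectK ht).neg
    · exact (h.deriv_defectL ht).neg
    · exact (h.deriv_defectM ht).neg
  · have h1 := h.cont_u
    have h2 := h.cont_p
    intro i j
    fin_cases i <;> fin_cases j <;> simp [hA] <;> fun_prop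
  · intro i j hij t ht
    have h1 := h.nonneg ht
    have h2 := hp t ht
    fin_cases i <;> fin_cases j <;> simp [hA] at hij ⊢ <;> positivity
  · intro i t ht _
    refine le_of_eq ?_
    fin_cases i <;> simp [hA, Fin.sum_univ_three] <;> ring
  · intro i
    fin_cases i <;> simpa

/-- Along solutions with `p ≥ 0` and nonpositive defects, `u` stays bounded by a constant that
depends only on the initial point. Indeed `defectK ≤ -c (u - u₀)` for a suitable `c > 0`, and this
makes `p² / u + (4 c / (3 √ε)) (log u + u₀ / u)` nonincreasing. -/
lemma exists_bound_of_defects {ε : ℝ} (hε : 0 < ε) {x : Phase} (hu : 0 < x.1)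
    (hk : defectK ε x ≤ 0) (hl : defectL x < 0) (hm : defectM ε x ≤ 0) :
    ∃ U, 0 ≤ U ∧ ∀ T γ, IsSolutionOn ε (Icc 0 T) γ → γ 0 = x → (∀ t ∈ Icc 0 T, 0 ≤ (γ t).2.1) →
      ∀ t ∈ Icc 0 T, x.1 ≤ (γ t).1 ∧ (γ t).1 ≤ U ∧ defectL (γ t) ≤ defectL x ∧
        defectM ε (γ t) ≤ 0 := by
  have hs : 0 < √ε := Real.sqrt_pos.2 hε
  -- chosen so that `c p ≤ 3 |defectL x| u`, given `p² ≤ u / (3 √ε)` and `u ≥ x.1`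
  set c := √(27 * √ε * defectL x ^ 2 * x.1) with hc
  have hc0 : 0 < c := Real.sqrt_pos.2
    (mul_pos (mul_pos (by positivity) (by nlinarith : 0 < defectL x ^ 2)) hu)
  have hc2 : c ^ 2 = 27 * √ε * defectL x ^ 2 * x.1 := Real.sq_sqrt (by positivity)
  set Ψ : Phase → ℝ := fun z => z.2.1 ^ 2 / z.1 + 4 * c / (3 * √ε) * (Real.log z.1 + x.1 / z.1)
    with hΨ
  refine ⟨Real.exp (Ψ x / (4 * c / (3 * √ε))), (Real.exp_pos _).le, ?_⟩
  rintro T γ h rfl hp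
  have hdef := h.defects_nonpos hp hk hl.le hm
  have hT : ∀ t ∈ Icc 0 T, (0 : ℝ) ∈ Icc 0 T := fun t ht => ⟨le_rfl, ht.1.trans ht.2⟩
  have hul : ∀ t ∈ Icc 0 T, (γ 0).1 ≤ (γ t).1 := fun t ht =>
    monotoneOn_Icc_of_deriv (fun r hr => h.deriv_u hr) (fun r hr =>
      mul_nonneg (mul_nonneg hs.le (h.nonneg hr)) (hp r hr)) (hT t ht) ht ht.1
  have hll : ∀ t ∈ Icc 0 T, defectL (γ t) ≤ defectL (γ 0) := fun t ht =>
    antitoneOn_Icc_of_deriv (fun r hr => h.deriv_defectL hr) (fun r hr => by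
      have h1 := mul_nonpos_of_nonneg_of_nonpos (h.nonneg hr) (hdef r hr).1
      have h2 := mul_nonpos_of_nonneg_of_nonpos (h.nonneg hr) (hdef r hr).2.2
      linarith) (hT t ht) ht ht.1
  have hkl : ∀ t ∈ Icc 0 T, defectK ε (γ t) + c * ((γ t).1 - (γ 0).1) ≤ 0 := by
    intro t ht
    have h1 := antitoneOn_Icc_of_deriv
      (fun r hr => (h.deriv_defectK hr).fun_add ((h.deriv_u hr).const_mul c)) (fun r hr => by
        have hur := hul r hr
        have hu0 := h.nonneg hr
        have hpr := hp r hr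
        have hmr := (hdef r hr).2.2
        have h2 : (γ r).2.1 ^ 2 ≤ (γ r).1 / (3 * √ε) := by
          rw [le_div_iff₀ (by positivity)]
          simp only [defectM] at hmr
          linarith
        have h3 : (c * (γ r).2.1) ^ 2 ≤ (3 * -defectL (γ 0) * (γ r).1) ^ 2 := by
          calc (c * (γ r).2.1) ^ 2 = c ^ 2 * (γ r).2.1 ^ 2 := by ring
            _ ≤ c ^ 2 * ((γ r).1 / (3 * √ε)) := mul_le_mul_of_nonneg_left h2 (sq_nonneg _)
            _ = 9 * defectL (γ 0) ^ 2 * (γ r).1 * (γ 0).1 := by rw [hc2]; field_simp; ring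
            _ ≤ 9 * defectL (γ 0) ^ 2 * (γ r).1 * (γ r).1 :=
                mul_le_mul_of_nonneg_left hur (by positivity)
            _ = _ := by ring
        have h4 : c * (γ r).2.1 ≤ 3 * -defectL (γ 0) * (γ r).1 :=
          (pow_le_pow_iff_left₀ (by positivity)
            (mul_nonneg (by linarith) hu0) two_ne_zero).1 h3
        have h5 := mul_le_mul_of_nonneg_left h4 (mul_nonneg hs.le hu0)
        have h6 := mul_le_mul_of_nonneg_left (hll r hr)
          (show 0 ≤ 3 * √ε * (γ r).1 ^ 2 by positivity)
        linarith) (hT t ht) ht ht.1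
    simp only at h1
    linarith
  have hΨm : AntitoneOn (fun t => Ψ (γ t)) (Icc 0 T) := by
    refine antitoneOn_Icc_of_deriv
      (f' := fun t => 4 * (γ t).2.1 / (3 * (γ t).1) *
        (defectK ε (γ t) + c * ((γ t).1 - (γ 0).1))) (fun r hr => ?_) (fun r hr => ?_)
    · have hur : (γ r).1 ≠ 0 := (hu.trans_le (hul r hr)).ne'
      refine ((((h.deriv_p_eq hr).fun_pow 2).fun_div (h.deriv_u hr) hur).fun_add
        ((((h.deriv_u hr).log hur).fun_add
          (((hasDerivAt_const r (γ 0).1).hasDerivWithinAt).fun_div (h.deriv_u hr) hur)).const_mul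
            (4 * c / (3 * √ε)))).congr_deriv ?_
      push_cast
      field_simp
      ring
    · have h1 := hp r hr
      have h2 := h.nonneg hr
      exact mul_nonpos_of_nonneg_of_nonpos (by positivity) (hkl r hr)
  intro t ht
  refine ⟨hul t ht, ?_, hll t ht, (hdef t ht).2.2⟩
  have hut : 0 < (γ t).1 := hu.trans_le (hul t ht)
  have h1 : Ψ (γ t) ≤ Ψ (γ 0) := hΨm (hT t ht) ht ht.1
  have h2 : 4 * c / (3 * √ε) * Real.log (γ t).1 ≤ Ψ (γ t) := by
    have h3 : 0 ≤ (γ t).2.1 ^ 2 / (γ t).1 := by positivity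
    have h4 : 0 ≤ 4 * c / (3 * √ε) * ((γ 0).1 / (γ t).1) := by positivity
    simp only [hΨ]
    linarith
  rw [← Real.log_le_iff_le_exp hut, le_div_iff₀ (by positivity)]
  linarith

/-- Points on the lower side of the branch `p > 0` of the algebraic solution terminate at
`lineMinusS`. -/
lemma mem_terminatesAt_of_defects {ε : ℝ} (hε : 0 < ε) {x : Phase} (hu : 0 < x.1) (hp : 0 < x.2.1)
    (hq : 0 < x.2.2) (hk : defectK ε x ≤ 0) (hl : defectL x < 0) (hm : defectM ε x ≤ 0) :
    x ∈ terminatesAt ε lineMinusS := by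
  have hs : 0 < √ε := Real.sqrt_pos.2 hε
  have hxh : x ∈ halfSpace := hu.le
  by_contra hcon
  -- where `p < 0` outside `trapMinus`, `defectK ≥ 0` and hence `p' ≥ 0`
  have hpnn : ∀ T γ, IsSolutionOn ε (Icc 0 T) γ → γ 0 = x → ∀ t ∈ Icc 0 T, 0 ≤ (γ t).2.1 := by
    rintro T γ h rfl
    refine nonneg_of_deriv_ge_mul (A := fun _ => 0) (fun r hr => h.deriv_p_eq hr)
      continuousOn_const (fun r hr hneg => ?_) hp.le
    have hqr : 0 < (γ r).2.2 := hq.trans_le (h.monotoneOn_q ⟨le_rfl, hr.1.trans hr.2⟩ hr hr.1)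
    have hkr : 0 ≤ defectK ε (γ r) := by
      by_contra hkneg
      push Not at hkneg
      exact hcon (mem_terminatesAt_of_Icc hr.1 (h.mono (Icc_subset_Icc_right hr.2))
        (trapMinus_subset hε (h r hr).2 ⟨hqr, hneg, hkneg⟩))
    rw [zero_mul]
    positivity
  obtain ⟨U, hU0, hU⟩ := exists_bound_of_defects hε hu hk hl hm
  have hpU : ∀ z : Phase, z.1 ≤ U → defectM ε z ≤ 0 → z.2.1 ^ 2 ≤ U / (3 * √ε) := by
    intro z hz hmz
    rw [le_div_iff₀ (by positivity)]
    simp only [defectM] at hmz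
    linarith
  obtain ⟨γ, h, hγ0⟩ := exists_solution_Ici_of_bound hxh fun T hT =>
    ⟨U + (U / (3 * √ε) + 1) + (x.2.2 + U ^ 2 * T), fun τ hτ γ h hγ0 => by
      have hall := hU τ γ h hγ0 (hpnn τ γ h hγ0)
      have hτm : τ ∈ Icc 0 τ := ⟨hτ.1, le_rfl⟩
      obtain ⟨h1, h2, -, h4⟩ := hall τ hτm
      have h5 := hpnn τ γ h hγ0 τ hτm
      have h6 := hpU _ h2 h4
      have h7 := h.nonneg hτm
      have h8 : x.2.2 ≤ (γ τ).2.2 := by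
        rw [← hγ0]; exact h.monotoneOn_q ⟨le_rfl, hτ.1⟩ hτm hτ.1
      have h9 := antitoneOn_Icc_of_deriv (f := fun t => (γ t).2.2 - U ^ 2 * t)
        (fun r hr => (h.deriv_q hr).sub (((hasDerivAt_id r).const_mul (U ^ 2)).hasDerivWithinAt))
        (fun r hr => by
          have := pow_le_pow_left₀ (h.nonneg hr) (hall r hr).2.1 2
          linarith) ⟨le_rfl, hτ.1⟩ hτm hτ.1
      simp only [hγ0, mul_zero, sub_zero] at h9
      have h10 := mul_le_mul_of_nonneg_left hτ.2 (sq_nonneg U)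
      have h11 : 0 ≤ U / (3 * √ε) := by positivity
      have h12 : 0 ≤ U ^ 2 * T := by positivity
      have h13 : (γ τ).2.1 ≤ U / (3 * √ε) + 1 := by nlinarith
      refine phase_norm_le ?_ ?_ ?_
      · rw [abs_of_nonneg h7]; linarith
      · rw [abs_of_nonneg h5]; linarith
      · rw [abs_of_pos (by linarith)]; linarith⟩
  have hpt : ∀ t ∈ Ici (0 : ℝ), 0 ≤ (γ t).2.1 := fun t ht =>
    hpnn t γ (h.mono Icc_subset_Ici_self) hγ0 t ⟨ht, le_rfl⟩
  have hall : ∀ t ∈ Ici (0 : ℝ), x.1 ≤ (γ t).1 ∧ (γ t).1 ≤ U ∧ defectL (γ t) ≤ defectL x ∧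
      defectM ε (γ t) ≤ 0 := fun t ht =>
    hU t γ (h.mono Icc_subset_Ici_self) hγ0 (fun r hr => hpt r hr.1) t ⟨ht, le_rfl⟩
  -- `defectK` decreases at a definite rate, and once it is negative enough, so does `p`
  have hkev := eventually_le_of_deriv_le (f := fun t => defectK ε (γ t))
    (β := -(3 / 2 * (U / 6 + 1))) (c := 3 * √ε * x.1 ^ 2 * -defectL x)
    (by have := neg_pos.2 hl; positivity) (fun t ht => h.deriv_defectK ht) (fun t ht _ => by
      obtain ⟨h1, -, h3, -⟩ := hall t ht
      have h4 : x.1 ^ 2 ≤ (γ t).1 ^ 2 := pow_le_pow_left₀ hu.le h1 2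
      have h5 : x.1 ^ 2 * -defectL x ≤ (γ t).1 ^ 2 * -defectL (γ t) :=
        mul_le_mul h4 (by linarith) (by linarith) (sq_nonneg _)
      have h6 := mul_le_mul_of_nonneg_left h5 (show 0 ≤ 3 * √ε by positivity)
      linarith)
  obtain ⟨T, hT⟩ := eventually_atTop.1 (hkev.and (eventually_ge_atTop 0))
  have hpev := eventually_le_of_deriv_le (f := fun t => (γ t).2.1) (β := -1) (c := 1) one_pos
    (fun t ht => (h.mono (Ici_subset_Ici.2 (hT T le_rfl).2)).deriv_p_eq ht) (fun t ht _ => by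
      obtain ⟨h1, h2⟩ := hT t ht
      have h3 := hpU _ (hall t h2).2.1 (hall t h2).2.2.2
      have h4 := mul_le_mul_of_nonneg_left h3 (show 0 ≤ 1 / 2 * √ε by positivity)
      have h5 : 1 / 2 * √ε * (U / (3 * √ε)) = U / 6 := by field_simp; ring
      linarith)
  obtain ⟨t, ht1, ht2⟩ := (hpev.and (eventually_ge_atTop 0)).exists
  linarith [hpt t ht2]

/-! ### Disjointness of the basins -/

lemma terminatesAt_nonempty_inter {ε : ℝ} {A B : Set Phase} {x : Phase}
    (hA : x ∈ terminatesAt ε A) (hB : x ∈ terminatesAt ε B) : (A ∩ B).Nonempty := by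
  obtain ⟨γ, hγ, hγ0, a, ha, hla⟩ := hA
  obtain ⟨δ, hδ, hδ0, b, hb, hlb⟩ := hB
  have heq := hγ.eqOn_Ici hδ (hγ0.trans hδ0.symm)
  have : a = b := tendsto_nhds_unique_of_eventuallyEq hla hlb
    ((eventually_ge_atTop 0).mono fun t ht => heq ht)
  exact ⟨a, ha, this ▸ hb⟩

lemma notMem_lineMinusS_of_linePlusS {ε : ℝ} {x : Phase} (h : x ∈ terminatesAt ε linePlusS) :
    x ∉ terminatesAt ε lineMinusS := fun h' => by
  obtain ⟨a, ha, hb⟩ := terminatesAt_nonempty_inter h h'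
  exact lt_asymm ha.2 hb.2

lemma notMem_of_terminatesAt_zero {ε : ℝ} {x : Phase} (h : x ∈ terminatesAt ε {0}) :
    x ∉ terminatesAt ε lineMinusS ∧ x ∉ terminatesAt ε linePlusS := by
  constructor <;> intro h' <;> obtain ⟨a, rfl, hb⟩ := terminatesAt_nonempty_inter h h' <;>
    exact lt_irrefl _ hb.2

/-! ### Time reversal of the sets in the statement -/

/-- `reversal` as a homeomorphism of the phase space. -/
def reversalHomeo : Phase ≃ₜ Phase where
  toFun := reversal
  invFun := reversal
  left_inv := reversal_reversal
  right_inv := reversal_reversal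
  continuous_toFun := continuous_reversal
  continuous_invFun := continuous_reversal

lemma isometry_reversal : Isometry reversal := by
  refine Isometry.of_dist_eq fun x y => ?_
  simp [reversal, Prod.dist_eq]

lemma reversal_image_preimage (A : Set Phase) : reversal '' (reversal ⁻¹' A) = A :=
  reversalHomeo.surjective.image_preimage A

lemma reversal_mem_lineMinusS {x : Phase} : reversal x ∈ lineMinusS ↔ x ∈ lineMinusU := by
  simp only [lineMinusS, lineMinusU, lineMinus, reversal, mem_ofPred_eq]
  constructor <;> rintro ⟨⟨h1, h2⟩, h3⟩ <;> exact ⟨⟨h1, by linarith⟩, by linarith⟩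

lemma reversal_mem_lineMinusU {x : Phase} : reversal x ∈ lineMinusU ↔ x ∈ lineMinusS := by
  rw [← reversal_mem_lineMinusS, reversal_reversal]

lemma reversal_mem_linePlusS {x : Phase} : reversal x ∈ linePlusS ↔ x ∈ linePlusU := by
  simp only [linePlusS, linePlusU, linePlus, reversal, mem_ofPred_eq]
  constructor <;> rintro ⟨⟨h1, h2⟩, h3⟩ <;> exact ⟨⟨h1, by linarith⟩, by linarith⟩

lemma reversal_mem_linePlusU {x : Phase} : reversal x ∈ linePlusU ↔ x ∈ linePlusS := by
  rw [← reversal_mem_linePlusS, reversal_reversal]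

lemma Connects.reverse {ε : ℝ} {A B : Set Phase} {γ : ℝ → Phase} (h : Connects ε A B γ) :
    Connects ε (reversal ⁻¹' B) (reversal ⁻¹' A) (fun t => reversal (γ (-t))) := by
  obtain ⟨hγ, a, ha, b, hb, hla, hlb⟩ := h
  refine ⟨hγ.reverse fun t _ => mem_univ _, reversal b, by simpa, reversal a, by simpa, ?_, ?_⟩
  · exact (continuous_reversal.tendsto b).comp (hlb.comp tendsto_neg_atBot_atTop)
  · exact (continuous_reversal.tendsto a).comp (hla.comp tendsto_neg_atTop_atBot)

lemma mem_emanatesFrom_iff {ε : ℝ} {A : Set Phase} {x : Phase} :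
    x ∈ emanatesFrom ε A ↔ reversal x ∈ terminatesAt ε (reversal ⁻¹' A) := by
  constructor
  · rintro ⟨γ, hγ, rfl, a, ha, hl⟩
    refine ⟨_, hγ.reverse (J' := Ici 0) fun t ht => mem_Iic.2 (neg_nonpos.2 ht), by simp,
      reversal a, by simpa, (continuous_reversal.tendsto a).comp (hl.comp tendsto_neg_atTop_atBot)⟩
  · rintro ⟨γ, hγ, h0, a, ha, hl⟩
    refine ⟨_, hγ.reverse (J' := Iic 0) fun t ht => mem_Ici.2 (neg_nonneg.2 ht), by simp [h0],
      reversal a, ha, (continuous_reversal.tendsto a).comp (hl.comp tendsto_neg_atBot_atTop)⟩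

lemma mem_emanatesFrom_lineMinusU_iff {ε : ℝ} {x : Phase} :
    x ∈ emanatesFrom ε lineMinusU ↔ reversal x ∈ terminatesAt ε lineMinusS := by
  rw [mem_emanatesFrom_iff]
  have : reversal ⁻¹' lineMinusU = lineMinusS := Set.ext fun _ => reversal_mem_lineMinusU
  rw [this]

lemma terminatesAt_eq_reversal_preimage (ε : ℝ) :
    terminatesAt ε lineMinusS = reversal ⁻¹' emanatesFrom ε lineMinusU := by
  ext x
  rw [mem_preimage, mem_emanatesFrom_lineMinusU_iff, reversal_reversal]

lemma equilibria_eq_reversal_preimage (ε : ℝ) :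
    equilibria ε = reversal ⁻¹' equilibria ε := by
  ext x
  simp [equilibria, halfSpace, reversal, field]

lemma region1_eq_reversal_preimage (ε : ℝ) : region1 ε = reversal ⁻¹' region1 ε := by
  have key : ∀ x, x ∈ region1 ε → reversal x ∈ region1 ε := by
    rintro _ ⟨γ, hγ, t, rfl⟩
    refine ⟨fun t => reversal (γ (-t)), ?_, -t, by simp⟩
    have := Connects.reverse hγ
    have e1 : reversal ⁻¹' lineMinusU = lineMinusS := Set.ext fun _ => reversal_mem_lineMinusU
    have e2 : reversal ⁻¹' lineMinusS = lineMinusU := Set.ext fun _ => reversal_mem_lineMinusS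
    rwa [e1, e2] at this
  exact Subset.antisymm key fun x hx => by
    have := key _ hx
    rwa [reversal_reversal] at this

lemma isClass3_reverse {ε : ℝ} {γ : ℝ → Phase} (h : IsClass2 ε γ) :
    IsClass3 ε (fun t => reversal (γ (-t))) := by
  have := Connects.reverse h
  have e1 : reversal ⁻¹' lineMinusU = lineMinusS := Set.ext fun _ => reversal_mem_lineMinusU
  have e2 : reversal ⁻¹' linePlusS = linePlusU := Set.ext fun _ => reversal_mem_linePlusS
  rwa [e1, e2] at this

lemma isClass2_reverse {ε : ℝ} {γ : ℝ → Phase} (h : IsClass3 ε γ) :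
    IsClass2 ε (fun t => reversal (γ (-t))) := by
  have := Connects.reverse h
  have e1 : reversal ⁻¹' lineMinusS = lineMinusU := Set.ext fun _ => reversal_mem_lineMinusS
  have e2 : reversal ⁻¹' linePlusU = linePlusS := Set.ext fun _ => reversal_mem_linePlusU
  rwa [e1, e2] at this

lemma region3_eq_reversal_preimage (ε : ℝ) : region3 ε = reversal ⁻¹' region2 ε := by
  ext x
  constructor
  · rintro ⟨γ, hγ, t, rfl⟩
    exact ⟨_, isClass2_reverse hγ, -t, by simp⟩
  · rintro ⟨γ, hγ, t, ht⟩
    exact ⟨_, isClass3_reverse hγ, -t, by simp [ht]⟩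

lemma reversal_algebraicSolution (ε y : ℝ) :
    reversal (algebraicSolution ε y) = algebraicSolution ε (-y) := by
  simp only [reversal, algebraicSolution]
  congr 1
  · ring
  · congr 1 <;> ring

lemma gammaPlus_eq_reversal_preimage (ε : ℝ) : gammaPlus ε = reversal ⁻¹' gammaMinus ε := by
  ext x
  constructor
  · rintro ⟨y, hy, rfl⟩
    exact ⟨-y, mem_Iic.2 (neg_nonpos.2 hy), (reversal_algebraicSolution ε y).symm⟩
  · rintro ⟨y, hy, h⟩
    refine ⟨-y, mem_Ici.2 (neg_nonneg.2 hy), ?_⟩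
    rw [← reversal_algebraicSolution, h, reversal_reversal]

lemma unstableManifold_eq_reversal_preimage (ε : ℝ) :
    unstableManifold ε (gammaPlus ε) = reversal ⁻¹' stableManifold ε (gammaMinus ε) := by
  have hd : ∀ z, Metric.infDist (reversal z) (gammaMinus ε) = Metric.infDist z (gammaPlus ε) := by
    intro z
    have h : reversal '' gammaPlus ε = gammaMinus ε := by
      rw [gammaPlus_eq_reversal_preimage, reversal_image_preimage]
    rw [← h, Metric.infDist_image isometry_reversal]
  ext x
  constructor
  · rintro ⟨γ, hγ, rfl, hl⟩
    refine ⟨_, hγ.reverse (J' := Ici 0) fun t ht => mem_Iic.2 (neg_nonpos.2 ht), by simp, ?_⟩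
    simp only [hd]
    exact hl.comp tendsto_neg_atTop_atBot
  · rintro ⟨γ, hγ, h0, hl⟩
    refine ⟨_, hγ.reverse (J' := Iic 0) fun t ht => mem_Ici.2 (neg_nonneg.2 ht), by simp [h0], ?_⟩
    simp only [← hd, reversal_reversal]
    exact hl.comp tendsto_neg_atBot_atTop

lemma frontier_reversal_preimage (A : Set Phase) :
    frontier (reversal ⁻¹' A) = reversal ⁻¹' frontier A :=
  (reversalHomeo.preimage_frontier A).symm

lemma IsBoundaryBetween.reversal_preimage {W C C' D E : Set Phase}
    (h : IsBoundaryBetween W C C' D E) :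
    IsBoundaryBetween (reversal ⁻¹' W) (reversal ⁻¹' C) (reversal ⁻¹' C') (reversal ⁻¹' D)
      (reversal ⁻¹' E) := by
  obtain ⟨h1, h2, h3, h4⟩ := h
  refine ⟨h1.preimage _, ?_, ?_, ?_⟩
  · rw [frontier_reversal_preimage, frontier_reversal_preimage]
    exact fun x hx => h2 hx
  · rw [frontier_reversal_preimage, frontier_reversal_preimage]
    exact fun x hx => h3 hx
  · rintro T hT hTD ⟨x, hxT, hx⟩ ⟨y, hyT, hy⟩
    obtain ⟨_, ⟨z, hzT, rfl⟩, hz⟩ := h4 (reversal '' T)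
      (hT.image _ continuous_reversal.continuousOn)
      (by rintro _ ⟨z, hz, rfl⟩; exact hTD hz)
      ⟨_, mem_image_of_mem _ hxT, hx⟩ ⟨_, mem_image_of_mem _ hyT, hy⟩
    exact ⟨z, hzT, hz⟩

/-! ### The regions filled by heteroclinics -/

lemma exists_connects {ε : ℝ} {A B : Set Phase} {x : Phase} (hA : x ∈ emanatesFrom ε A)
    (hB : x ∈ terminatesAt ε B) : ∃ γ, Connects ε A B γ ∧ γ 0 = x := by
  obtain ⟨γ, hγ, hγ0, a, ha, hla⟩ := hA
  obtain ⟨δ, hδ, hδ0, b, hb, hlb⟩ := hB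
  have h := hγ.concat hδ (T := 0) subset_rfl subset_rfl self_mem_Iic self_mem_Ici
    (hγ0.trans hδ0.symm)
  rw [Iic_union_Ici] at h
  refine ⟨_, ⟨h, a, ha, b, hb, hla.congr' ?_, hlb.congr' ?_⟩, by simp [hγ0]⟩
  · filter_upwards [eventually_le_atBot 0] with t ht
    simp [ht]
  · filter_upwards [eventually_gt_atTop 0] with t ht
    simp [ht]

lemma setOf_connects_eq (ε : ℝ) (A B : Set Phase) :
    {x | ∃ γ, Connects ε A B γ ∧ x ∈ range γ} = emanatesFrom ε A ∩ terminatesAt ε B := by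
  ext x
  constructor
  · rintro ⟨γ, ⟨hγ, a, ha, b, hb, hla, hlb⟩, t, rfl⟩
    exact ⟨⟨_, hγ.comp_add t fun _ _ => mem_univ _, by simp, a, ha,
      hla.comp (tendsto_atBot_add_const_right _ t tendsto_id)⟩,
      ⟨_, hγ.comp_add t fun _ _ => mem_univ _, by simp, b, hb,
      hlb.comp (tendsto_atTop_add_const_right _ t tendsto_id)⟩⟩
  · rintro ⟨hA, hB⟩
    obtain ⟨γ, hγ, h0⟩ := exists_connects hA hB
    exact ⟨γ, hγ, 0, h0⟩

lemma region1_eq (ε : ℝ) :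
    region1 ε = emanatesFrom ε lineMinusU ∩ terminatesAt ε lineMinusS := setOf_connects_eq _ _ _

lemma region2_eq (ε : ℝ) :
    region2 ε = emanatesFrom ε lineMinusU ∩ terminatesAt ε linePlusS := setOf_connects_eq _ _ _

lemma IsSolutionOn.u_pos_univ {ε : ℝ} {γ : ℝ → Phase} (h : IsSolutionOn ε univ γ) {t0 : ℝ}
    (h0 : 0 < (γ t0).1) (t : ℝ) : 0 < (γ t).1 := by
  rcases le_total t0 t with ht | ht
  · exact (h.mono (subset_univ (Icc t0 t))).u_pos h0 t ⟨ht, le_rfl⟩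
  · refine (h.nonneg (mem_univ t)).lt_of_ne fun h1 => h0.ne' ?_
    exact (h.mono (subset_univ (Icc t t0))).u_eq_zero h1.symm t0 ⟨ht, le_rfl⟩

lemma eventually_mem_emanatesFrom {ε : ℝ} (hε : 0 < ε) {x : Phase}
    (hx : x ∈ emanatesFrom ε lineMinusU) :
    ∀ᶠ y in 𝓝 x, y ∈ halfSpace → y ∈ emanatesFrom ε lineMinusU := by
  rw [mem_emanatesFrom_lineMinusU_iff] at hx
  filter_upwards [continuous_reversal.continuousAt.eventually
    (eventually_mem_terminatesAt_lineMinusS hε hx)] with y hy hyh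
  rw [mem_emanatesFrom_lineMinusU_iff]
  exact hy hyh

lemma q_neg_of_emanatesFrom {ε : ℝ} {x : Phase} (hx : x ∈ emanatesFrom ε lineMinusU)
    (hu : x.1 = 0) : x.2.2 < 0 := by
  rw [mem_emanatesFrom_lineMinusU_iff] at hx
  obtain ⟨γ, hγ, hγ0, a, ha, hl⟩ := hx
  have h0 : (γ 0).1 = 0 := by rw [hγ0]; exact hu
  have h1 : Tendsto (fun t => (γ t).2.2) atTop (𝓝 a.2.2) :=
    ((continuous_snd.comp continuous_snd).tendsto _).comp hl
  have h2 : a.2.2 = (γ 0).2.2 := tendsto_nhds_unique h1 (tendsto_const_nhds.congr'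
    ((eventually_ge_atTop 0).mono fun t ht => (hγ.q_eq_of_u_eq_zero h0 ht).symm))
  have h3 : a.2.2 = -x.2.2 := by rw [h2, hγ0]; rfl
  linarith [ha.2]

/-! ### The stable manifold of the algebraic solution -/

lemma defectK_algebraicSolution (ε y : ℝ) : defectK ε (algebraicSolution ε y) = 0 := by
  simp only [defectK, algebraicSolution]
  ring

lemma zero_mem_gammaMinus (ε : ℝ) : (0 : Phase) ∈ gammaMinus ε :=
  ⟨0, self_mem_Iic, by simp [algebraicSolution]⟩

lemma mem_stableManifold_of_terminatesAt_zero {ε : ℝ} {x : Phase} (hx : x ∈ terminatesAt ε {0}) :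
    x ∈ stableManifold ε (gammaMinus ε) := by
  obtain ⟨γ, hγ, hγ0, a, rfl, hl⟩ := hx
  refine ⟨γ, hγ, hγ0, squeeze_zero (fun t => Metric.infDist_nonneg)
    (fun t => Metric.infDist_le_dist_of_mem (zero_mem_gammaMinus ε)) ?_⟩
  exact tendsto_iff_dist_tendsto_zero.1 hl

/-- A curve whose distance to `gammaMinus` tends to `0` is shadowed by points of `gammaMinus`. -/
lemma exists_shadow {ε : ℝ} {γ : ℝ → Phase}
    (h : Tendsto (fun t => Metric.infDist (γ t) (gammaMinus ε)) atTop (𝓝 0)) :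
    ∃ z : ℝ → Phase, (∀ t, z t ∈ gammaMinus ε) ∧
      Tendsto (fun t => dist (z t) (γ t)) atTop (𝓝 0) := by
  have hne : (gammaMinus ε).Nonempty := ⟨0, zero_mem_gammaMinus ε⟩
  have hex : ∀ t, ∃ z ∈ gammaMinus ε,
      dist (γ t) z < Metric.infDist (γ t) (gammaMinus ε) + Real.exp (-t) := fun t =>
    (Metric.infDist_lt_iff hne).1 (by linarith [Real.exp_pos (-t)])
  choose z hz hzd using hex
  refine ⟨z, hz, squeeze_zero (g := fun t => Metric.infDist (γ t) (gammaMinus ε) + Real.exp (-t))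
    (fun _ => dist_nonneg) (fun t => by rw [dist_comm]; exact (hzd t).le) ?_⟩
  simpa using h.add Real.tendsto_exp_neg_atTop_nhds_zero

lemma q_nonpos_of_infDist {ε : ℝ} {γ : ℝ → Phase} (hγ : IsSolutionOn ε (Ici 0) γ)
    (h : Tendsto (fun t => Metric.infDist (γ t) (gammaMinus ε)) atTop (𝓝 0)) :
    ∀ t ∈ Ici (0 : ℝ), (γ t).2.2 ≤ 0 := by
  obtain ⟨z, hz, hzd⟩ := exists_shadow h
  intro t ht
  refine ge_of_tendsto hzd ((eventually_ge_atTop t).mono fun r hr => ?_)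
  have hzq : (z r).2.2 ≤ 0 := by
    obtain ⟨y, hy, hyz⟩ := hz r
    rw [← hyz]
    have hy0 : y ≤ 0 := hy
    have := mul_nonpos_of_nonneg_of_nonpos (show 0 ≤ 1 / 36 * √ε by positivity)
      (show y ^ 3 ≤ 0 from Odd.pow_nonpos (by decide) hy0)
    simpa [algebraicSolution] using this
  have h1 := hγ.q_le_q ht hr
  have h2 : |(z r).2.2 - (γ r).2.2| ≤ dist (z r) (γ r) := by
    rw [dist_eq_norm]
    exact (norm_snd_le (z r - γ r).2).trans (norm_snd_le (z r - γ r))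
  linarith [neg_abs_le ((z r).2.2 - (γ r).2.2)]

/-- If the distance to `gammaMinus` tends to `0` along a curve and `u → 0` there, then also
`q → 0`. -/
lemma q_eq_zero_of_infDist {ε : ℝ} (hε : 0 < ε) {γ : ℝ → Phase} {Q : ℝ}
    (h : Tendsto (fun t => Metric.infDist (γ t) (gammaMinus ε)) atTop (𝓝 0))
    (hu : Tendsto (fun t => (γ t).1) atTop (𝓝 0)) (hq : Tendsto (fun t => (γ t).2.2) atTop (𝓝 Q)) :
    Q = 0 := by
  have hs : 0 < √ε := Real.sqrt_pos.2 hε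
  obtain ⟨z, hz, hzd⟩ := exists_shadow h
  have h1 : Tendsto (fun t => (z t).1 - (γ t).1) atTop (𝓝 0) :=
    squeeze_zero_norm (fun t => by
      rw [dist_eq_norm]; exact norm_fst_le (z t - γ t)) hzd
  have h2 : Tendsto (fun t => (z t).2.2 - (γ t).2.2) atTop (𝓝 0) :=
    squeeze_zero_norm (fun t => by
      rw [dist_eq_norm]
      exact (norm_snd_le (z t - γ t).2).trans (norm_snd_le (z t - γ t))) hzd
  have h3 : Tendsto (fun t => (z t).1) atTop (𝓝 0) := by simpa using h1.add hu
  have h4 : Tendsto (fun t => (z t).2.2) atTop (𝓝 Q) := by simpa using h2.add hq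
  have h5 : Tendsto (fun t => defectK ε (z t)) atTop (𝓝 (0 ^ 3 - 3 / 4 * √ε * Q ^ 2)) :=
    (h3.pow 3).sub ((h4.pow 2).const_mul _)
  have h6 : (fun t => defectK ε (z t)) = fun _ => 0 := by
    funext t
    obtain ⟨y, -, hy⟩ := hz t
    rw [← hy, defectK_algebraicSolution]
  rw [h6] at h5
  have h7 := tendsto_nhds_unique h5 tendsto_const_nhds
  have h8 : √ε * Q ^ 2 = 0 := by linarith
  simpa [hs.ne'] using h8

lemma terminatesAt_zero_of_mem_stableManifold {ε : ℝ} (hε : 0 < ε) {x : Phase} (hu : 0 < x.1)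
    (hx : x ∈ stableManifold ε (gammaMinus ε)) : x ∈ terminatesAt ε {0} := by
  obtain ⟨γ, hγ, rfl, hl⟩ := hx
  have hq := q_nonpos_of_infDist hγ hl
  obtain ⟨Q, hQ, -⟩ := hγ.exists_tendsto hε (hγ.eventually_p_nonpos hu hq) hq
  have hQ0 : Q = 0 := q_eq_zero_of_infDist hε hl ((continuous_fst.tendsto _).comp hQ)
    (((continuous_snd.comp continuous_snd).tendsto _).comp hQ)
  refine ⟨γ, hγ, rfl, 0, rfl, ?_⟩
  rw [hQ0, abs_zero, neg_zero] at hQ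
  exact hQ

/-- Points of the stable manifold that emanate from `lineMinusU` lie in `{u > 0}`. -/
lemma u_pos_of_mem_stableManifold {ε : ℝ} (hε : 0 < ε) {x : Phase}
    (hx : x ∈ stableManifold ε (gammaMinus ε)) (hD : x ∈ emanatesFrom ε lineMinusU) :
    0 < x.1 := by
  obtain ⟨γ, hγ, rfl, hl⟩ := hx
  refine (hγ.nonneg self_mem_Ici).lt_of_ne fun h0 => ?_
  have h1 := q_neg_of_emanatesFrom hD h0.symm
  have hu : Tendsto (fun t => (γ t).1) atTop (𝓝 0) := tendsto_const_nhds.congr'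
    ((eventually_ge_atTop 0).mono fun t ht =>
      ((hγ.mono Icc_subset_Ici_self).u_eq_zero h0.symm t (⟨ht, le_rfl⟩ : t ∈ Icc 0 t)).symm)
  have hq : Tendsto (fun t => (γ t).2.2) atTop (𝓝 (γ 0).2.2) := tendsto_const_nhds.congr'
    ((eventually_ge_atTop 0).mono fun t ht => (hγ.q_eq_of_u_eq_zero h0.symm ht).symm)
  exact h1.ne (q_eq_zero_of_infDist hε hl hu hq)

lemma mem_frontier_of_closure {A : Set Phase} {x : Phase} (h : x ∈ closure A) (h' : x ∉ A) :
    x ∈ frontier A := ⟨h, fun hi => h' (interior_subset hi)⟩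

lemma tendsto_add_right (x v : Phase) : Tendsto (fun b : ℝ => x + b • v) (𝓝[>] 0) (𝓝 x) := by
  have : Continuous fun b : ℝ => x + b • v := by fun_prop
  simpa using (this.tendsto 0).mono_left nhdsWithin_le_nhds

/-- A point of `{u > 0}` that tends to the origin is a common boundary point of the two regions, if
the points slightly above it in the `p` direction and slightly below it in the `q` direction
emanate from `lineMinusU`. -/
lemma mem_frontiers {ε : ℝ} (hε : 0 < ε) {x : Phase} (hu : 0 < x.1)
    (hx : x ∈ terminatesAt ε {0})
    (hup : ∀ᶠ b : ℝ in 𝓝[>] 0, x + b • ((0, 1, 0) : Phase) ∈ emanatesFrom ε lineMinusU)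
    (hdown : ∀ᶠ b : ℝ in 𝓝[>] 0, x + b • ((0, 0, -1) : Phase) ∈ emanatesFrom ε lineMinusU) :
    x ∈ frontier (region1 ε) ∩ frontier (region2 ε) := by
  obtain ⟨hn1, hn2⟩ := notMem_of_terminatesAt_zero hx
  rw [region1_eq, region2_eq]
  refine ⟨mem_frontier_of_closure ?_ fun h => hn1 h.2, mem_frontier_of_closure ?_ fun h => hn2 h.2⟩
  · refine mem_closure_of_tendsto (tendsto_add_right x (0, 1, 0)) ?_
    filter_upwards [hup, (tendsto_add_right x (0, 1, 0)).eventually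
      (eventually_above_mem_terminatesAt hε hu hx), self_mem_nhdsWithin] with b h1 h2 hb
    exact ⟨h1, h2 (by simp) (by simpa using hb) (by simp)⟩
  · refine mem_closure_of_tendsto (tendsto_add_right x (0, 0, -1)) ?_
    filter_upwards [hdown, (tendsto_add_right x (0, 0, -1)).eventually
      (eventually_below_mem_terminatesAt hε hu hx), self_mem_nhdsWithin] with b h1 h2 hb
    refine ⟨h1, h2 ?_ (by simp) (by simp) (by simpa using hb)⟩
    simpa [halfSpace] using hu.le

/-- The stable manifold is the boundary between the classes 1 and 2; time reversal turns this into
the statement about the unstable manifold. -/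
lemma isBoundaryBetween_stableManifold {ε : ℝ} (hε : 0 < ε) :
    IsBoundaryBetween (stableManifold ε (gammaMinus ε)) (region1 ε) (region2 ε)
      (emanatesFrom ε lineMinusU) (equilibria ε) := by
  have hcl : ∀ x ∈ closure (terminatesAt ε linePlusS), x ∉ equilibria ε →
      x ∉ stableManifold ε (gammaMinus ε) → x ∈ terminatesAt ε linePlusS := fun x hx hE hW =>
    (mem_of_mem_closure_terminatesAt hε hx hE).resolve_right fun h =>
      hW (mem_stableManifold_of_terminatesAt_zero h)
  have hr2 : region2 ε ⊆ terminatesAt ε linePlusS := by rw [region2_eq]; exact inter_subset_right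
  have hr1 : region1 ε ⊆ terminatesAt ε lineMinusS := by rw [region1_eq]; exact inter_subset_right
  refine ⟨?_, ?_, ?_, ?_⟩
  · exact disjoint_left.2 fun x h1 h2 => notMem_lineMinusS_of_linePlusS (hr2 h2) (hr1 h1)
  · rintro x ⟨⟨hx1, hx2⟩, hE⟩
    by_contra hW
    have hx := hcl x (closure_mono hr2 (frontier_subset_closure hx2)) hE hW
    obtain ⟨y, hy1, hy2⟩ := ((mem_closure_iff_frequently.1
      (closure_mono hr1 (frontier_subset_closure hx1))).and_eventually
      (eventually_mem_terminatesAt_linePlusS hε hx)).exists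
    exact notMem_lineMinusS_of_linePlusS (hy2 (terminatesAt_subset_halfSpace hy1)) hy1
  · rintro x ⟨hW, hD⟩
    have hu := u_pos_of_mem_stableManifold hε hW hD
    refine mem_frontiers hε hu (terminatesAt_zero_of_mem_stableManifold hε hu hW) ?_ ?_
    · filter_upwards [(tendsto_add_right x (0, 1, 0)).eventually
        (eventually_mem_emanatesFrom hε hD)] with b hb
      exact hb (by simpa [halfSpace] using hu.le)
    · filter_upwards [(tendsto_add_right x (0, 0, -1)).eventually
        (eventually_mem_emanatesFrom hε hD)] with b hb
      exact hb (by simpa [halfSpace] using hu.le)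
  · -- off the stable manifold, `terminatesAt ε linePlusS` is relatively open and closed in `T`
    rintro T hT hTD ⟨x, hxT, hx⟩ ⟨y, hyT, hy⟩
    by_contra hne
    have hW : ∀ z ∈ T, z ∉ stableManifold ε (gammaMinus ε) := fun z hz hzW => hne ⟨z, hz, hzW⟩
    have hTh : T ⊆ halfSpace := by
      intro z hz
      have := (mem_emanatesFrom_lineMinusU_iff.1 (hTD hz).1)
      have h2 : reversal z ∈ halfSpace := terminatesAt_subset_halfSpace this
      exact h2
    set U : Set Phase := interior {z | z ∈ halfSpace → z ∈ terminatesAt ε linePlusS} with hU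
    have hTU : ∀ z ∈ T, z ∈ terminatesAt ε linePlusS → z ∈ U := fun z _ hz =>
      mem_interior_iff_mem_nhds.2 (eventually_mem_terminatesAt_linePlusS hε hz)
    obtain ⟨z, hzT, hzU, hzV⟩ := hT U (closure (terminatesAt ε linePlusS))ᶜ isOpen_interior
      isClosed_closure.isOpen_compl (fun z hz => by
        by_cases h : z ∈ closure (terminatesAt ε linePlusS)
        · exact Or.inl (hTU z hz (hcl z h (hTD hz).2 (hW z hz)))
        · exact Or.inr h) ⟨y, hyT, hTU y hyT (hr2 hy)⟩
      ⟨x, hxT, fun h => notMem_lineMinusS_of_linePlusS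
        (hcl x h (hTD hxT).2 (hW x hxT)) (hr1 hx)⟩
    exact hzV (subset_closure (interior_subset hzU (hTh hzT)))

/-- The algebraic solution, for `y < 0`, reaches the origin as the desingularized time tends to
`+∞`. -/
lemma algebraicSolution_terminatesAt_zero {ε : ℝ} (hε : 0 < ε) {y : ℝ} (hy : y < 0) :
    algebraicSolution ε y ∈ terminatesAt ε {0} := by
  have hs : 0 < √ε := Real.sqrt_pos.2 hε
  set c := -(√ε / 12 * y) with hc
  have hc0 : 0 < c := by
    have := mul_neg_of_pos_of_neg (show 0 < √ε / 12 by positivity) hy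
    linarith
  -- the solution of `Y' = √ε Y² / 12` with `Y 0 = y`
  set Y : ℝ → ℝ := fun t => y / (1 + c * t) with hY
  have hYd : ∀ t ∈ Ici (0 : ℝ), HasDerivAt Y (√ε / 12 * Y t ^ 2) t := by
    intro t ht
    have ht0 : (0 : ℝ) ≤ t := ht
    have hne : 1 + c * t ≠ 0 := by positivity
    refine ((hasDerivAt_const t y).fun_div (((hasDerivAt_id t).const_mul c).const_add 1)
      hne).congr_deriv ?_
    simp only [hY, hc] at hne ⊢
    field_simp
    simp
  refine ⟨fun t => algebraicSolution ε (Y t), fun t ht => ⟨?_, ?_⟩, by simp [hY], 0, rfl, ?_⟩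
  · have h1 := hYd t ht
    refine HasDerivAt.hasDerivWithinAt ?_
    refine (((h1.fun_pow 2).const_mul (1 / 12 * √ε)).prodMk ((h1.const_mul (1 / 6)).prodMk
      ((h1.fun_pow 3).const_mul (1 / 36 * √ε)))).congr_deriv ?_
    simp only [field, algebraicSolution, Prod.mk.injEq]
    push_cast
    refine ⟨by ring, by ring, by ring⟩
  · simp only [halfSpace, algebraicSolution, mem_ofPred_eq]
    positivity
  · have h1 : Tendsto Y atTop (𝓝 0) :=
      Tendsto.div_atTop tendsto_const_nhds
        (tendsto_atTop_add_const_left _ _ (tendsto_id.const_mul_atTop hc0))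
    have h2 : Continuous (algebraicSolution ε) := by unfold algebraicSolution; fun_prop
    have h3 := (h2.tendsto 0).comp h1
    have h4 : algebraicSolution ε 0 = 0 := by simp [algebraicSolution]
    rwa [h4] at h3

/-- Near the branch `y < 0` of the algebraic solution, the points slightly above it in the `p`
direction and those below it in the `q` direction emanate from `lineMinusU`: their reversals lie
on the lower side of the other branch. -/
lemma algebraicSolution_add_mem_emanatesFrom {ε : ℝ} (hε : 0 < ε) {y : ℝ} (hy : y < 0) :
    (∀ᶠ b : ℝ in 𝓝[>] 0,
      algebraicSolution ε y + b • ((0, 1, 0) : Phase) ∈ emanatesFrom ε lineMinusU) ∧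
    ∀ᶠ b : ℝ in 𝓝[>] 0,
      algebraicSolution ε y + b • ((0, 0, -1) : Phase) ∈ emanatesFrom ε lineMinusU := by
  have hs : 0 < √ε := Real.sqrt_pos.2 hε
  have hy2 : 0 < √ε * y ^ 2 := by have := sq_pos_of_neg hy; positivity
  have hy3 : √ε * y ^ 3 < 0 := mul_neg_of_pos_of_neg hs (Odd.pow_neg (by decide) hy)
  constructor
  · filter_upwards [self_mem_nhdsWithin,
      mem_nhdsWithin_of_mem_nhds (Iio_mem_nhds (show 0 < -(1 / 6 * y) by linarith))] with b hb hb'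
    have hb0 : 0 < b := hb
    have hb1 : b < -(1 / 6 * y) := hb'
    rw [mem_emanatesFrom_lineMinusU_iff]
    refine mem_terminatesAt_of_defects hε ?_ ?_ ?_ ?_ ?_ ?_ <;>
      simp [reversal, algebraicSolution, defectK, defectL, defectM]
    · linarith
    · linarith
    · linarith
    · exact le_of_eq (by ring)
    · have := mul_pos hb0 hy2
      linarith
    · have h1 : b * (2 * (1 / 6 * y) + b) ≤ 0 :=
        mul_nonpos_of_nonneg_of_nonpos hb0.le (by linarith)
      have h2 := mul_nonpos_of_nonneg_of_nonpos hs.le h1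
      linarith
  · filter_upwards [self_mem_nhdsWithin] with b hb
    have hb0 : 0 < b := hb
    rw [mem_emanatesFrom_lineMinusU_iff]
    refine mem_terminatesAt_of_defects hε ?_ ?_ ?_ ?_ ?_ ?_ <;>
      simp [reversal, algebraicSolution, defectK, defectL, defectM]
    · linarith
    · linarith
    · linarith
    · have h1 := mul_nonneg hs.le (mul_nonneg hb0.le (neg_nonneg.2 hy3.le))
      have h2 := mul_nonneg hs.le (sq_nonneg b)
      linarith
    · linarith
    · linarith

lemma algebraicSolution_mem_frontiers {ε : ℝ} (hε : 0 < ε) {y : ℝ} (hy : y < 0) :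
    algebraicSolution ε y ∈ frontier (region1 ε) ∩ frontier (region2 ε) := by
  have hu : 0 < (algebraicSolution ε y).1 := by
    have hs : 0 < √ε := Real.sqrt_pos.2 hε
    have := sq_pos_of_neg hy
    simp only [algebraicSolution]
    positivity
  exact mem_frontiers hε hu (algebraicSolution_terminatesAt_zero hε hy)
    (algebraicSolution_add_mem_emanatesFrom hε hy).1
    (algebraicSolution_add_mem_emanatesFrom hε hy).2

/-- For `y < 0` the points of `gammaMinus` are limits of both classes; the origin, at `y = 0`,
follows by closedness. -/
lemma gammaMinus_subset {ε : ℝ} (hε : 0 < ε) :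
    gammaMinus ε ⊆
      stableManifold ε (gammaMinus ε) ∩ frontier (region1 ε) ∩ frontier (region2 ε) := by
  rintro _ ⟨y, hy, rfl⟩
  have hfr : algebraicSolution ε y ∈ frontier (region1 ε) ∩ frontier (region2 ε) := by
    have hc : Continuous (algebraicSolution ε) := by unfold algebraicSolution; fun_prop
    have hm : MapsTo (algebraicSolution ε) (Iio 0) (frontier (region1 ε) ∩ frontier (region2 ε)) :=
      fun y hy => algebraicSolution_mem_frontiers hε hy
    have := hm.closure hc
    rw [closure_Iio, (isClosed_frontier.inter isClosed_frontier).closure_eq] at this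
    exact this hy
  refine ⟨⟨?_, hfr.1⟩, hfr.2⟩
  rcases (show y ≤ 0 from hy).eq_or_lt with h | h
  · have h0 : algebraicSolution ε y = 0 := by simp [h, algebraicSolution]
    rw [h0]
    refine mem_stableManifold_of_terminatesAt_zero ⟨fun _ => 0, fun t _ => ⟨?_, le_refl (0 : ℝ)⟩,
      rfl, 0, rfl, tendsto_const_nhds⟩
    have h0 : field ε 0 = 0 := by simp [field]
    rw [h0]
    exact hasDerivWithinAt_const t (Ici 0) (0 : Phase)
  · exact mem_stableManifold_of_terminatesAt_zero (algebraicSolution_terminatesAt_zero hε h)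

/-- Each region contains a point with `u > 0`, hence an orbit in `{u > 0}`. -/
lemma exists_connects_u_pos {ε : ℝ} (hε : 0 < ε) {A B : Set Phase}
    (h : algebraicSolution ε (-1) ∈ closure {x | ∃ γ, Connects ε A B γ ∧ x ∈ range γ}) :
    ∃ γ, Connects ε A B γ ∧ ∀ t, 0 < (γ t).1 := by
  have hs : 0 < √ε := Real.sqrt_pos.2 hε
  have hU : IsOpen {x : Phase | 0 < x.1} := isOpen_lt (by fun_prop) (by fun_prop)
  obtain ⟨x, hx, γ, hγ, t, rfl⟩ := mem_closure_iff.1 h _ hU (by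
    simp only [algebraicSolution, mem_ofPred_eq]
    positivity)
  exact ⟨γ, hγ, hγ.1.u_pos_univ hx⟩

/-! ### Exclusion of further connections -/

/-- A solution that tends, as time tends to `-∞`, to an equilibrium with `p = -|q| < 0` is
constant. -/
lemma eq_of_tendsto_atBot {ε : ℝ} (hε : 0 < ε) {γ : ℝ → Phase} {a : Phase}
    (h : IsSolutionOn ε univ γ) (ha1 : a.1 = 0) (ha2 : a.2.1 ^ 2 = a.2.2 ^ 2) (ha3 : a.2.1 < 0)
    (hl : Tendsto γ atBot (𝓝 a)) : ∀ t, γ t = a := by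
  have hs : 0 < √ε := Real.sqrt_pos.2 hε
  have hlu : Tendsto (fun t => (γ t).1) atBot (𝓝 0) := by
    rw [← ha1]; exact (continuous_fst.tendsto _).comp hl
  have hlp : Tendsto (fun t => (γ t).2.1) atBot (𝓝 a.2.1) :=
    ((continuous_fst.comp continuous_snd).tendsto _).comp hl
  have hlq : Tendsto (fun t => (γ t).2.2) atBot (𝓝 a.2.2) :=
    ((continuous_snd.comp continuous_snd).tendsto _).comp hl
  obtain ⟨T, hT⟩ := eventually_atBot.1 (hlp.eventually (Iio_mem_nhds ha3))
  have hsol : ∀ a b, IsSolutionOn ε (Icc a b) γ := fun a b => h.mono (subset_univ _)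
  have hu : ∀ t, (γ t).1 = 0 := by
    intro t
    have h1 : (γ (min t T)).1 ≤ 0 := by
      refine ge_of_tendsto hlu ((eventually_le_atBot (min t T)).mono fun r hr => ?_)
      exact (hsol r (min t T)).antitoneOn_u
        (fun q hq => le_of_lt (hT q (hq.2.trans (min_le_right _ _))))
        ⟨le_rfl, hr⟩ ⟨hr, le_rfl⟩ hr
    have h2 := le_antisymm h1 (h.nonneg (mem_univ _))
    exact (hsol (min t T) t).u_eq_zero h2 t ⟨min_le_left _ _, le_rfl⟩
  have hq : ∀ t, (γ t).2.2 = a.2.2 := by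
    intro t
    refine tendsto_nhds_unique (tendsto_const_nhds.congr'
      ((eventually_le_atBot t).mono fun r hr => ?_)) hlq
    exact (h.mono (subset_univ (Ici r))).q_eq_of_u_eq_zero (hu r) hr
  have hd : ∀ b c : ℝ, ∀ r ∈ Icc b c, HasDerivWithinAt (fun t => (γ t).2.1 - a.2.1)
      (1 / 2 * √ε * ((γ r).2.1 + a.2.1) * ((γ r).2.1 - a.2.1)) (Icc b c) r := by
    intro b c r hr
    refine (((hsol b c).deriv_p hr).sub_const a.2.1).congr_deriv ?_
    rw [hu r, hq r, ← ha2]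
    ring
  have hp : ∀ t, (γ t).2.1 - a.2.1 = 0 := by
    intro t
    have h1 : ((γ (min t T)).2.1 - a.2.1) ^ 2 ≤ 0 := by
      have hlp2 : Tendsto (fun r => ((γ r).2.1 - a.2.1) ^ 2) atBot (𝓝 0) := by
        simpa using (hlp.sub_const a.2.1).pow 2
      refine ge_of_tendsto hlp2 ((eventually_le_atBot (min t T)).mono fun r hr => ?_)
      refine antitoneOn_Icc_of_deriv (fun q hq => (hd r (min t T) q hq).fun_pow 2)
        (fun q hq => ?_) ⟨le_rfl, hr⟩ ⟨hr, le_rfl⟩ hr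
      have h2 : (γ q).2.1 < 0 := hT q (hq.2.trans (min_le_right _ _))
      have h3 : 0 ≤ √ε * -((γ q).2.1 + a.2.1) := mul_nonneg hs.le (by linarith)
      have h4 := mul_nonneg h3 (sq_nonneg ((γ q).2.1 - a.2.1))
      push_cast
      linarith
    have h2 : (γ (min t T)).2.1 - a.2.1 = 0 :=
      (pow_eq_zero_iff two_ne_zero).1 (le_antisymm h1 (sq_nonneg _))
    exact eq_zero_of_deriv_eq_mul (A := fun r => 1 / 2 * √ε * ((γ r).2.1 + a.2.1))
      (hd (min t T) t)
      (continuousOn_const.mul ((hsol (min t T) t).cont_p.add continuousOn_const)) h2 t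
      ⟨min_le_left _ _, le_rfl⟩
  intro t
  exact Prod.ext (by rw [hu t, ha1]) (Prod.ext (by linarith [hp t]) (hq t))

lemma class_of_connects {ε : ℝ} (hε : 0 < ε) {γ : ℝ → Phase}
    (h : Connects ε (lineMinusU ∪ lineMinusS ∪ linePlusU ∪ linePlusS)
      (lineMinusU ∪ lineMinusS ∪ linePlusU ∪ linePlusS) γ) (hne : ∃ t t', γ t ≠ γ t') :
    IsClass1 ε γ ∨ IsClass2 ε γ ∨ IsClass3 ε γ := by
  obtain ⟨hγ, a, ha, b, hb, hla, hlb⟩ := h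
  obtain ⟨t, t', htt'⟩ := hne
  have hconst : ∀ c, ¬ ∀ t, γ t = c := fun c hc => htt' ((hc t).trans (hc t').symm)
  have ha' : a ∈ lineMinusU ∨ a ∈ linePlusU := by
    rcases ha with ((ha | ha) | ha) | ha
    · exact Or.inl ha
    · obtain ⟨⟨h1, h2⟩, h3⟩ := ha
      exact absurd (eq_of_tendsto_atBot hε hγ h1 (by rw [h2]; ring) (by linarith) hla) (hconst _)
    · exact Or.inr ha
    · obtain ⟨⟨h1, h2⟩, h3⟩ := ha
      exact absurd (eq_of_tendsto_atBot hε hγ h1 (by rw [h2]) (by linarith) hla) (hconst _)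
  have hrev : b.1 = 0 → b.2.1 ^ 2 = b.2.2 ^ 2 → ¬ 0 < b.2.1 := by
    intro h1 h2 h3
    have h4 := eq_of_tendsto_atBot hε (hγ.reverse (J' := univ) fun _ _ => mem_univ _)
      (a := reversal b) h1 (by simpa [reversal] using h2) (by simpa [reversal] using h3)
      ((continuous_reversal.tendsto b).comp (hlb.comp tendsto_neg_atBot_atTop))
    refine hconst b fun t => ?_
    have := h4 (-t)
    rw [neg_neg] at this
    rw [← reversal_reversal (γ t), this, reversal_reversal]
  have hb' : b ∈ lineMinusS ∨ b ∈ linePlusS := by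
    rcases hb with ((hb | hb) | hb) | hb
    · obtain ⟨⟨h1, h2⟩, h3⟩ := hb
      exact absurd (by linarith) (hrev h1 (by rw [h2]; ring))
    · exact Or.inl hb
    · obtain ⟨⟨h1, h2⟩, h3⟩ := hb
      exact absurd (by linarith) (hrev h1 (by rw [h2]))
    · exact Or.inr hb
  rcases ha' with ha' | ha' <;> rcases hb' with hb' | hb'
  · exact Or.inl ⟨hγ, a, ha', b, hb', hla, hlb⟩
  · exact Or.inr (Or.inl ⟨hγ, a, ha', b, hb', hla, hlb⟩)
  · exact Or.inr (Or.inr ⟨hγ, a, ha', b, hb', hla, hlb⟩)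
  · -- `q` cannot decrease
    exfalso
    have hlq : Tendsto (fun t => (γ t).2.2) atBot (𝓝 a.2.2) :=
      ((continuous_snd.comp continuous_snd).tendsto _).comp hla
    have h1 : a.2.2 ≤ (γ 0).2.2 := le_of_tendsto hlq ((eventually_le_atBot 0).mono fun r hr =>
      (hγ.mono (subset_univ (Ici r))).q_le_q le_rfl hr)
    have h2 := (hγ.mono (subset_univ (Ici 0))).q_le_of_tendsto hlb le_rfl
    linarith [ha'.2, hb'.2]

theorem proposition6p2 (ε : ℝ) (hε : 0 < ε) :
    -- each class contains heteroclinics that lie in the open half-space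
    (∃ γ, IsClass1 ε γ ∧ ∀ t, 0 < (γ t).1) ∧
    (∃ γ, IsClass2 ε γ ∧ ∀ t, 0 < (γ t).1) ∧
    (∃ γ, IsClass3 ε γ ∧ ∀ t, 0 < (γ t).1) ∧
    -- there are no further classes
    (∀ γ, Connects ε (lineMinusU ∪ lineMinusS ∪ linePlusU ∪ linePlusS)
        (lineMinusU ∪ lineMinusS ∪ linePlusU ∪ linePlusS) γ →
      (∃ t t', γ t ≠ γ t') → IsClass1 ε γ ∨ IsClass2 ε γ ∨ IsClass3 ε γ) ∧
    -- the stable manifold is the boundary between class 1 and class 2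
    IsBoundaryBetween (stableManifold ε (gammaMinus ε)) (region1 ε) (region2 ε)
      (emanatesFrom ε lineMinusU) (equilibria ε) ∧
    gammaMinus ε ⊆
      stableManifold ε (gammaMinus ε) ∩ frontier (region1 ε) ∩ frontier (region2 ε) ∧
    -- the unstable manifold is the boundary between class 1 and class 3
    IsBoundaryBetween (unstableManifold ε (gammaPlus ε)) (region1 ε) (region3 ε)
      (terminatesAt ε lineMinusS) (equilibria ε) ∧
    gammaPlus ε ⊆
      unstableManifold ε (gammaPlus ε) ∩ frontier (region1 ε) ∩ frontier (region3 ε) := by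
  have hfr := algebraicSolution_mem_frontiers hε (show (-1 : ℝ) < 0 by norm_num)
  obtain ⟨γ2, hγ2, hpos2⟩ := exists_connects_u_pos hε (frontier_subset_closure hfr.2)
  refine ⟨exists_connects_u_pos hε (frontier_subset_closure hfr.1), ⟨γ2, hγ2, hpos2⟩,
    ⟨_, isClass3_reverse hγ2, fun t => hpos2 (-t)⟩, fun γ h hne => class_of_connects hε h hne,
    isBoundaryBetween_stableManifold hε, gammaMinus_subset hε, ?_, ?_⟩
  · rw [unstableManifold_eq_reversal_preimage, region1_eq_reversal_preimage,
      region3_eq_reversal_preimage, terminatesAt_eq_reversal_preimage,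
      equilibria_eq_reversal_preimage]
    exact (isBoundaryBetween_stableManifold hε).reversal_preimage
  · rw [unstableManifold_eq_reversal_preimage, region1_eq_reversal_preimage,
      region3_eq_reversal_preimage, frontier_reversal_preimage, frontier_reversal_preimage,
      gammaPlus_eq_reversal_preimage]
    exact fun x hx => gammaMinus_subset hε hx
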